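/- **Corollary (preservation of correctness).** Let $G$ be a proof net and let $G\to G'$ be a step of cut elimination. Then $G'$ is a correct net. Here the notions are the following. *Terms.* $t,s ::= x\mid \lambda x.t\mid v\,s\mid t[x/s]$ with values $v::=x\mid\lambda x.t$; in $\lambda x.t$ and $t[x/s]$ the variable $x$ is bound in $t$. *Nets.* Nodes are $e$-nodes or $m$-nodes, and variable names are used as names of $e$-nodes. Links are: $!$ (source an $e$-node, target an $m$-node); $\mathsf d$ (source an $m$-node, target an $e$-node); $\mathsf w$ (no source, target an $e$-node); par (sources an $m$-node and an $e$-node $x$, its variable; target an $e$-node $r$); $\otimes$ (source an $e$-node; targets an $m$-node and an $e$-node). In a hypergraph of such links, a source (target) is a node without incoming (outgoing) links, an internal node is neither, and the free variables are the targets. A *net* is a finite such hypergraph without isolated nodes, with a root and with a box for each par-link, such that: the root is an $e$-node that is a source; all links whose target is a free variable are $\mathsf d$- or $\mathsf w$-links; every $m$-node has exactly one incoming and one outgoing link; every $e$-node has at most one outgoing link, and if it has several incoming links they are all $\mathsf d$-links. The box of a par-link $l$ with variable $x$ and target $r$ is a sub-hypergraph that is itself a net with root $r$ (its par-links inherit their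 boxes), $x$ is one of its free variables, and no other free variable of it is the target of a weakening in the box; if two boxes intersect and neither contains the other, the nodes they share are free variables of both; every link of the net whose target is $x$ or an internal $e$-node of the box belongs to the box. *Correctness.* The correction graph of $G$ is obtained by replacing each par-link contained in no box, together with its box, by a $\square$-link from its $m$-node to the free variables of the box other than the variable of the par-link. A net is *correct* if in its correction graph the root is the only $e$-node without incoming links, there is no directed cycle, and (recursively) each of its boxes is correct. *Proof nets.* For a finite set $X$ of variables, $[\![t]\!]_X$ is $[\![t]\!]$ plus a weakening on each $y\in X$ not free in $t$. The translation $[\![t]\!]$ (for terms whose bound variables are pairwise distinct and distinct from the free ones, with all other nodes chosen fresh, so that distinct parts share only the nodes named by their common free variables) is: $[\![x]\!]$ is a $!$-link from the root to an $m$-node $a$ and a $\mathsf d$-link from $a$ to $x$; $[\![\lambda x.t]\!]$ is a $!$-link from the root to $a$, and a par-link with $m$-node $a$, variable $x$ and box $[\![t]\!]_{\{x\}}$, whose target is the root of the box; $[\![v\,s]\!]$ is $[\![s]\!]$ together with a $\otimes$-link from the root to $a$ and to the root of $[\![s]\!]$, where $a$ carries the $\mathsf d$-link, or the par-link with its box,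 of $v$; $[\![t[x/s]]\!]$ is the union of $[\![t]\!]_{\{x\}}$ and $[\![s]\!]$ with the root of $[\![s]\!]$ identified with $x$, and its root is that of $[\![t]\!]$. A *proof net* is a $[\![t]\!]_X$. *Cut elimination.* A step can be performed anywhere, also inside boxes. Multiplicative: if an $m$-node $a$ is the target of a $\otimes$-link with source $s$ and $e$-target $u$, and a source of a par-link with variable $x$ and target $r$, both links are removed, $r$ is merged with $s$ and $x$ with $u$, and the box of the par-link is opened. Exponential: let $x$ be the source of a $!$-link with target $a$, and let $H$ be the $\mathsf d$-link with source $a$, or the par-link with source $a$ together with its box; the targets of $H$ are its nodes without outgoing link in $H$. If the links into $x$ are $k\ge1$ $\mathsf d$-links, the $!$-link, these $\mathsf d$-links and $H$ are removed and $k$ copies of $H$ are added, one in the place of each removed $\mathsf d$-link, with $a$ renamed to the source of that link and inside all the boxes containing that link; the copies share the targets of $H$, all other nodes are copied, and the boxes in $H$ are copied along. If the link into $x$ is a weakening, it is removed with the $!$-link and $H$, and each target of $H$ that is no longer the target of any link receives a weakening, placed at the level of $H$ and pushed out of all the boxes of which that node is a free variable other than the variable of their par-link. -/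

import Mathlib

namespace CBVNet

/-! ## Terms of the value substitution kernel -/

/-- Terms `t ::= x | λx.t | v s | t[x/s]` with `v ::= x | λx.t`. Since the left subterm of an
application is a value, application is split into its two cases `x s` and `(λx.t) s`. -/
inductive Term where
  | var (x : ℕ)
  | lam (x : ℕ) (t : Term)
  | appVar (x : ℕ) (s : Term)
  | appLam (x : ℕ) (t : Term) (s : Term)
  | esub (t : Term) (x : ℕ) (s : Term)

/-- Free variables of a term. -/
def Term.fv : Term → Set ℕ
  | .var x => {x}
  | .lam x t => t.fv \ {x}
  | .appVar x s => {x} ∪ s.fv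
  | .appLam x t s => (t.fv \ {x}) ∪ s.fv
  | .esub t x s => (t.fv \ {x}) ∪ s.fv

/-! ## Hypergraphs -/

/-- Nodes, of exponential or of multiplicative type. The names of `e`-nodes are also the
variable names of terms. -/
inductive Node where
  | e (x : ℕ)
  | m (a : ℕ)

/-- Links (directed hyperedges). An argument `r`, `x`, `u` is the name of an `e`-node, an
argument `a` is the name of an `m`-node.

A link is identified with its label and its endpoints. Nothing is lost for nets: there an
`m`-node has one incoming and one outgoing link, an `e`-node at most one outgoing link, and a
weakening is never contracted, so a net has no two parallel links with the same label. -/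
inductive Link where
  /-- `!`: source the `e`-node `r`, target the `m`-node `a`. -/
  | bang (r a : ℕ)
  /-- Dereliction: source the `m`-node `a`, target the `e`-node `x`. -/
  | der (a x : ℕ)
  /-- Weakening: no source, target the `e`-node `x`. -/
  | weak (x : ℕ)
  /-- `⅋`: sources the `m`-node `a` and the `e`-node `x` (its variable), target the `e`-node `r`
  (the root of its box). -/
  | par (a x r : ℕ)
  /-- `⊗`: source the `e`-node `r`, targets the `m`-node `a` and the `e`-node `u`. -/
  | tens (r a u : ℕ)

/-- Sources of a link. -/
def Link.src : Link → Set Node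
  | .bang r _ => {.e r}
  | .der a _ => {.m a}
  | .weak _ => ∅
  | .par a x _ => {.m a, .e x}
  | .tens r _ _ => {.e r}

/-- Targets of a link. -/
def Link.tgt : Link → Set Node
  | .bang _ a => {.m a}
  | .der _ x => {.e x}
  | .weak x => {.e x}
  | .par _ _ r => {.e r}
  | .tens _ a u => {.m a, .e u}

def Link.IsDer (l : Link) : Prop := ∃ a x, l = .der a x
def Link.IsWeak (l : Link) : Prop := ∃ x, l = .weak x
def Link.IsPar (l : Link) : Prop := ∃ a x r, l = .par a x r

/-- Renaming of the nodes of a link. -/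
def Link.map (f g : ℕ → ℕ) : Link → Link
  | .bang r a => .bang (f r) (g a)
  | .der a x => .der (g a) (f x)
  | .weak x => .weak (f x)
  | .par a x r => .par (g a) (f x) (f r)
  | .tens r a u => .tens (f r) (g a) (f u)

/-- The nodes of the hypergraph with set of links `L`. There are no isolated nodes in a net, so
a hypergraph is given by its links, the nodes being their endpoints. -/
def nodes (L : Set Link) : Set Node := {v | ∃ l ∈ L, v ∈ l.src ∨ v ∈ l.tgt}

/-- Names of the `e`-nodes. -/
def eNodes (L : Set Link) : Set ℕ := {x | Node.e x ∈ nodes L}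

/-- Names of the `m`-nodes. -/
def mNodes (L : Set Link) : Set ℕ := {a | Node.m a ∈ nodes L}

/-- A source of a hypergraph: a node without incoming links. -/
def IsSource (L : Set Link) (v : Node) : Prop := v ∈ nodes L ∧ ∀ l ∈ L, v ∉ l.tgt

/-- A target of a hypergraph: a node without outgoing links. -/
def IsTarget (L : Set Link) (v : Node) : Prop := v ∈ nodes L ∧ ∀ l ∈ L, v ∉ l.src

/-- An internal node: neither a source nor a target. -/
def IsInternal (L : Set Link) (v : Node) : Prop :=
  v ∈ nodes L ∧ ¬ IsSource L v ∧ ¬ IsTarget L v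

/-- The free variables: the `e`-nodes that are targets (in a net, these are all the targets,
since `m`-nodes have an outgoing link). -/
def freeVars (L : Set Link) : Set ℕ := {x | IsTarget L (.e x)}

/-! ## Nets -/

/-- The data of a net: a hypergraph, a root, and an assignment of a sub-hypergraph (the box) to
the `⅋`-links. The value of `box` is relevant only on the `⅋`-links in `links`. -/
structure PreNet where
  links : Set Link
  root : ℕ
  box : Link → Set Link

/-- The box of the link `par a x r` as a net in its own right: its root is `r`, and the
`⅋`-links in it inherit their boxes. -/
def PreNet.boxNet (G : PreNet) (a x r : ℕ) : PreNet where
  links := G.box (.par a x r)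
  root := r
  box := G.box

/-- The conditions on the hypergraph of a net and on its root. -/
structure PreNet.GraphConditions (G : PreNet) : Prop where
  finite : G.links.Finite
  root : IsSource G.links (.e G.root)
  conclusions : ∀ x ∈ freeVars G.links, ∀ l ∈ G.links, Node.e x ∈ l.tgt → l.IsDer ∨ l.IsWeak
  multiplicative : ∀ a ∈ mNodes G.links,
    (∃! l, l ∈ G.links ∧ Node.m a ∈ l.tgt) ∧ (∃! l, l ∈ G.links ∧ Node.m a ∈ l.src)
  exp_out : ∀ x, ∀ l ∈ G.links, ∀ l' ∈ G.links, Node.e x ∈ l.src → Node.e x ∈ l'.src → l = l'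
  exp_in : ∀ x, ∀ l ∈ G.links, ∀ l' ∈ G.links, Node.e x ∈ l.tgt → Node.e x ∈ l'.tgt →
    l ≠ l' → l.IsDer ∧ l'.IsDer

/-- The conditions on the boxes of a net, apart from boxes being nets. -/
structure PreNet.BoxConditions (G : PreNet) : Prop where
  /-- The variable of a `⅋`-link is a free variable of its box. -/
  variable_mem : ∀ a x r, Link.par a x r ∈ G.links → x ∈ freeVars (G.box (.par a x r))
  /-- A box does not close on weakenings, except on its variable. -/
  border : ∀ a x r, Link.par a x r ∈ G.links →
    ∀ y ∈ freeVars (G.box (.par a x r)), y ≠ x → Link.weak y ∉ G.box (.par a x r)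
  /-- Boxes that intersect and are not nested share only free variables of both. -/
  nesting : ∀ l₁ ∈ G.links, ∀ l₂ ∈ G.links, l₁.IsPar → l₂.IsPar →
    ¬ G.box l₁ ⊆ G.box l₂ → ¬ G.box l₂ ⊆ G.box l₁ →
    ∀ v ∈ nodes (G.box l₁) ∩ nodes (G.box l₂), ∃ y, v = .e y ∧
      y ∈ freeVars (G.box l₁) ∧ y ∈ freeVars (G.box l₂)
  /-- A link whose target is an `e`-node internal to a box is in the box. The variable of the
  `⅋`-link counts as internal to the box here. -/
  internal_closure : ∀ a x r, Link.par a x r ∈ G.links →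
    ∀ y, IsInternal (G.box (.par a x r)) (.e y) ∨ y = x →
    ∀ l ∈ G.links, Node.e y ∈ l.tgt → l ∈ G.box (.par a x r)
  /-- A box is a sub-hypergraph. -/
  subnet : ∀ a x r, Link.par a x r ∈ G.links → G.box (.par a x r) ⊆ G.links

/-- Nets. The definition is recursive: every box has to be a net. -/
inductive IsNet : PreNet → Prop
  | intro (G : PreNet) (graph : G.GraphConditions) (boxes : G.BoxConditions)
      (recursive : ∀ a x r, Link.par a x r ∈ G.links → IsNet (G.boxNet a x r)) : IsNet G

/-! ## Correctness -/

/-- Links of a correction graph: ordinary links, and `□`-links with one `m`-source and any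
number of `e`-targets. -/
inductive CLink where
  | keep (l : Link)
  | square (a : ℕ) (ys : Set ℕ)

def CLink.src : CLink → Set Node
  | .keep l => l.src
  | .square a _ => {.m a}

def CLink.tgt : CLink → Set Node
  | .keep l => l.tgt
  | .square _ ys => Node.e '' ys

/-- A link is at level 0 if no box contains it. -/
def PreNet.LevelZero (G : PreNet) (l : Link) : Prop :=
  l ∈ G.links ∧ ∀ p ∈ G.links, p.IsPar → l ∉ G.box p

/-- The correction graph: every `⅋`-link at level 0 is collapsed, together with its box, to a
`□`-link from the `m`-node of the `⅋`-link to the free variables of the box other than the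
variable of the `⅋`-link. -/
inductive PreNet.correctionGraph (G : PreNet) : CLink → Prop
  | keep (l : Link) : G.LevelZero l → ¬ l.IsPar → G.correctionGraph (.keep l)
  | square (a x r : ℕ) : G.LevelZero (.par a x r) →
      G.correctionGraph (.square a (freeVars (G.box (.par a x r)) \ {x}))

/-- There is a link of the correction graph with source `u` and target `v`. -/
def PreNet.Arrow (G : PreNet) (u v : Node) : Prop :=
  ∃ l, G.correctionGraph l ∧ u ∈ l.src ∧ v ∈ l.tgt

/-- `e`-nodes of the correction graph without incoming links. -/
def PreNet.IsCorrectionESource (G : PreNet) (x : ℕ) : Prop :=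
  (∃ l, G.correctionGraph l ∧ (Node.e x ∈ l.src ∨ Node.e x ∈ l.tgt)) ∧
    ∀ l, G.correctionGraph l → Node.e x ∉ l.tgt

/-- Correct nets. -/
inductive Correct : PreNet → Prop
  | intro (G : PreNet) (net : IsNet G)
      (source : ∀ x, G.IsCorrectionESource x ↔ x = G.root)
      (acyclic : ∀ v, ¬ Relation.TransGen G.Arrow v v)
      (recursive : ∀ a x r, Link.par a x r ∈ G.links → Correct (G.boxNet a x r)) : Correct G

/-! ## The translation of terms -/

/-- Addition of a weakening for every variable in `X` that is not free in `t`. -/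
def addWeak (L : Set Link) (t : Term) (X : Set ℕ) : Set Link :=
  L ∪ Link.weak '' (X \ t.fv)

/-- `X` meets the hypergraph `L` of `t` only on free variables of `t`. -/
def NoClash (X : Set ℕ) (L : Set Link) (t : Term) : Prop := X ∩ eNodes L ⊆ t.fv

/-- `Trans box t r L`: the net with root `r`, links `L` and boxes given by `box` is a translation
of `t`. The free variables of `t` are `e`-nodes with the same name, and the other nodes are chosen
fresh. The freshness conditions make all bound variables distinct from each other and from the
free ones, so only well-named terms have a translation, and every term is `α`-equivalent to
one that has.

In `lam` and `appLam` the box is the translation of the body with respect to `{x}`; in `esub` the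
root of the translation of the second subterm is the node `x`. -/
inductive Trans (box : Link → Set Link) : Term → ℕ → Set Link → Prop
  | var (x r a : ℕ) : r ≠ x → Trans box (.var x) r {.bang r a, .der a x}
  | lam (x : ℕ) (t : Term) (q : ℕ) (L W : Set Link) (r a : ℕ) :
      Trans box t q L → NoClash {x} L t → W = addWeak L t {x} →
      r ∉ eNodes W → a ∉ mNodes W →
      box (.par a x q) = W →
      Trans box (.lam x t) r ({.bang r a, .par a x q} ∪ W)
  | appVar (x : ℕ) (s : Term) (u : ℕ) (L : Set Link) (r a : ℕ) :
      Trans box s u L → NoClash {x} L s →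
      r ≠ x → r ∉ eNodes L → a ∉ mNodes L →
      Trans box (.appVar x s) r ({.tens r a u, .der a x} ∪ L)
  | appLam (x : ℕ) (t s : Term) (q u : ℕ) (L W L' : Set Link) (r a : ℕ) :
      Trans box t q L → NoClash {x} L t → W = addWeak L t {x} →
      Trans box s u L' →
      eNodes W ∩ eNodes L' ⊆ (t.fv \ {x}) ∩ s.fv → Disjoint (mNodes W) (mNodes L') →
      r ∉ eNodes W → r ∉ eNodes L' → a ∉ mNodes W → a ∉ mNodes L' →
      box (.par a x q) = W →
      Trans box (.appLam x t s) r ({.tens r a u, .par a x q} ∪ W ∪ L')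
  | esub (t : Term) (x : ℕ) (s : Term) (r : ℕ) (L W L' : Set Link) :
      Trans box t r L → NoClash {x} L t → W = addWeak L t {x} →
      Trans box s x L' →
      eNodes W ∩ eNodes L' ⊆ {x} ∪ (t.fv ∩ s.fv) → Disjoint (mNodes W) (mNodes L') →
      Trans box (.esub t x s) r (W ∪ L')

/-- `G` is a translation of `t` with respect to the set of variables `X`: the translation of `t`
plus a weakening for every variable in `X` that is not free in `t`. -/
def IsTranslation (t : Term) (X : Finset ℕ) (G : PreNet) : Prop :=
  ∃ L, Trans G.box t G.root L ∧ NoClash X L t ∧ G.links = addWeak L t X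

/-- A proof net is the translation of a term, with respect to some finite set of variables. -/
def IsProofNet (G : PreNet) : Prop := ∃ t X, IsTranslation t X G

/-! ## Cut elimination -/

/-- The sub-hypergraph `H` below an `m`-node `a` that is the target of a `!`-link, with the set
`ys` of its targets (as a part of the net): it is either a dereliction, or a `⅋`-link with its
box. -/
inductive Content (G : PreNet) (a : ℕ) : Set Link → Set ℕ → Prop
  | der (y : ℕ) : .der a y ∈ G.links → Content G a {.der a y} {y}
  | par (x r : ℕ) : .par a x r ∈ G.links →
      Content G a ({.par a x r} ∪ G.box (.par a x r)) (freeVars (G.box (.par a x r)) \ {x})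

/-- Copies of the hypergraph `H` below `a`, one for every `b ∈ D`: the copy of index `b` renames
`e`-nodes by `f b` and `m`-nodes by `g b`; it renames `a` to `b`, keeps the targets `ys` of
`H`, and gives new names to the other nodes, which differ for distinct copies and from those of
the rest of the net (names of nodes in `H`, which is removed, may be used again). -/
structure IsCopying (G : PreNet) (a : ℕ) (H : Set Link) (ys D : Set ℕ)
    (f g : ℕ → ℕ → ℕ) : Prop where
  top : ∀ b ∈ D, g b a = b
  bottom : ∀ b ∈ D, ∀ y ∈ ys, f b y = y
  e_inj : ∀ b ∈ D, ∀ b' ∈ D, ∀ z ∈ eNodes H \ ys, ∀ z' ∈ eNodes H \ ys,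
    f b z = f b' z' → b = b' ∧ z = z'
  m_inj : ∀ b ∈ D, ∀ b' ∈ D, ∀ c ∈ mNodes H \ {a}, ∀ c' ∈ mNodes H \ {a},
    g b c = g b' c' → b = b' ∧ c = c'
  e_fresh : ∀ b ∈ D, ∀ z ∈ eNodes H \ ys, f b z ∉ eNodes G.links \ (eNodes H \ ys)
  m_fresh : ∀ b ∈ D, ∀ c ∈ mNodes H \ {a}, g b c ∉ mNodes G.links \ (mNodes H \ {a})

/-- One step of cut elimination, anywhere in the net (possibly inside boxes). -/
inductive Step : PreNet → PreNet → Prop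
  /-- Multiplicative cut on `a`: the two links are removed, the root `r` of the box is merged with
  `s`, the variable `x` with the argument `u`, and the box is opened, that is, its links stay in
  all the boxes that contained it. -/
  | mult (G G' : PreNet) (s a u x r : ℕ) (σ : ℕ → ℕ) (K : Set Link)
      (tens_mem : .tens s a u ∈ G.links) (par_mem : .par a x r ∈ G.links)
      (hσ : σ = fun z => if z = r then s else if z = x then u else z)
      (hK : K = G.links \ {.tens s a u, .par a x r})
      (links : G'.links = Link.map σ id '' K)
      (root : G'.root = G.root)
      (box : ∀ p ∈ K, p.IsPar → G'.box (p.map σ id) = Link.map σ id '' (G.box p ∩ K)) :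
      Step G G'
  /-- Exponential cut on `x`, with derelictions (`D` is the set of their sources): the `!`-link,
  the derelictions and `H` are removed, and a copy of `H` is put in the place of each dereliction,
  inside all the boxes that contained that dereliction. The copies share the targets of `H`, and
  a `⅋`-link in a copy has the copy of the box as its box. -/
  | expDer (G G' : PreNet) (x a : ℕ) (H : Set Link) (ys D : Set ℕ) (f g : ℕ → ℕ → ℕ)
      (K : Set Link)
      (bang_mem : .bang x a ∈ G.links) (content : Content G a H ys)
      (hD : D = {b | Link.der b x ∈ G.links}) (nonempty : D.Nonempty)
      (copying : IsCopying G a H ys D f g)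
      (hK : K = G.links \ ({.bang x a} ∪ H ∪ {l | ∃ b ∈ D, l = .der b x}))
      (links : G'.links = K ∪ {l | ∃ b ∈ D, l ∈ Link.map (f b) (g b) '' H})
      (root : G'.root = G.root)
      (box : ∀ p ∈ K, p.IsPar → G'.box p =
        (G.box p ∩ K) ∪ {l | ∃ b ∈ D, .der b x ∈ G.box p ∧ l ∈ Link.map (f b) (g b) '' H})
      (box_copy : ∀ b ∈ D, ∀ p ∈ H, p.IsPar →
        G'.box (p.map (f b) (g b)) = Link.map (f b) (g b) '' G.box p) :
      Step G G'
  /-- Exponential cut on `x`, with a weakening: both links and `H` are erased. Every target of `H`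
  gets a weakening, unless it is still the target of some other link. The new weakenings are
  placed at the level of `H`, and then pushed out of all the boxes of which their node is
  a free variable (other than the variable of the `⅋`-link). -/
  | expWeak (G G' : PreNet) (x a : ℕ) (H : Set Link) (ys Y : Set ℕ) (K : Set Link)
      (bang_mem : .bang x a ∈ G.links) (content : Content G a H ys)
      (weak_mem : .weak x ∈ G.links)
      (hK : K = G.links \ ({.bang x a, .weak x} ∪ H))
      (hY : Y = {y | y ∈ ys ∧ ∀ l ∈ K, Node.e y ∉ l.tgt})
      (links : G'.links = K ∪ Link.weak '' Y)
      (root : G'.root = G.root)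
      (box : ∀ b z q, .par b z q ∈ K → G'.box (.par b z q) =
        (G.box (.par b z q) ∩ K) ∪ {l | ∃ y ∈ Y, l = .weak y ∧ .bang x a ∈ G.box (.par b z q) ∧
          (y ∉ freeVars (G.box (.par b z q)) ∨ y = z)}) :
      Step G G'

end CBVNet

/-!
Correctness is recursive: every box is a net of its own, and every level has a correction graph of
its own. The proof goes through a flat description, `Leveled ∅`, in which every condition concerns
boxes alone, one node, or two adjacent links. The boxes form a forest under inclusion, and if the
link `l` leaves an `e`-node that the link `l'` enters, then each box with `l` in it, or with that
node as its variable, contains `l'` or is the box whose root is entered by `l'`; the converse holds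
unless `l'` is a dereliction. This says that only derelictions leave boxes.
Acyclicity is required of a single relation, the flow, for which all boxes are open: the `m`-node
of a `⅋`-link leads to every node of the box. It contains the arrows of the correction graphs of
the net and of all its boxes.

`Leveled.correct` shows that levelled nets are correct: the conditions pass to boxes
(`Leveled.boxNet`), so only the outermost level has to be considered. `Trans.leveled` shows that
translations of terms are levelled; the constructions of the translation are compositions of four
operations, adding a dereliction, a box, or weakenings, and glueing at an `e`-node. The term is not
used any further.

`Leveled.step` shows that a step of cut elimination preserves levelled nets. For the multiplicative
step the two links of the cut are at the same level, so merging `r` with `s` and `x` with `u`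
matches levels once the opened box is forgotten. The flow remains acyclic since the nodes inside
the opened box all take the place of `s`, where they are ordered as before. For the exponential
steps the part `H` below the `!`-link is at the level of that link, its inner nodes are met by no
link outside `H`, and only derelictions in `H` end on its targets (`ExpCut`). Hence copies of `H`
can be put in the boxes of the derelictions, which contain all boxes of the `!`-link, and every
step of the new flow projects to a path of the old one, through `x` and `a`. When `H` is erased,
the rule for the new weakenings puts them at exactly the level of the outgoing link of their node.
-/

namespace CBVNet

/-! ### Levelled nets -/

/-- The flow of a net with boxes: every link other than a `⅋`-link leads from its sources to its
targets, and the `m`-node of a `⅋`-link leads to every node of the box. All boxes are kept open,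
so that one relation covers the correction graphs of the net and of all its boxes. -/
inductive PreNet.Flow (G : PreNet) : Node → Node → Prop
  | link {u v : Node} (l : Link) : l ∈ G.links → ¬ l.IsPar → u ∈ l.src → v ∈ l.tgt → G.Flow u v
  | box {v : Node} (a x r : ℕ) : Link.par a x r ∈ G.links → v ∈ nodes (G.box (.par a x r)) →
      G.Flow (.m a) v

/-- The box of `p` contains the link `l`, which has the source `v`, or `v` is the variable of
`p = l`. Then every link with target `v` has to be in the box of `p`, or to be `p` itself. -/
def PreNet.OutLevel (G : PreNet) (p : Link) (v : Node) (l : Link) : Prop :=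
  l ∈ G.box p ∨ (l = p ∧ ∃ y, v = .e y)

/-- The link `l` is in the box of `p`, or targets its root. -/
def PreNet.InLevel (G : PreNet) (p l : Link) : Prop := l ∈ G.box p ∨ l = p

/-- A description of correct nets by conditions on single nodes and on adjacent links, without
recursion on boxes: boxes form a forest, the levels of adjacent links match, and the flow is
acyclic. At the nodes in `E` links other than derelictions and weakenings may end; correct nets
are the case `E = ∅`. -/
structure Leveled (E : Set ℕ) (G : PreNet) : Prop where
  finite : G.links.Finite
  box_subset : ∀ p ∈ G.links, p.IsPar → G.box p ⊆ G.links
  box_irrefl : ∀ p ∈ G.links, p.IsPar → p ∉ G.box p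
  box_trans : ∀ p ∈ G.links, p.IsPar → ∀ p' ∈ G.box p, p'.IsPar → G.box p' ⊆ G.box p
  box_laminar : ∀ p ∈ G.links, p.IsPar → ∀ p' ∈ G.links, p'.IsPar →
    ∀ l ∈ G.box p, l ∈ G.box p' → p = p' ∨ p ∈ G.box p' ∨ p' ∈ G.box p
  in_unique : ∀ v, ∀ l ∈ G.links, ∀ l' ∈ G.links, v ∈ l.tgt → v ∈ l'.tgt →
    l ≠ l' → l.IsDer ∧ l'.IsDer
  out_unique : ∀ v, ∀ l ∈ G.links, ∀ l' ∈ G.links, v ∈ l.src → v ∈ l'.src → l = l'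
  of_no_in : ∀ v, ∀ l ∈ G.links, v ∈ l.src → (∀ l' ∈ G.links, v ∉ l'.tgt) →
    v = .e G.root ∧ ∀ p ∈ G.links, p.IsPar → ¬ G.OutLevel p v l
  of_no_out : ∀ v, ∀ l ∈ G.links, v ∈ l.tgt → (∀ l' ∈ G.links, v ∉ l'.src) →
    l.IsDer ∨ ((l.IsWeak ∨ ¬ l.IsPar ∧ ∃ y ∈ E, v = .e y) ∧
      ∀ p ∈ G.links, p.IsPar → l ∉ G.box p)
  root_out : ∃ l ∈ G.links, Node.e G.root ∈ l.src
  root_in : ∀ l ∈ G.links, Node.e G.root ∉ l.tgt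
  level_le : ∀ v, ∀ l ∈ G.links, ∀ l' ∈ G.links, v ∈ l.src → v ∈ l'.tgt →
    ∀ p ∈ G.links, p.IsPar → G.OutLevel p v l → G.InLevel p l'
  level_eq : ∀ v, ∀ l ∈ G.links, ∀ l' ∈ G.links, v ∈ l.src → v ∈ l'.tgt → ¬ l'.IsDer →
    ∀ p ∈ G.links, p.IsPar → G.InLevel p l' → G.OutLevel p v l
  variable_in : ∀ x, ∀ l ∈ G.links, ∀ l' ∈ G.links, l.IsPar → Node.e x ∈ l.src →
    Node.e x ∈ l'.tgt → l'.IsDer ∨ l'.IsWeak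
  acyclic : ∀ v, ¬ Relation.TransGen G.Flow v v

theorem mem_freeVars_iff {L : Set Link} {y : ℕ} :
    y ∈ freeVars L ↔ (∃ l ∈ L, Node.e y ∈ l.tgt) ∧ ∀ l ∈ L, Node.e y ∉ l.src := by
  constructor
  · rintro ⟨⟨l, hl, hv⟩, hno⟩
    exact ⟨⟨l, hl, hv.resolve_left (hno l hl)⟩, hno⟩
  · rintro ⟨⟨l, hl, hv⟩, hno⟩
    exact ⟨⟨l, hl, .inr hv⟩, hno⟩

theorem Link.isPar_par (a x r : ℕ) : (Link.par a x r).IsPar := ⟨a, x, r, rfl⟩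

theorem Link.not_isDer_of_isPar {l : Link} (h : l.IsPar) : ¬ l.IsDer := by
  obtain ⟨a, x, r, rfl⟩ := h; rintro ⟨_, _, hb⟩; cases hb

theorem Link.not_isDer_of_m_tgt {l : Link} {a : ℕ} (h : Node.m a ∈ l.tgt) : ¬ l.IsDer := by
  rintro ⟨b, x, rfl⟩; simp [Link.tgt] at h

theorem Link.not_isWeak_of_m_tgt {l : Link} {a : ℕ} (h : Node.m a ∈ l.tgt) : ¬ l.IsWeak := by
  rintro ⟨x, rfl⟩; simp [Link.tgt] at h

theorem Link.not_isPar_of_m_tgt {l : Link} {a : ℕ} (h : Node.m a ∈ l.tgt) : ¬ l.IsPar := by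
  rintro ⟨b, x, r, rfl⟩; simp [Link.tgt] at h

theorem Link.isPar_map {l : Link} {f g : ℕ → ℕ} : (l.map f g).IsPar ↔ l.IsPar := by
  cases l <;> simp [Link.map, Link.IsPar]

theorem Link.isDer_map {l : Link} {f g : ℕ → ℕ} : (l.map f g).IsDer ↔ l.IsDer := by
  cases l <;> simp [Link.map, Link.IsDer]

theorem Link.isWeak_map {l : Link} {f g : ℕ → ℕ} : (l.map f g).IsWeak ↔ l.IsWeak := by
  cases l <;> simp [Link.map, Link.IsWeak]

theorem Link.exists_src {l : Link} (h : ¬ l.IsWeak) : ∃ v, v ∈ l.src := by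
  cases l <;> simp_all [Link.src, Link.IsWeak]

/-- Renaming of nodes. -/
def Node.map (f g : ℕ → ℕ) : Node → Node
  | .e x => .e (f x)
  | .m a => .m (g a)

theorem Link.src_map {l : Link} {f g : ℕ → ℕ} : (l.map f g).src = Node.map f g '' l.src := by
  cases l <;> simp [Link.map, Link.src, Node.map, Set.image_pair]

theorem Link.tgt_map {l : Link} {f g : ℕ → ℕ} : (l.map f g).tgt = Node.map f g '' l.tgt := by
  cases l <;> simp [Link.map, Link.tgt, Node.map, Set.image_pair]

theorem mem_nodes_src {L : Set Link} {l : Link} {v : Node} (hl : l ∈ L) (hv : v ∈ l.src) :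
    v ∈ nodes L := ⟨l, hl, .inl hv⟩

theorem mem_nodes_tgt {L : Set Link} {l : Link} {v : Node} (hl : l ∈ L) (hv : v ∈ l.tgt) :
    v ∈ nodes L := ⟨l, hl, .inr hv⟩

theorem nodes_mono {L L' : Set Link} (h : L ⊆ L') : nodes L ⊆ nodes L' :=
  fun _ ⟨l, hl, hv⟩ => ⟨l, h hl, hv⟩

namespace Leveled

variable {E : Set ℕ} {G : PreNet}

theorem src_eq_par (h : Leveled E G) {a x r : ℕ} (hp : Link.par a x r ∈ G.links) {l : Link}
    (hl : l ∈ G.links) (hx : Node.e x ∈ l.src) : l = .par a x r :=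
  h.out_unique _ l hl _ hp hx (by simp [Link.src])

theorem tgt_eq_par (h : Leveled E G) {a x r : ℕ} (hp : Link.par a x r ∈ G.links) {l : Link}
    (hl : l ∈ G.links) (hr : Node.e r ∈ l.tgt) : l = .par a x r := by
  by_contra hne
  obtain ⟨-, b, y, hb⟩ := h.in_unique _ l hl _ hp hr (by simp [Link.tgt]) hne
  cases hb

/-- Every link into the variable of a `⅋`-link is in the box. -/
theorem mem_box_of_tgt_variable (h : Leveled E G) {a x r : ℕ} (hp : Link.par a x r ∈ G.links)
    {l : Link} (hl : l ∈ G.links) (hx : Node.e x ∈ l.tgt) : l ∈ G.box (.par a x r) := by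
  rcases h.level_le (.e x) _ hp l hl (by simp [Link.src]) hx _ hp (Link.isPar_par ..)
    (.inr ⟨rfl, x, rfl⟩) with h1 | rfl
  · exact h1
  · rcases h.variable_in x _ hp _ hp (Link.isPar_par ..) (by simp [Link.src]) hx with
      ⟨b, y, hb⟩ | ⟨y, hb⟩ <;> cases hb

theorem exists_tgt_variable (h : Leveled E G) {a x r : ℕ} (hp : Link.par a x r ∈ G.links) :
    ∃ l ∈ G.box (.par a x r), Node.e x ∈ l.tgt := by
  by_contra! hc
  refine (h.of_no_in (.e x) _ hp (by simp [Link.src]) fun l hl hx => ?_).2 _ hp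
    (Link.isPar_par ..) (.inr ⟨rfl, x, rfl⟩)
  exact hc l (h.mem_box_of_tgt_variable hp hl hx) hx

/-- Every link out of the root of a box is in the box. -/
theorem mem_box_of_src_root (h : Leveled E G) {a x r : ℕ} (hp : Link.par a x r ∈ G.links)
    {l : Link} (hl : l ∈ G.links) (hr : Node.e r ∈ l.src) : l ∈ G.box (.par a x r) := by
  rcases h.level_eq (.e r) l hl _ hp hr (by simp [Link.tgt]) (by rintro ⟨_, _, hb⟩; cases hb) _ hp
    (Link.isPar_par ..) (.inr rfl) with h1 | ⟨rfl, -⟩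
  · exact h1
  · rcases h.variable_in r _ hp _ hp (Link.isPar_par ..) hr (by simp [Link.tgt]) with
      ⟨b, y, hb⟩ | ⟨y, hb⟩ <;> cases hb

theorem exists_src_root (h : Leveled ∅ G) {a x r : ℕ} (hp : Link.par a x r ∈ G.links) :
    ∃ l ∈ G.box (.par a x r), Node.e r ∈ l.src := by
  by_contra! hc
  rcases h.of_no_out (.e r) _ hp (by simp [Link.tgt]) fun l hl hx =>
    hc l (h.mem_box_of_src_root hp hl hx) hx with ⟨b, y, hb⟩ | ⟨⟨y, hb⟩ | ⟨-, y, hy, -⟩, -⟩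
  · cases hb
  · cases hb
  · exact hy

/-- A link into a source of a link in a box is in the box, unless it is the `⅋`-link of the box. -/
theorem in_mem_box (h : Leveled E G) {p l l' : Link} {v : Node} (hp : p ∈ G.links)
    (hpp : p.IsPar) (hl : l ∈ G.box p) (hl' : l' ∈ G.links) (hv : v ∈ l.src) (hv' : v ∈ l'.tgt) :
    l' ∈ G.box p ∨ l' = p :=
  h.level_le v l (h.box_subset p hp hpp hl) l' hl' hv hv' p hp hpp (.inl hl)

/-- A node with a link out of it in a box is the root of the box, or has a link of the box into
it. -/
theorem exists_in_mem_box (h : Leveled E G) {a x r : ℕ} {l : Link} {v : Node}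
    (hp : Link.par a x r ∈ G.links) (hl : l ∈ G.box (.par a x r)) (hv : v ∈ l.src) :
    v = .e r ∨ ∃ l' ∈ G.box (.par a x r), v ∈ l'.tgt := by
  have hlL := h.box_subset _ hp (Link.isPar_par ..) hl
  by_cases hin : ∀ l' ∈ G.links, v ∉ l'.tgt
  · exact absurd (.inl hl) ((h.of_no_in v l hlL hv hin).2 _ hp (Link.isPar_par ..))
  · push Not at hin
    obtain ⟨l', hl', hv'⟩ := hin
    rcases h.in_mem_box hp (Link.isPar_par ..) hl hl' hv hv' with h1 | rfl
    · exact .inr ⟨l', h1, hv'⟩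
    · left; simpa [Link.tgt] using hv'

theorem out_mem_box (h : Leveled E G) {p l l' : Link} {v : Node} (hp : p ∈ G.links)
    (hpp : p.IsPar) (hl : l ∈ G.links) (hl' : l' ∈ G.box p) (hv : v ∈ l.src) (hv' : v ∈ l'.tgt)
    (hd : ¬ l'.IsDer) : l ∈ G.box p ∨ (l = p ∧ ∃ y, v = .e y) :=
  h.level_eq v l hl l' (h.box_subset p hp hpp hl') hv hv' hd p hp hpp (.inl hl')

/-- The box of a `⅋`-link of a levelled net is a levelled net. -/
theorem boxNet (h : Leveled ∅ G) {a x r : ℕ} (hp : Link.par a x r ∈ G.links) :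
    Leveled ∅ (G.boxNet a x r) := by
  have hpp := Link.isPar_par a x r
  have hs : G.box (.par a x r) ⊆ G.links := h.box_subset _ hp hpp
  refine
    { finite := h.finite.subset hs
      box_subset := fun p hp' hpp' => h.box_trans _ hp hpp p hp' hpp'
      box_irrefl := fun p hp' hpp' => h.box_irrefl p (hs hp') hpp'
      box_trans := fun p hp' hpp' => h.box_trans p (hs hp') hpp'
      box_laminar := fun p hp' hpp' p2 hp2 => h.box_laminar p (hs hp') hpp' p2 (hs hp2)
      in_unique := fun v l hl l' hl' => h.in_unique v l (hs hl) l' (hs hl')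
      out_unique := fun v l hl l' hl' => h.out_unique v l (hs hl) l' (hs hl')
      of_no_in := ?_
      of_no_out := ?_
      root_out := h.exists_src_root hp
      root_in := ?_
      level_le := fun v l hl l' hl' hv hv' p hp' =>
        h.level_le v l (hs hl) l' (hs hl') hv hv' p (hs hp')
      level_eq := fun v l hl l' hl' hv hv' hd p hp' =>
        h.level_eq v l (hs hl) l' (hs hl') hv hv' hd p (hs hp')
      variable_in := fun y l hl l' hl' => h.variable_in y l (hs hl) l' (hs hl')
      acyclic := fun v hv => h.acyclic v (hv.lift id ?_) }
  · intro v l hl hv hin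
    have hvr : v = .e r := (h.exists_in_mem_box hp hl hv).resolve_right
      fun ⟨l', hl', hv'⟩ => hin l' hl' hv'
    refine ⟨hvr, fun p hp' hpp' ho => ?_⟩
    subst hvr
    rcases h.level_le _ l (hs hl) _ hp hv (by simp [Link.tgt]) p (hs hp') hpp' ho with h1 | h1
    · exact h.box_irrefl p (hs hp') hpp' (h.box_trans _ (hs hp') hpp' _ h1 hpp hp')
    · subst h1; exact h.box_irrefl _ hp hpp hp'
  · intro v l hl hv hout
    by_cases hd : l.IsDer
    · exact .inl hd
    right
    by_cases hno : ∀ l' ∈ G.links, v ∉ l'.src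
    · rcases h.of_no_out v l (hs hl) hv hno with h1 | ⟨-, h2⟩
      · exact absurd h1 hd
      · exact absurd hl (h2 _ hp hpp)
    push Not at hno
    obtain ⟨l', hl', hv'⟩ := hno
    rcases h.out_mem_box hp hpp hl' hl hv' hv hd with h1 | ⟨rfl, y, rfl⟩
    · exact absurd hv' (hout l' h1)
    have hy : y = x := by simpa [Link.src] using hv'
    refine ⟨.inl ((h.variable_in y _ hp l (hs hl) hpp hv' hv).resolve_left hd),
      fun p hp' hpp' hlp => ?_⟩
    rcases h.out_mem_box (hs hp') hpp' hp hlp hv' hv hd with h1 | ⟨rfl, -⟩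
    · exact h.box_irrefl p (hs hp') hpp' (h.box_trans _ (hs hp') hpp' _ h1 hpp hp')
    · exact h.box_irrefl _ hp hpp hp'
  · intro l hl hr
    have hl' : l ∈ G.box (.par a x r) := hl
    rw [h.tgt_eq_par hp (hs hl) hr] at hl'
    exact h.box_irrefl _ hp hpp hl'
  · rintro u v (⟨l, hl, h1, h2, h3⟩ | ⟨b, y, q, hq, h1⟩)
    · exact .link l (hs hl) h1 h2 h3
    · exact .box b y q (hs hq) h1

theorem not_mem_freeVars_root (h : Leveled ∅ G) {a x r : ℕ} (hp : Link.par a x r ∈ G.links) :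
    r ∉ freeVars (G.box (.par a x r)) := by
  obtain ⟨l, hl, hr⟩ := h.exists_src_root hp
  exact fun hf => hf.2 l hl hr

/-- Every node of a box other than the root has a link of the box into it. -/
theorem exists_in_of_mem_nodes (h : Leveled E G) {a x r : ℕ} {v : Node}
    (hp : Link.par a x r ∈ G.links) (hv : v ∈ nodes (G.box (.par a x r))) (hr : v ≠ .e r) :
    ∃ l ∈ G.box (.par a x r), v ∈ l.tgt := by
  obtain ⟨l, hl, hv | hv⟩ := hv
  · exact (h.exists_in_mem_box hp hl hv).resolve_left hr
  · exact ⟨l, hl, hv⟩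

theorem mem_freeVars_variable (h : Leveled E G) {a x r : ℕ} (hp : Link.par a x r ∈ G.links) :
    x ∈ freeVars (G.box (.par a x r)) := by
  have hpp := Link.isPar_par a x r
  obtain ⟨l, hl, hx⟩ := h.exists_tgt_variable hp
  refine ⟨mem_nodes_tgt hl hx, fun l' hl' hx' => h.box_irrefl _ hp hpp ?_⟩
  rwa [h.src_eq_par hp (h.box_subset _ hp hpp hl') hx'] at hl'

/-- The links of a box into a free variable other than the variable of the `⅋`-link are
derelictions. -/
theorem isDer_of_tgt_freeVars (h : Leveled ∅ G) {a x r y : ℕ} (hp : Link.par a x r ∈ G.links)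
    (hy : y ∈ freeVars (G.box (.par a x r))) (hyx : y ≠ x) {l : Link}
    (hl : l ∈ G.box (.par a x r)) (hly : Node.e y ∈ l.tgt) : l.IsDer := by
  have hpp := Link.isPar_par a x r
  have hlL := h.box_subset _ hp hpp hl
  by_contra hd
  by_cases hno : ∀ l' ∈ G.links, Node.e y ∉ l'.src
  · rcases h.of_no_out _ l hlL hly hno with h1 | ⟨-, h2⟩
    · exact hd h1
    · exact h2 _ hp hpp hl
  push Not at hno
  obtain ⟨l', hl', hv'⟩ := hno
  rcases h.out_mem_box hp hpp hl' hl hv' hly hd with h1 | ⟨rfl, -⟩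
  · exact hy.2 l' h1 hv'
  · exact hyx (by simpa [Link.src] using hv')

theorem mem_box_of_tgt_internal (h : Leveled E G) {a x r y : ℕ} (hp : Link.par a x r ∈ G.links)
    (hy : IsInternal (G.box (.par a x r)) (.e y) ∨ y = x) {l : Link} (hl : l ∈ G.links)
    (hly : Node.e y ∈ l.tgt) : l ∈ G.box (.par a x r) := by
  have hpp := Link.isPar_par a x r
  rcases hy with ⟨hn, hs, ht⟩ | rfl
  · unfold IsSource at hs
    unfold IsTarget at ht
    push Not at hs ht
    obtain ⟨l₁, hl₁, h₁⟩ := hs hn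
    obtain ⟨l₂, hl₂, h₂⟩ := ht hn
    rcases h.in_mem_box hp hpp hl₂ hl h₂ hly with h3 | rfl
    · exact h3
    · have hr : y = r := by simpa [Link.tgt] using hly
      subst hr
      rwa [h.tgt_eq_par hp (h.box_subset _ hp hpp hl₁) h₁] at hl₁
  · exact h.mem_box_of_tgt_variable hp hl hly

theorem graphConditions (h : Leveled ∅ G) : G.GraphConditions where
  finite := h.finite
  root := by
    obtain ⟨l, hl, hr⟩ := h.root_out
    exact ⟨mem_nodes_src hl hr, h.root_in⟩
  conclusions x hx l hl hxl := by
    rcases h.of_no_out _ l hl hxl hx.2 with h1 | ⟨h1 | ⟨-, y, hy, -⟩, -⟩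
    · exact .inl h1
    · exact .inr h1
    · exact hy.elim
  multiplicative a ha := by
    have hin : ∃ l ∈ G.links, Node.m a ∈ l.tgt := by
      by_contra! hc
      obtain ⟨l, hl, hv | hv⟩ := ha
      · exact absurd (h.of_no_in _ l hl hv hc).1 (by simp)
      · exact hc l hl hv
    obtain ⟨l, hl, hv⟩ := hin
    have hout : ∃ l ∈ G.links, Node.m a ∈ l.src := by
      by_contra! hc
      rcases h.of_no_out _ l hl hv hc with h1 | ⟨h1 | ⟨-, y, -, hy⟩, -⟩
      · exact Link.not_isDer_of_m_tgt hv h1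
      · exact Link.not_isWeak_of_m_tgt hv h1
      · cases hy
    obtain ⟨k, hk, hvk⟩ := hout
    refine ⟨⟨l, ⟨hl, hv⟩, fun l' hl' => ?_⟩, ⟨k, ⟨hk, hvk⟩, fun k' hk' =>
      h.out_unique _ k' hk'.1 k hk hk'.2 hvk⟩⟩
    by_contra hne
    exact Link.not_isDer_of_m_tgt hv (h.in_unique _ l' hl'.1 l hl hl'.2 hv hne).2
  exp_out x := h.out_unique (.e x)
  exp_in x := h.in_unique (.e x)

theorem boxConditions (h : Leveled ∅ G) : G.BoxConditions where
  variable_mem a x r hp := h.mem_freeVars_variable hp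
  border a x r hp y hy hyx hw := by
    obtain ⟨b, z, hb⟩ := h.isDer_of_tgt_freeVars hp hy hyx hw (by simp [Link.tgt])
    cases hb
  nesting := by
    rintro _ hp _ hp' ⟨a, x, r, rfl⟩ ⟨a', x', r', rfl⟩ h12 h21 v ⟨hv, hv'⟩
    have hpp := Link.isPar_par a x r
    have hpp' := Link.isPar_par a' x' r'
    have hs := h.box_subset _ hp hpp
    have hs' := h.box_subset _ hp' hpp'
    have key : ∀ l ∈ G.box (.par a x r), l ∉ G.box (.par a' x' r') := fun l hl hl' => by
      rcases h.box_laminar _ hp hpp _ hp' hpp' l hl hl' with h1 | h1 | h1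
      · rw [h1] at h12; exact h12 subset_rfl
      · exact h12 (h.box_trans _ hp' hpp' _ h1 hpp)
      · exact h21 (h.box_trans _ hp hpp _ h1 hpp')
    have hr : v ≠ .e r := by
      rintro rfl
      by_cases hrr : r = r'
      · subst hrr
        rw [h.tgt_eq_par hp' hp (by simp [Link.tgt])] at h12; exact h12 subset_rfl
      · obtain ⟨l, hl, hvl⟩ := h.exists_in_of_mem_nodes hp' hv' (by simpa using hrr)
        rw [h.tgt_eq_par hp (hs' hl) hvl] at hl
        exact h12 (h.box_trans _ hp' hpp' _ hl hpp)
    have hr' : v ≠ .e r' := by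
      rintro rfl
      by_cases hrr : r' = r
      · exact hr (by rw [hrr])
      · obtain ⟨l, hl, hvl⟩ := h.exists_in_of_mem_nodes hp hv (by simpa using hrr)
        rw [h.tgt_eq_par hp' (hs hl) hvl] at hl
        exact h21 (h.box_trans _ hp hpp _ hl hpp')
    obtain ⟨l, hl, hvl⟩ := h.exists_in_of_mem_nodes hp hv hr
    obtain ⟨l', hl', hvl'⟩ := h.exists_in_of_mem_nodes hp' hv' hr'
    obtain ⟨y, rfl⟩ : ∃ y, v = .e y := by
      rcases v with y | b
      · exact ⟨y, rfl⟩
      · have : l = l' := by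
          by_contra hne
          exact Link.not_isDer_of_m_tgt hvl
            (h.in_unique _ l (hs hl) l' (hs' hl') hvl hvl' hne).1
        exact absurd hl' (this ▸ key l hl)
    refine ⟨y, rfl, ?_, ?_⟩ <;> by_contra hf
    · refine key l' (h.mem_box_of_tgt_internal hp (.inl ⟨hv, ?_, hf⟩) (hs' hl') hvl') hl'
      exact fun hs => hs.2 l hl hvl
    · refine key l hl (h.mem_box_of_tgt_internal hp' (.inl ⟨hv', ?_, hf⟩) (hs hl) hvl)
      exact fun hs => hs.2 l' hl' hvl'
  internal_closure a x r hp y hy l hl hly := h.mem_box_of_tgt_internal hp hy hl hly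
  subnet a x r hp := h.box_subset _ hp (Link.isPar_par a x r)

/-- A link that lies in some box lies in one whose `⅋`-link is in no box. -/
theorem exists_levelZero (h : Leveled E G) {p l : Link} (hp : p ∈ G.links) (hpp : p.IsPar)
    (hl : l ∈ G.box p) : ∃ q, G.LevelZero q ∧ q.IsPar ∧ l ∈ G.box q := by
  have hfin : {q | q ∈ G.links ∧ q.IsPar ∧ l ∈ G.box q}.Finite :=
    h.finite.subset fun q hq => hq.1
  obtain ⟨q, hq, hmax⟩ := hfin.exists_maximalFor (fun q => (G.box q).ncard) _ ⟨p, hp, hpp, hl⟩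
  refine ⟨q, ⟨hq.1, fun q' hq' hqp hmem => ?_⟩, hq.2⟩
  have hsub := h.box_trans q' hq' hqp q hmem hq.2.1
  have hlt : (G.box q).ncard < (G.box q').ncard :=
    Set.ncard_lt_ncard ⟨hsub, fun hc => h.box_irrefl q hq.1 hq.2.1 (hc hmem)⟩
      (h.finite.subset (h.box_subset q' hq' hqp))
  exact absurd (hmax ⟨hq', hqp, hsub hq.2.2⟩ hlt.le) (not_le.mpr hlt)

theorem isCorrectionESource_iff (h : Leveled ∅ G) (y : ℕ) :
    G.IsCorrectionESource y ↔ y = G.root := by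
  constructor
  · rintro ⟨⟨c, hc, hyc⟩, hno⟩
    have hyc := hyc.resolve_right (hno c hc)
    rcases hc with ⟨l, hl, hlp⟩ | ⟨a, x, r, hp⟩
    swap
    · simp [CLink.src] at hyc
    by_cases hin : ∀ l' ∈ G.links, Node.e y ∉ l'.tgt
    · simpa using (h.of_no_in _ l hl.1 hyc hin).1
    push Not at hin
    obtain ⟨l', hl', hy'⟩ := hin
    by_cases hb : ∃ p ∈ G.links, p.IsPar ∧ l' ∈ G.box p
    · obtain ⟨p, hp, hpp, hlp'⟩ := hb
      obtain ⟨q, hq, ⟨a, x, r, rfl⟩, hlq⟩ := h.exists_levelZero hp hpp hlp'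
      refine absurd ?_ (hno _ (.square a x r hq))
      refine ⟨y, ⟨⟨mem_nodes_tgt hlq hy', fun k hk hyk => ?_⟩, fun hyx => ?_⟩, rfl⟩
      · have := h.out_unique _ l hl.1 k (h.box_subset _ hq.1 (Link.isPar_par ..) hk) hyc hyk
        exact hl.2 _ hq.1 (Link.isPar_par ..) (this ▸ hk)
      · obtain rfl : y = x := hyx
        exact hlp (h.src_eq_par hq.1 hl.1 hyc ▸ Link.isPar_par ..)
    · push Not at hb
      by_cases hlp' : l'.IsPar
      · obtain ⟨a, x, r, rfl⟩ := hlp'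
        have hyr : y = r := by simpa [Link.tgt] using hy'
        subst hyr
        exact absurd (h.mem_box_of_src_root hl' hl.1 hyc) (hl.2 _ hl' (Link.isPar_par ..))
      · exact absurd hy' (hno _ (.keep l' ⟨hl', hb⟩ hlp'))
  · rintro rfl
    obtain ⟨l, hl, hr⟩ := h.root_out
    have hz := (h.of_no_in _ l hl hr h.root_in).2
    refine ⟨⟨_, .keep l ⟨hl, fun p hp hpp hlp => hz p hp hpp (.inl hlp)⟩ fun hlp =>
      hz l hl hlp (.inr ⟨rfl, _, rfl⟩), .inl hr⟩, ?_⟩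
    rintro _ (⟨l', hl', -⟩ | ⟨a, x, r, hp⟩) ht
    · exact h.root_in l' hl'.1 ht
    · obtain ⟨y, ⟨hy, -⟩, hyr⟩ := ht
      obtain rfl : y = G.root := by simpa using hyr
      by_cases hyr : G.root = r
      · exact h.not_mem_freeVars_root hp.1 (hyr ▸ hy)
      · obtain ⟨k, hk, hyk⟩ := h.exists_in_of_mem_nodes hp.1 hy.1 (by simpa using hyr)
        exact h.root_in k (h.box_subset _ hp.1 (Link.isPar_par ..) hk) hyk

theorem flow_of_arrow {u v : Node} (h : G.Arrow u v) : G.Flow u v := by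
  obtain ⟨_, ⟨l, hl, hlp⟩ | ⟨a, x, r, hp⟩, hu, hv⟩ := h
  · exact .link l hl.1 hlp hu hv
  · obtain ⟨y, hy, rfl⟩ := hv
    obtain rfl : u = .m a := hu
    exact .box a x r hp.1 hy.1.1

theorem isNet (h : Leveled ∅ G) : IsNet G := by
  induction hn : G.links.ncard using Nat.strong_induction_on generalizing G with
  | _ n ih =>
    refine .intro G h.graphConditions h.boxConditions fun a x r hp => ?_
    refine ih _ ?_ (h.boxNet hp) rfl
    rw [← hn]
    exact Set.ncard_lt_ncard ⟨h.box_subset _ hp (Link.isPar_par ..), fun hc =>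
      h.box_irrefl _ hp (Link.isPar_par ..) (hc hp)⟩ h.finite

theorem correct (h : Leveled ∅ G) : Correct G := by
  induction hn : G.links.ncard using Nat.strong_induction_on generalizing G with
  | _ n ih =>
    refine .intro G h.isNet h.isCorrectionESource_iff
      (fun v hv => h.acyclic v (hv.lift id fun _ _ => flow_of_arrow)) fun a x r hp => ?_
    refine ih _ ?_ (h.boxNet hp) rfl
    rw [← hn]
    exact Set.ncard_lt_ncard ⟨h.box_subset _ hp (Link.isPar_par ..), fun hc =>
      h.box_irrefl _ hp (Link.isPar_par ..) (hc hp)⟩ h.finite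

end Leveled

/-! ### Translations of terms are levelled -/

/-- A union of two acyclic relations is acyclic if a step of the second is never followed by a
step of the first. -/
theorem acyclic_sup {α : Type*} {A B : α → α → Prop}
    (hA : ∀ v, ¬ Relation.TransGen A v v) (hB : ∀ v, ¬ Relation.TransGen B v v)
    (h : ∀ u v w, B u v → ¬ A v w) (v : α) :
    ¬ Relation.TransGen (fun u w => A u w ∨ B u w) v v := by
  -- A path consists of a path in `A` followed by a path in `B`.
  have key : ∀ u w, Relation.TransGen (fun u w => A u w ∨ B u w) u w →
      Relation.TransGen A u w ∨ ∃ z, Relation.ReflTransGen A u z ∧ Relation.TransGen B z w := by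
    intro u w huw
    induction huw with
    | single h1 =>
      rcases h1 with h1 | h1
      · exact .inl (.single h1)
      · exact .inr ⟨u, .refl, .single h1⟩
    | tail _ h1 ih =>
      rcases h1 with h1 | h1 <;> rcases ih with ih | ⟨z, hz, ih⟩
      · exact .inl (ih.tail h1)
      · obtain ⟨c, -, hc⟩ := Relation.TransGen.tail'_iff.mp ih
        exact absurd h1 (h _ _ _ hc)
      · exact .inr ⟨_, ih.to_reflTransGen, .single h1⟩
      · exact .inr ⟨z, hz, ih.tail h1⟩
  intro hv
  rcases key v v hv with h1 | ⟨z, hz, h1⟩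
  · exact hA v h1
  · rcases Relation.ReflTransGen.cases_head hz with rfl | ⟨c, hc, -⟩
    · exact hB _ h1
    · obtain ⟨d, -, hd⟩ := Relation.TransGen.tail'_iff.mp h1
      exact h _ _ _ hd hc

/-- The link `T` at the root `r` of the translation of a value (`!`, with `E = ∅`) or of an
application (`⊗`, with its argument in `E`), with `m`-target `a`. -/
structure HeadLink (T : Link) (r a : ℕ) (E : Set ℕ) : Prop where
  src : ∀ v, v ∈ T.src ↔ v = .e r
  tgt : ∀ v, v ∈ T.tgt ↔ v = .m a ∨ ∃ y ∈ E, v = .e y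
  not_isPar : ¬ T.IsPar
  not_isDer : ¬ T.IsDer
  not_isWeak : ¬ T.IsWeak
  target_ne : r ∉ E

theorem headLink_bang (r a : ℕ) : HeadLink (.bang r a) r a ∅ := by
  constructor <;> simp [Link.src, Link.tgt, Link.IsPar, Link.IsDer, Link.IsWeak]

theorem headLink_tens {r u : ℕ} (a : ℕ) (h : r ≠ u) : HeadLink (.tens r a u) r a {u} := by
  constructor <;> simp [Link.src, Link.tgt, Link.IsPar, Link.IsDer, Link.IsWeak, h]

namespace Leveled

variable {E : Set ℕ} {box : Link → Set Link}

theorem mono {G : PreNet} (h : Leveled ∅ G) (E : Set ℕ) : Leveled E G where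
  __ := h
  of_no_out v l hl hv hno := (h.of_no_out v l hl hv hno).imp_right
    (And.imp_left (Or.imp_right (And.imp_right fun ⟨_, hy, _⟩ => hy.elim)))

/-- The translation of a variable, up to the head link. -/
theorem der {T : Link} {r a x : ℕ} (hT : HeadLink T r a E) (hxr : x ≠ r) (hxE : x ∉ E) :
    Leveled E ⟨{T, .der a x}, r, box⟩ := by
  obtain ⟨hs, ht, hp, hd, hw, hr⟩ := hT
  have hp' : ¬ (Link.der a x).IsPar := by simp [Link.IsPar]
  have hd' : (Link.der a x).IsDer := ⟨a, x, rfl⟩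
  have hs' : ∀ v, v ∈ (Link.der a x).src ↔ v = .m a := by simp [Link.src]
  have ht' : ∀ v, v ∈ (Link.der a x).tgt ↔ v = .e x := by simp [Link.tgt]
  have hnp : ∀ p ∈ ({T, .der a x} : Set Link), ¬ p.IsPar := by
    rintro p (rfl | rfl) <;> assumption
  have hm : ∀ l, l ∈ ({T, .der a x} : Set Link) ↔ l = T ∨ l = .der a x := by simp
  constructor
  case finite => exact (Set.finite_singleton _).insert _
  case box_subset => exact fun p hp h => absurd h (hnp p hp)
  case box_irrefl => exact fun p hp h => absurd h (hnp p hp)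
  case box_trans => exact fun p hp h => absurd h (hnp p hp)
  case box_laminar => exact fun p hp h => absurd h (hnp p hp)
  case in_unique => grind
  case out_unique => grind
  case of_no_in => grind
  case of_no_out => grind
  case root_out => exact ⟨T, by simp, by simp [hs]⟩
  case root_in => grind
  case level_le => exact fun v l hl l' hl' hv hv' p hp h => absurd h (hnp p hp)
  case level_eq => exact fun v l hl l' hl' hv hv' hd p hp h => absurd h (hnp p hp)
  case variable_in => exact fun y l hl l' hl' h => absurd h (hnp l hl)
  case acyclic =>
    -- every node is sent to its depth: the root, then `a`, then everything else
    have key : ∀ u w, PreNet.Flow ⟨{T, .der a x}, r, box⟩ u w →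
        (u = .e r ∧ w ≠ .e r) ∨ (u = .m a ∧ w = .e x) := by
      rintro u w (⟨l, hl, h1, h2, h3⟩ | ⟨b, y, q, hq, h1⟩)
      · grind
      · exact absurd (Link.isPar_par ..) (hnp _ hq)
    have key2 : ∀ u w, Relation.TransGen (PreNet.Flow ⟨{T, .der a x}, r, box⟩) u w →
        (u = .e r ∧ w ≠ .e r) ∨ (u = .m a ∧ w = .e x) := by
      intro u w h
      induction h with
      | single h => exact key _ _ h
      | tail _ h ih => have := key _ _ h; grind
    intro v hv
    have := key2 v v hv
    grind

/-- Addition of weakenings on fresh nodes. -/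
theorem weaken {L : Set Link} {r : ℕ} (h : Leveled E ⟨L, r, box⟩) {Y : Set ℕ} (hY : Y.Finite)
    (hd : ∀ y ∈ Y, y ∉ eNodes L) : Leveled E ⟨L ∪ Link.weak '' Y, r, box⟩ := by
  have hnp : ∀ p ∈ L ∪ Link.weak '' Y, p.IsPar → p ∈ L := by
    rintro p (hp | ⟨y, hy, rfl⟩) ⟨a, x, q, h⟩
    · exact hp
    · cases h
  have hbw : ∀ p ∈ L ∪ Link.weak '' Y, p.IsPar → box p ⊆ L := fun p hp hpp =>
    h.box_subset p (hnp p hp hpp) hpp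
  have hw : ∀ l ∈ L ∪ Link.weak '' Y, l ∈ L ∨ (l.IsWeak ∧ l ∉ L ∧ l.src = ∅ ∧
      ∃ y, l.tgt = {Node.e y} ∧ Node.e y ∉ nodes L) := by
    rintro l (hl | ⟨y, hy, rfl⟩)
    · exact .inl hl
    · exact .inr ⟨⟨y, rfl⟩, fun hc => hd y hy (mem_nodes_tgt hc (by simp [Link.tgt])), rfl, y, rfl,
        hd y hy⟩
  have hsub : ∀ l ∈ L, l ∈ L ∪ Link.weak '' Y := fun l hl => .inl hl
  have hsrc : ∀ v, ∀ l ∈ L ∪ Link.weak '' Y, v ∈ l.src → l ∈ L := by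
    intro v l hl hv
    rcases hw l hl with h1 | ⟨-, -, h1, -⟩
    · exact h1
    · simp [h1] at hv
  have htgt : ∀ v, ∀ l ∈ L ∪ Link.weak '' Y, v ∈ l.tgt → v ∈ nodes L → l ∈ L := by
    intro v l hl hv hn
    rcases hw l hl with h1 | ⟨-, -, -, y, h1, h2⟩
    · exact h1
    · rw [h1] at hv; obtain rfl : v = .e y := hv
      exact absurd hn h2
  constructor
  case finite => exact h.finite.union (hY.image _)
  case box_subset => exact fun p hp hpp => (hbw p hp hpp).trans Set.subset_union_left
  case box_irrefl => exact fun p hp hpp => h.box_irrefl p (hnp p hp hpp) hpp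
  case box_trans => exact fun p hp hpp => h.box_trans p (hnp p hp hpp) hpp
  case box_laminar =>
    exact fun p hp hpp p' hp' hpp' => h.box_laminar p (hnp p hp hpp) hpp p' (hnp p' hp' hpp') hpp'
  case in_unique =>
    intro v l hl l' hl' hv hv' hne
    rcases hw l hl with h1 | ⟨⟨z, rfl⟩, h2, -, y, h3, h4⟩
    · exact h.in_unique v l h1 l' (htgt v l' hl' hv' (mem_nodes_tgt h1 hv)) hv hv' hne
    · rcases hw l' hl' with h1 | ⟨⟨z', rfl⟩, -, -, -⟩
      · exact absurd (htgt v _ hl hv (mem_nodes_tgt h1 hv')) h2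
      · simp_all [Link.tgt]
  case out_unique =>
    intro v l hl l' hl' hv hv'
    exact h.out_unique v l (hsrc v l hl hv) l' (hsrc v l' hl' hv') hv hv'
  case of_no_in =>
    intro v l hl hv hno
    obtain ⟨h1, h2⟩ := h.of_no_in v l (hsrc v l hl hv) hv fun l' hl' => hno l' (hsub l' hl')
    exact ⟨h1, fun p hp hpp => h2 p (hnp p hp hpp) hpp⟩
  case of_no_out =>
    intro v l hl hv hno
    rcases hw l hl with h1 | ⟨h1, h2, -⟩
    · rcases h.of_no_out v l h1 hv fun l' hl' => hno l' (hsub l' hl') with h3 | ⟨h3, h4⟩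
      · exact .inl h3
      · exact .inr ⟨h3, fun p hp hpp => h4 p (hnp p hp hpp) hpp⟩
    · exact .inr ⟨.inl h1, fun p hp hpp hlp => h2 (hbw p hp hpp hlp)⟩
  case root_out =>
    obtain ⟨l, hl, hr⟩ := h.root_out
    exact ⟨l, hsub l hl, hr⟩
  case root_in =>
    intro l hl hr
    obtain ⟨k, hk, hkr⟩ := h.root_out
    exact h.root_in l (htgt _ l hl hr (mem_nodes_src hk hkr)) hr
  case level_le =>
    intro v l hl l' hl' hv hv' p hp hpp
    have h1 := hsrc v l hl hv
    exact h.level_le v l h1 l' (htgt v l' hl' hv' (mem_nodes_src h1 hv)) hv hv' p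
      (hnp p hp hpp) hpp
  case level_eq =>
    intro v l hl l' hl' hv hv' hd p hp hpp
    have h1 := hsrc v l hl hv
    exact h.level_eq v l h1 l' (htgt v l' hl' hv' (mem_nodes_src h1 hv)) hv hv' hd p
      (hnp p hp hpp) hpp
  case variable_in =>
    intro x l hl l' hl' hpp hv hv'
    have h1 := hsrc _ l hl hv
    exact h.variable_in x l h1 l' (htgt _ l' hl' hv' (mem_nodes_src h1 hv)) hpp hv hv'
  case acyclic =>
    refine fun v hv => h.acyclic v (hv.lift id ?_)
    rintro u w (⟨l, hl, h1, h2, h3⟩ | ⟨b, y, q, hq, h1⟩)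
    · exact .link l (hsrc u l hl h2) h1 h2 h3
    · exact .box b y q (hnp _ hq (Link.isPar_par ..)) h1

/-- The translation of an abstraction from that of its body, up to the head link. -/
theorem abs {T : Link} {r a x q : ℕ} {W : Set Link} (hT : HeadLink T r a E)
    (h : Leveled ∅ ⟨W, q, box⟩) (hbox : box (.par a x q) = W) (hx : x ∈ freeVars W)
    (hweak : ∀ y ∈ freeVars W, y ≠ x → Link.weak y ∉ W) (hr : r ∉ eNodes W) (ha : a ∉ mNodes W)
    (hE : ∀ y ∈ E, y ∉ eNodes W) : Leveled E ⟨{T, .par a x q} ∪ W, r, box⟩ := by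
  obtain ⟨hs, ht, hp, hd, hw, hrE⟩ := hT
  set P := Link.par a x q with hP
  have hpP : P.IsPar := Link.isPar_par ..
  have hdP : ¬ P.IsDer := Link.not_isDer_of_isPar hpP
  have hsP : ∀ v, v ∈ P.src ↔ v = .m a ∨ v = .e x := by simp [hP, Link.src]
  have htP : ∀ v, v ∈ P.tgt ↔ v = .e q := by simp [hP, Link.tgt]
  have hm : ∀ l, l ∈ {T, P} ∪ W ↔ l = T ∨ l = P ∨ l ∈ W := by simp [or_assoc]
  have hr' : ∀ l ∈ W, Node.e r ∉ l.src ∧ Node.e r ∉ l.tgt := fun l hl =>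
    ⟨fun h => hr (mem_nodes_src hl h), fun h => hr (mem_nodes_tgt hl h)⟩
  have ha' : ∀ l ∈ W, Node.m a ∉ l.src ∧ Node.m a ∉ l.tgt := fun l hl =>
    ⟨fun h => ha (mem_nodes_src hl h), fun h => ha (mem_nodes_tgt hl h)⟩
  have hE' : ∀ y ∈ E, ∀ l ∈ W, Node.e y ∉ l.src ∧ Node.e y ∉ l.tgt := fun y hy l hl =>
    ⟨fun h => hE y hy (mem_nodes_src hl h), fun h => hE y hy (mem_nodes_tgt hl h)⟩
  have hTW : T ∉ W := fun h => (hr' T h).1 ((hs _).2 rfl)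
  have hPW : P ∉ W := fun h => (ha' P h).1 ((hsP _).2 (.inl rfl))
  obtain ⟨kq, hkq, hq⟩ : ∃ l ∈ W, Node.e q ∈ l.src := h.root_out
  have hqin : ∀ l ∈ W, Node.e q ∉ l.tgt := h.root_in
  obtain ⟨lx, hlx, hxin⟩ : ∃ l ∈ W, Node.e x ∈ l.tgt := by
    obtain ⟨⟨l, hl, h1 | h1⟩, h2⟩ := hx
    · exact absurd h1 (h2 l hl)
    · exact ⟨l, hl, h1⟩
  have hxout : ∀ l ∈ W, Node.e x ∉ l.src := hx.2
  have hqr : q ≠ r := fun hc => (hr' kq hkq).1 (hc ▸ hq)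
  have hqE : q ∉ E := fun hc => (hE' q hc kq hkq).1 hq
  have hxr : x ≠ r := fun hc => (hr' lx hlx).2 (hc ▸ hxin)
  have hxE : x ∉ E := fun hc => (hE' x hc lx hlx).2 hxin
  have hxq : x ≠ q := fun hc => hqin lx hlx (hc ▸ hxin)
  have hsub : ∀ p ∈ W, p.IsPar → box p ⊆ W := h.box_subset
  have hpar : ∀ p ∈ {T, P} ∪ W, p.IsPar → p = P ∨ p ∈ W := by grind
  have hboxW : ∀ p ∈ {T, P} ∪ W, p.IsPar → box p ⊆ W := by
    intro p hp hpp
    rcases hpar p hp hpp with rfl | h1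
    · exact hbox.le
    · exact hsub p h1 hpp
  constructor
  case finite => exact ((Set.finite_singleton _).insert _).union h.finite
  case box_subset => exact fun p hp hpp => (hboxW p hp hpp).trans Set.subset_union_right
  case box_irrefl =>
    intro p hp hpp hc
    rcases hpar p hp hpp with rfl | h1
    · exact hPW (hbox.le hc)
    · exact h.box_irrefl p h1 hpp hc
  case box_trans =>
    intro p hp hpp p' hp' hpp'
    rcases hpar p hp hpp with rfl | h1
    · exact (hsub p' (hbox.le hp') hpp').trans hbox.ge
    · exact h.box_trans p h1 hpp p' hp' hpp'
  case box_laminar =>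
    intro p hp hpp p' hp' hpp' l hl hl'
    rcases hpar p hp hpp with rfl | h1 <;> rcases hpar p' hp' hpp' with rfl | h2
    · exact .inl rfl
    · exact .inr (.inr (hbox.ge h2))
    · exact .inr (.inl (hbox.ge h1))
    · exact h.box_laminar p h1 hpp p' h2 hpp' l hl hl'
  case in_unique =>
    have := h.in_unique
    grind
  case out_unique =>
    have := h.out_unique
    grind
  case of_no_in =>
    intro v l hl hv hno
    replace hl := (hm l).1 hl
    rcases hl with rfl | rfl | hl
    · refine ⟨(hs v).1 hv, fun p hp' hpp ho => ?_⟩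
      rcases ho with ho | ⟨rfl, -⟩
      · exact hTW (hboxW p hp' hpp ho)
      · exact hp hpp
    · rcases (hsP v).1 hv with rfl | rfl
      · exact absurd ((ht _).2 (.inl rfl)) (hno T (by simp))
      · exact absurd hxin (hno lx (by simp [hlx]))
    · obtain ⟨rfl, -⟩ := h.of_no_in v l hl hv fun l' hl' => hno l' (.inr hl')
      exact absurd ((htP _).2 rfl) (hno P (by simp))
  case of_no_out =>
    intro v l hl hv hno
    replace hl := (hm l).1 hl
    rcases hl with rfl | rfl | hl
    · rcases (ht v).1 hv with rfl | ⟨y, hy, rfl⟩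
      · exact absurd ((hsP _).2 (.inl rfl)) (hno P (by simp))
      · exact .inr ⟨.inr ⟨hp, y, hy, rfl⟩, fun p hp' hpp hl => hTW (hboxW p hp' hpp hl)⟩
    · obtain rfl := (htP v).1 hv
      exact absurd hq (hno kq (by simp [hkq]))
    · rcases h.of_no_out v l hl hv fun l' hl' => hno l' (.inr hl') with h1 | ⟨h1 | ⟨-, y, hy, -⟩, -⟩
      · exact .inl h1
      · obtain ⟨y, rfl⟩ := h1
        obtain rfl : v = .e y := by simpa [Link.tgt] using hv
        have hyx : y ≠ x := by
          rintro rfl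
          exact hno P (by simp) ((hsP _).2 (.inr rfl))
        exact absurd hl (hweak y ⟨mem_nodes_tgt hl hv, fun l' hl' => hno l' (.inr hl')⟩ hyx)
      · exact hy.elim
  case root_out => exact ⟨T, by simp, (hs _).2 rfl⟩
  case root_in => grind
  case level_le =>
    intro v l hl l' hl' hv hv' p hp' hpp ho
    replace hl := (hm l).1 hl
    rcases hl with rfl | rfl | hl
    · rcases ho with ho | ⟨rfl, -⟩
      · exact absurd (hboxW p hp' hpp ho) hTW
      · exact absurd hpp hp
    · rcases ho with ho | ⟨rfl, y, rfl⟩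
      · exact absurd (hboxW p hp' hpp ho) hPW
      · obtain rfl : y = x := by simpa using (hsP _).1 hv
        replace hl' := (hm l').1 hl'
        rcases hl' with rfl | rfl | hl'
        · simp [ht, hxE] at hv'
        · simp [htP, hxq] at hv'
        · exact .inl (hbox.ge hl')
    · replace hl' := (hm l').1 hl'
      rcases hl' with rfl | rfl | hl'
      · rcases (ht v).1 hv' with rfl | ⟨y, hy, rfl⟩
        · exact absurd hv (ha' l hl).1
        · exact absurd hv (hE' y hy l hl).1
      · obtain rfl := (htP v).1 hv'
        rcases hpar p hp' hpp with rfl | hp''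
        · exact .inr rfl
        · exact absurd ho ((h.of_no_in _ l hl hv hqin).2 p hp'' hpp)
      · rcases hpar p hp' hpp with rfl | hp''
        · exact .inl (hbox.ge hl')
        · exact h.level_le v l hl l' hl' hv hv' p hp'' hpp ho
  case level_eq =>
    intro v l hl l' hl' hv hv' hd' p hp' hpp hi
    replace hl' := (hm l').1 hl'
    rcases hl' with rfl | rfl | hl'
    · rcases hi with hi | rfl
      · exact absurd (hboxW p hp' hpp hi) hTW
      · exact absurd hpp hp
    · rcases hi with hi | rfl
      · exact absurd (hboxW p hp' hpp hi) hPW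
      · obtain rfl := (htP v).1 hv'
        replace hl := (hm l).1 hl
        rcases hl with rfl | rfl | hl
        · simp [hs, hqr] at hv
        · simp [hsP, hxq.symm] at hv
        · exact .inl (hbox.ge hl)
    · replace hl := (hm l).1 hl
      rcases hl with rfl | rfl | hl
      · obtain rfl := (hs v).1 hv
        exact absurd hv' (hr' l' hl').2
      · rcases (hsP v).1 hv with rfl | rfl
        · exact absurd hv' (ha' l' hl').2
        · rcases hpar p hp' hpp with rfl | hp''
          · exact .inr ⟨rfl, x, rfl⟩
          · rcases h.of_no_out _ l' hl' hv' hxout with h1 | ⟨h1, h2⟩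
            · exact absurd h1 hd'
            · rcases hi with hi | rfl
              · exact absurd hi (h2 p hp'' hpp)
              · rcases h1 with ⟨y, rfl⟩ | ⟨h1, -⟩
                · obtain ⟨_, _, _, hb⟩ := hpp; cases hb
                · exact absurd hpp h1
      · rcases hpar p hp' hpp with rfl | hp''
        · exact .inl (hbox.ge hl)
        · exact h.level_eq v l hl l' hl' hv hv' hd' p hp'' hpp hi
  case variable_in =>
    intro y l hl l' hl' hlp hv hv'
    replace hl := (hm l).1 hl
    rcases hl with rfl | rfl | hl
    · exact absurd hlp hp
    · obtain rfl : y = x := by simpa using (hsP _).1 hv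
      replace hl' := (hm l').1 hl'
      rcases hl' with rfl | rfl | hl'
      · simp [ht, hxE] at hv'
      · simp [htP, hxq] at hv'
      · rcases h.of_no_out _ l' hl' hv' hxout with h1 | ⟨h1 | ⟨-, z, hz, -⟩, -⟩
        · exact .inl h1
        · exact .inr h1
        · exact hz.elim
    · replace hl' := (hm l').1 hl'
      rcases hl' with rfl | rfl | hl'
      · obtain ⟨z, hz, hyz⟩ : ∃ z ∈ E, y = z := by simpa [ht] using hv'
        subst hyz
        exact absurd hv (hE' _ hz l hl).1
      · obtain rfl : y = q := by simpa using (htP _).1 hv'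
        exact absurd (.inr ⟨rfl, y, rfl⟩) ((h.of_no_in _ l hl hv hqin).2 l hl hlp)
      · exact h.variable_in y l hl l' hl' hlp hv hv'
  case acyclic =>
    -- the new steps lead from `r` to `a` and the argument, and from `a` into the box
    let A : Node → Node → Prop := fun u w =>
      (u = .e r ∧ (w = .m a ∨ ∃ y ∈ E, w = .e y)) ∨ (u = .m a ∧ w ∈ nodes W)
    have hA : ∀ u w, Relation.TransGen A u w →
        (u = .e r ∧ w ≠ .e r) ∨ (u = .m a ∧ w ∈ nodes W) := by
      intro u w huw
      have base : ∀ u w, A u w → (u = .e r ∧ w ≠ .e r) ∨ (u = .m a ∧ w ∈ nodes W) := by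
        rintro u w (⟨rfl, rfl | ⟨y, hy, rfl⟩⟩ | h1)
        · exact .inl ⟨rfl, by simp⟩
        · exact .inl ⟨rfl, fun hc => hrE (by cases hc; exact hy)⟩
        · exact .inr h1
      induction huw with
      | single h1 => exact base _ _ h1
      | tail _ h1 ih =>
        rcases ih with ⟨rfl, h2⟩ | ⟨rfl, h2⟩ <;> rcases base _ _ h1 with ⟨rfl, h3⟩ | ⟨rfl, h3⟩
        · exact .inl ⟨rfl, h3⟩
        · refine .inl ⟨rfl, ?_⟩; rintro rfl; exact hr h3
        · exact absurd h2 hr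
        · exact absurd h2 ha
    have hBW : ∀ u w, PreNet.Flow ⟨W, q, box⟩ u w → w ∈ nodes W := by
      rintro u w (⟨l, hl, h1, h2, h3⟩ | ⟨b, y, q, hq, h1⟩)
      · exact mem_nodes_tgt hl h3
      · exact nodes_mono (hsub _ hq (Link.isPar_par ..)) h1
    have key := acyclic_sup (A := A) (B := PreNet.Flow ⟨W, q, box⟩) ?_ h.acyclic ?_
    · refine fun v hv => key v (hv.lift id ?_)
      rintro u w (⟨l, hl, h1, h2, h3⟩ | ⟨b, y, q', hq, h1⟩)
      · replace hl := (hm l).1 hl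
        rcases hl with rfl | rfl | hl
        · exact .inl (.inl ⟨(hs u).1 h2, (ht w).1 h3⟩)
        · exact absurd hpP h1
        · exact .inr (.link l hl h1 h2 h3)
      · rcases hpar _ hq (Link.isPar_par ..) with h2 | h2
        · have h1' : w ∈ nodes W := by rw [h2] at h1; rw [← hbox]; exact h1
          obtain ⟨rfl, -, -⟩ : b = a ∧ y = x ∧ q' = q := by simpa [hP] using h2
          exact .inl (.inr ⟨rfl, h1'⟩)
        · exact .inr (.box b y q' h2 h1)
    · intro v hv
      rcases hA v v hv with ⟨rfl, h1⟩ | ⟨rfl, h1⟩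
      · exact h1 rfl
      · exact ha h1
    · rintro u v w h1 (⟨rfl, -⟩ | ⟨rfl, -⟩)
      · exact hr (hBW _ _ h1)
      · exact ha (hBW _ _ h1)

/-- Two nets are glued by identifying the root `u` of the second with a free variable of the
first. They may share further free variables, if these have no weakenings. -/
theorem glue {A B : Set Link} {r u : ℕ} (hA : Leveled {u} ⟨A, r, box⟩)
    (hB : Leveled ∅ ⟨B, u, box⟩) (hu : u ∈ freeVars A)
    (hAB : ∀ v ∈ nodes A, v ∈ nodes B → v = .e u ∨ ∃ y, v = .e y ∧ y ∈ freeVars A ∧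
      y ∈ freeVars B ∧ Link.weak y ∉ A ∧ Link.weak y ∉ B) :
    Leveled ∅ ⟨A ∪ B, r, box⟩ := by
  have huA : ∀ l ∈ A, Node.e u ∉ l.src := hu.2
  have huB : ∀ l ∈ B, Node.e u ∉ l.tgt := hB.root_in
  obtain ⟨ku, hku, hkus⟩ : ∃ l ∈ B, Node.e u ∈ l.src := hB.root_out
  have hsrc : ∀ v, ∀ l ∈ A, ∀ l' ∈ B, v ∈ l.src → v ∉ nodes B := by
    intro v l hl l' hl' hv hv'
    rcases hAB v (mem_nodes_src hl hv) hv' with rfl | ⟨y, rfl, h1, -⟩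
    · exact huA l hl hv
    · exact h1.2 l hl hv
  have htgt : ∀ v, ∀ l ∈ A, ∀ l' ∈ B, v ∈ l.tgt → v ∈ l'.tgt → l.IsDer ∧ l'.IsDer := by
    intro v l hl l' hl' hv hv'
    have hvu : v ≠ .e u := fun h => huB l' hl' (h ▸ hv')
    rcases hAB v (mem_nodes_tgt hl hv) (mem_nodes_tgt hl' hv') with rfl | ⟨y, rfl, h1, h2, h3, h4⟩
    · exact absurd rfl hvu
    · constructor
      · rcases hA.of_no_out _ l hl hv h1.2 with h5 | ⟨⟨z, rfl⟩ | ⟨-, z, hz, h5⟩, -⟩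
        · exact h5
        · obtain rfl : y = z := by simpa [Link.tgt] using hv
          exact absurd hl h3
        · obtain rfl : z = u := hz
          exact absurd h5 hvu
      · rcases hB.of_no_out _ l' hl' hv' h2.2 with h5 | ⟨⟨z, rfl⟩ | ⟨-, z, hz, -⟩, -⟩
        · exact h5
        · obtain rfl : y = z := by simpa [Link.tgt] using hv'
          exact absurd hl' h4
        · exact hz.elim
  have hglue : ∀ v, ∀ l ∈ B, ∀ l' ∈ A, v ∈ l.src → v ∈ l'.tgt → v = .e u := by
    intro v l hl l' hl' hv hv'
    rcases hAB v (mem_nodes_tgt hl' hv') (mem_nodes_src hl hv) with h1 | ⟨y, rfl, -, h1, -⟩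
    · exact h1
    · exact absurd hv (h1.2 l hl)
  have hdisj : ∀ l ∈ A, l ∉ B := by
    intro l hl hl'
    obtain ⟨y, rfl⟩ : l.IsWeak := by
      by_contra hw
      obtain ⟨v, hv⟩ := Link.exists_src hw
      exact hsrc v l hl l hl' hv (mem_nodes_src hl' hv)
    rcases htgt (.e y) _ hl _ hl' (by simp [Link.tgt]) (by simp [Link.tgt]) with ⟨⟨_, _, h2⟩, -⟩
    cases h2
  have hboxA : ∀ p ∈ A, p.IsPar → box p ⊆ A := hA.box_subset
  have hboxB : ∀ p ∈ B, p.IsPar → box p ⊆ B := hB.box_subset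
  have hlevA : ∀ p ∈ A, p.IsPar → ∀ l ∈ B, l ∈ box p ∨ l = p → False := by
    rintro p hp hpp l hl (h1 | rfl)
    · exact hdisj l (hboxA p hp hpp h1) hl
    · exact hdisj l hp hl
  have hlevB : ∀ p ∈ B, p.IsPar → ∀ l ∈ A, l ∈ box p ∨ l = p → False := by
    rintro p hp hpp l hl (h1 | rfl)
    · exact hdisj l hl (hboxB p hp hpp h1)
    · exact hdisj l hl hp
  have hout : ∀ {p v l}, PreNet.OutLevel ⟨A ∪ B, r, box⟩ p v l → l ∈ box p ∨ l = p :=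
    fun h => h.imp_right And.left
  constructor
  case finite => exact hA.finite.union hB.finite
  case box_subset =>
    rintro p (hp | hp) hpp
    · exact (hboxA p hp hpp).trans Set.subset_union_left
    · exact (hboxB p hp hpp).trans Set.subset_union_right
  case box_irrefl =>
    rintro p (hp | hp) hpp
    · exact hA.box_irrefl p hp hpp
    · exact hB.box_irrefl p hp hpp
  case box_trans =>
    rintro p (hp | hp) hpp
    · exact hA.box_trans p hp hpp
    · exact hB.box_trans p hp hpp
  case box_laminar =>
    rintro p (hp | hp) hpp p' (hp' | hp') hpp' l hl hl'
    · exact hA.box_laminar p hp hpp p' hp' hpp' l hl hl'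
    · exact absurd (hboxB p' hp' hpp' hl') (hdisj l (hboxA p hp hpp hl))
    · exact absurd (hboxB p hp hpp hl) (hdisj l (hboxA p' hp' hpp' hl'))
    · exact hB.box_laminar p hp hpp p' hp' hpp' l hl hl'
  case in_unique =>
    rintro v l (hl | hl) l' (hl' | hl') hv hv' hne
    · exact hA.in_unique v l hl l' hl' hv hv' hne
    · exact htgt v l hl l' hl' hv hv'
    · exact (htgt v l' hl' l hl hv' hv).symm
    · exact hB.in_unique v l hl l' hl' hv hv' hne
  case out_unique =>
    rintro v l (hl | hl) l' (hl' | hl') hv hv'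
    · exact hA.out_unique v l hl l' hl' hv hv'
    · exact absurd (mem_nodes_src hl' hv') (hsrc v l hl l' hl' hv)
    · exact absurd (mem_nodes_src hl hv) (hsrc v l' hl' l hl hv')
    · exact hB.out_unique v l hl l' hl' hv hv'
  case of_no_in =>
    rintro v l (hl | hl) hv hno
    · obtain ⟨h1, h2⟩ := hA.of_no_in v l hl hv fun l' hl' => hno l' (.inl hl')
      refine ⟨h1, ?_⟩
      rintro p (hp | hp) hpp ho
      · exact h2 p hp hpp ho
      · exact hlevB p hp hpp l hl (hout ho)
    · obtain ⟨rfl, -⟩ := hB.of_no_in v l hl hv fun l' hl' => hno l' (.inr hl')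
      obtain ⟨⟨k, hk, h1 | h1⟩, -⟩ := hu
      · exact absurd h1 (huA k hk)
      · exact absurd h1 (hno k (.inl hk))
  case of_no_out =>
    rintro v l (hl | hl) hv hno
    · rcases hA.of_no_out v l hl hv fun l' hl' => hno l' (.inl hl') with
        h1 | ⟨h1 | ⟨-, y, hy, h1⟩, h2⟩
      · exact .inl h1
      · refine .inr ⟨.inl h1, ?_⟩
        rintro p (hp | hp) hpp hlp
        · exact h2 p hp hpp hlp
        · exact hlevB p hp hpp l hl (.inl hlp)
      · obtain rfl : y = u := hy
        exact absurd (h1 ▸ hkus) (hno ku (.inr hku))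
    · rcases hB.of_no_out v l hl hv fun l' hl' => hno l' (.inr hl') with h1 | ⟨h1, h2⟩
      · exact .inl h1
      · refine .inr ⟨h1, ?_⟩
        rintro p (hp | hp) hpp hlp
        · exact hlevA p hp hpp l hl (.inl hlp)
        · exact h2 p hp hpp hlp
  case root_out =>
    obtain ⟨l, hl, h1⟩ := hA.root_out
    exact ⟨l, .inl hl, h1⟩
  case root_in =>
    rintro l (hl | hl) hv
    · exact hA.root_in l hl hv
    · obtain ⟨k, hk, h1⟩ := hA.root_out
      exact hsrc _ k hk l hl h1 (mem_nodes_tgt hl hv)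
  case level_le =>
    rintro v l (hl | hl) l' (hl' | hl') hv hv' p (hp | hp) hpp ho
    · exact hA.level_le v l hl l' hl' hv hv' p hp hpp ho
    · exact (hlevB p hp hpp l hl (hout ho)).elim
    · exact absurd (mem_nodes_tgt hl' hv') (hsrc v l hl l' hl' hv)
    · exact absurd (mem_nodes_tgt hl' hv') (hsrc v l hl l' hl' hv)
    · exact (hlevA p hp hpp l hl (hout ho)).elim
    · obtain rfl := hglue v l hl l' hl' hv hv'
      exact absurd ho ((hB.of_no_in _ l hl hv huB).2 p hp hpp)
    · exact (hlevA p hp hpp l hl (hout ho)).elim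
    · exact hB.level_le v l hl l' hl' hv hv' p hp hpp ho
  case level_eq =>
    rintro v l (hl | hl) l' (hl' | hl') hv hv' hd p (hp | hp) hpp hi
    · exact hA.level_eq v l hl l' hl' hv hv' hd p hp hpp hi
    · exact (hlevB p hp hpp l' hl' hi).elim
    · exact absurd (mem_nodes_tgt hl' hv') (hsrc v l hl l' hl' hv)
    · exact absurd (mem_nodes_tgt hl' hv') (hsrc v l hl l' hl' hv)
    · obtain rfl := hglue v l hl l' hl' hv hv'
      rcases hA.of_no_out _ l' hl' hv' huA with h1 | ⟨h1, h2⟩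
      · exact absurd h1 hd
      · rcases hi with hi | rfl
        · exact absurd hi (h2 p hp hpp)
        · rcases h1 with ⟨y, rfl⟩ | ⟨h1, -⟩
          · obtain ⟨_, _, _, hb⟩ := hpp; cases hb
          · exact absurd hpp h1
    · exact (hlevB p hp hpp l' hl' hi).elim
    · exact (hlevA p hp hpp l' hl' hi).elim
    · exact hB.level_eq v l hl l' hl' hv hv' hd p hp hpp hi
  case variable_in =>
    rintro x l (hl | hl) l' (hl' | hl') hlp hv hv'
    · exact hA.variable_in x l hl l' hl' hlp hv hv'
    · exact absurd (mem_nodes_tgt hl' hv') (hsrc _ l hl l' hl' hv)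
    · obtain rfl : x = u := by simpa using hglue _ l hl l' hl' hv hv'
      exact absurd (.inr ⟨rfl, x, rfl⟩) ((hB.of_no_in _ l hl hv huB).2 l hl hlp)
    · exact hB.variable_in x l hl l' hl' hlp hv hv'
  case acyclic =>
    have key := acyclic_sup hA.acyclic hB.acyclic ?_
    · refine fun v hv => key v (hv.lift id ?_)
      rintro u w (⟨l, hl | hl, h1, h2, h3⟩ | ⟨b, y, q', hq | hq, h1⟩)
      · exact .inl (.link l hl h1 h2 h3)
      · exact .inr (.link l hl h1 h2 h3)
      · exact .inl (.box b y q' hq h1)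
      · exact .inr (.box b y q' hq h1)
    · intro z v w h1 h2
      have hvB : v ∈ nodes B := by
        rcases h1 with ⟨l, hl, -, -, h3⟩ | ⟨b, y, q, hq, h3⟩
        · exact mem_nodes_tgt hl h3
        · exact nodes_mono (hboxB _ hq (Link.isPar_par ..)) h3
      rcases h2 with ⟨l, hl, -, h3, -⟩ | ⟨b, y, q, hq, h3⟩
      · exact hsrc v l hl ku hku h3 hvB
      · exact hsrc _ _ hq ku hku (by simp [Link.src]) hvB

end Leveled

theorem root_notMem_freeVars {E : Set ℕ} {G : PreNet} (h : Leveled E G) :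
    G.root ∉ freeVars G.links := by
  obtain ⟨l, hl, hr⟩ := h.root_out
  exact fun hf => hf.2 l hl hr

theorem HeadLink.freeVars_der {T : Link} {r a x : ℕ} {E : Set ℕ} (hT : HeadLink T r a E)
    (hxr : x ≠ r) : freeVars {T, .der a x} = E ∪ {x} := by
  obtain ⟨hs, ht, -, -, -, hr⟩ := hT
  ext y
  rw [mem_freeVars_iff]
  have hs' : Node.e y ∉ (Link.der a x).src := by simp [Link.src]
  have ht' : Node.e y ∈ (Link.der a x).tgt ↔ y = x := by simp [Link.tgt]
  simp only [Set.mem_insert_iff, Set.mem_singleton_iff, exists_eq_or_imp, exists_eq_left,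
    forall_eq_or_imp, forall_eq, hs, ht, hs', ht', Set.mem_union, Node.e.injEq, reduceCtorEq,
    false_or, not_false_eq_true, and_true, exists_eq_right']
  constructor
  · exact fun h => h.1
  · rintro h
    refine ⟨h, ?_⟩
    rintro rfl
    exact h.elim hr fun h => hxr h.symm

theorem HeadLink.freeVars_abs {T : Link} {r a x q : ℕ} {E : Set ℕ} {W : Set Link}
    (hT : HeadLink T r a E) (hq : ∃ l ∈ W, Node.e q ∈ l.src) (hr : r ∉ eNodes W)
    (hx : x ∈ freeVars W) (hE : ∀ y ∈ E, y ∉ eNodes W) :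
    freeVars ({T, .par a x q} ∪ W) = E ∪ (freeVars W \ {x}) := by
  obtain ⟨hs, ht, -, -, -, hr'⟩ := hT
  obtain ⟨k, hk, hq⟩ := hq
  ext y
  rw [Set.mem_union, Set.mem_sdiff, mem_freeVars_iff, mem_freeVars_iff]
  constructor
  · rintro ⟨⟨l, (rfl | rfl) | hl, hv⟩, hno⟩
    · obtain ⟨z, hz, h⟩ : ∃ z ∈ E, Node.e y = .e z := by simpa using (ht _).1 hv
      cases h; exact .inl hz
    · obtain rfl : y = q := by simpa [Link.tgt] using hv
      exact absurd hq (hno k (.inr hk))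
    · refine .inr ⟨⟨⟨l, hl, hv⟩, fun l' hl' => hno l' (.inr hl')⟩, ?_⟩
      rintro rfl
      exact hno (.par a y q) (.inl (.inr rfl)) (by simp [Link.src])
  · rintro (hy | ⟨⟨⟨l, hl, hv⟩, hno⟩, hyx⟩)
    · refine ⟨⟨T, by simp, (ht _).2 (.inr ⟨y, hy, rfl⟩)⟩, ?_⟩
      rintro l ((rfl | rfl) | hl) hv
      · have := (hs _).1 hv
        cases this; exact hr' hy
      · obtain rfl : y = x := by simpa [Link.src] using hv
        exact hE y hy hx.1
      · exact hE y hy (mem_nodes_src hl hv)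
    · refine ⟨⟨l, .inr hl, hv⟩, ?_⟩
      rintro l' ((rfl | rfl) | hl') hv'
      · have := (hs _).1 hv'
        cases this; exact hr (mem_nodes_tgt hl hv)
      · exact hyx (by simpa [Link.src] using hv')
      · exact hno l' hl' hv'

theorem freeVars_glue {A B : Set Link} {u : ℕ} (hu : u ∈ freeVars A) (hu' : ∃ l ∈ B, .e u ∈ l.src)
    (hAB : ∀ v ∈ nodes A, v ∈ nodes B → v = .e u ∨ ∃ y, v = .e y ∧ y ∈ freeVars A ∧
      y ∈ freeVars B ∧ Link.weak y ∉ A ∧ Link.weak y ∉ B) :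
    freeVars (A ∪ B) = freeVars A \ {u} ∪ freeVars B := by
  obtain ⟨k, hk, hku⟩ := hu'
  ext y
  constructor
  · rintro ⟨⟨l, hl | hl, hv⟩, hno⟩
    · refine .inl ⟨⟨⟨l, hl, hv⟩, fun l' hl' => hno l' (.inl hl')⟩, ?_⟩
      rintro rfl
      exact hno k (.inr hk) hku
    · exact .inr ⟨⟨l, hl, hv⟩, fun l' hl' => hno l' (.inr hl')⟩
  · rintro (⟨⟨⟨l, hl, hv⟩, hno⟩, hyu⟩ | ⟨⟨l, hl, hv⟩, hno⟩)
    · refine ⟨⟨l, .inl hl, hv⟩, ?_⟩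
      rintro l' (hl' | hl') hv'
      · exact hno l' hl' hv'
      · rcases hAB _ ⟨l, hl, hv⟩ (mem_nodes_src hl' hv') with h1 | ⟨z, h1, -, h2, -⟩
        · exact hyu (by simpa using h1)
        · cases h1; exact h2.2 l' hl' hv'
    · refine ⟨⟨l, .inr hl, hv⟩, ?_⟩
      rintro l' (hl' | hl') hv'
      · rcases hAB _ (mem_nodes_src hl' hv') ⟨l, hl, hv⟩ with h1 | ⟨z, h1, h2, -⟩
        · cases h1; exact hno k hk hku
        · cases h1; exact h2.2 l' hl' hv'
      · exact hno l' hl' hv'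

theorem weak_mem_addWeak {L : Set Link} {t : Term} {X : Set ℕ} {y : ℕ} :
    Link.weak y ∈ addWeak L t X ↔ Link.weak y ∈ L ∨ (y ∈ X ∧ y ∉ t.fv) := by
  simp [addWeak]

theorem freeVars_addWeak {L : Set Link} {t : Term} {X : Set ℕ} (hX : NoClash X L t)
    (ht : freeVars L = t.fv) : freeVars (addWeak L t X) = t.fv ∪ X := by
  ext y
  constructor
  · rintro ⟨⟨l, hl | ⟨z, hz, rfl⟩, hv⟩, hno⟩
    · exact .inl (ht ▸ ⟨⟨l, hl, hv⟩, fun l' hl' => hno l' (.inl hl')⟩)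
    · obtain rfl : y = z := by simpa [Link.src, Link.tgt] using hv
      exact .inr hz.1
  · intro hy
    by_cases hyt : y ∈ t.fv
    · obtain ⟨⟨l, hl, hv⟩, hno⟩ : y ∈ freeVars L := ht ▸ hyt
      refine ⟨⟨l, .inl hl, hv⟩, ?_⟩
      rintro l' (hl' | ⟨z, hz, rfl⟩)
      · exact hno l' hl'
      · simp [Link.src]
    · have hyX := hy.resolve_left hyt
      refine ⟨⟨.weak y, .inr ⟨y, ⟨hyX, hyt⟩, rfl⟩, by simp [Link.tgt]⟩, ?_⟩
      rintro l' (hl' | ⟨z, hz, rfl⟩) hv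
      · exact hyt (hX ⟨hyX, mem_nodes_src hl' hv⟩)
      · simp [Link.src] at hv

theorem Leveled.addWeak {E : Set ℕ} {box : Link → Set Link} {L : Set Link} {r : ℕ} {t : Term}
    {X : Set ℕ} (h : Leveled E ⟨L, r, box⟩) (hX : X.Finite) (hXL : NoClash X L t) :
    Leveled E ⟨addWeak L t X, r, box⟩ :=
  h.weaken hX.sdiff fun _ hy hyL => hy.2 (hXL ⟨hy.1, hyL⟩)

theorem Trans.leveled {box : Link → Set Link} {t : Term} {r : ℕ} {L : Set Link}
    (h : Trans box t r L) :
    Leveled ∅ ⟨L, r, box⟩ ∧ freeVars L = t.fv ∧ ∀ y ∈ t.fv, Link.weak y ∉ L := by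
  induction h with
  | var x r a hrx =>
    have hT := headLink_bang r a
    refine ⟨.der hT (Ne.symm hrx) (by simp), ?_, by simp⟩
    rw [hT.freeVars_der (Ne.symm hrx)]; simp [Term.fv]
  | lam x t q L W r a _ hc hW hr ha hb ih =>
    obtain ⟨ih, hf, hw⟩ := ih
    have hT := headLink_bang r a
    have hWl : Leveled ∅ ⟨W, q, box⟩ := hW ▸ ih.addWeak (Set.finite_singleton x) hc
    have hWf : freeVars W = t.fv ∪ {x} := hW ▸ freeVars_addWeak hc hf
    have hWw : ∀ y ∈ t.fv, Link.weak y ∉ W := fun y hy => by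
      rw [hW, weak_mem_addWeak]; simp [hw y hy, hy]
    have hx : x ∈ freeVars W := by simp [hWf]
    obtain ⟨kq, hkq, hq⟩ := hWl.root_out
    refine ⟨.abs hT hWl hb hx (fun y hy hyx => hWw y ?_) hr ha (by simp), ?_, ?_⟩
    · rw [hWf] at hy; exact hy.resolve_right hyx
    · rw [hT.freeVars_abs ⟨kq, hkq, hq⟩ hr hx (by simp), hWf]
      ext y; simp [Term.fv]
    · intro y hy
      simp [hWw y hy.1]
  | appVar x s u L r a _ hc hrx hr ha ih =>
    obtain ⟨ih, hf, hw⟩ := ih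
    obtain ⟨k, hk, hku⟩ : ∃ l ∈ L, Node.e u ∈ l.src := ih.root_out
    have huL : u ∈ eNodes L := mem_nodes_src hk hku
    have hus : u ∉ s.fv := hf ▸ root_notMem_freeVars ih
    have hru : r ≠ u := fun hru => hr (hru ▸ huL)
    have hxu : x ≠ u := fun hxu => hus (hc ⟨hxu.symm, huL⟩)
    have hT := headLink_tens a hru
    have hA := Leveled.der (box := box) hT (Ne.symm hrx) (by simpa using hxu)
    have hAf := hT.freeVars_der (Ne.symm hrx)
    have hAB : ∀ v ∈ nodes {.tens r a u, .der a x}, v ∈ nodes L → v = .e u ∨ ∃ y, v = .e y ∧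
        y ∈ freeVars {.tens r a u, .der a x} ∧ y ∈ freeVars L ∧
        Link.weak y ∉ ({.tens r a u, .der a x} : Set Link) ∧ Link.weak y ∉ L := by
      rintro v ⟨l, rfl | rfl, hv⟩ hvL
      · have : v = .e r ∨ v = .m a ∨ v = .e u := by simpa [Link.src, Link.tgt] using hv
        rcases this with rfl | rfl | rfl
        · exact absurd hvL hr
        · exact absurd hvL ha
        · exact .inl rfl
      · have : v = .m a ∨ v = .e x := by simpa [Link.src, Link.tgt] using hv
        rcases this with rfl | rfl
        · exact absurd hvL ha
        · have hxs : x ∈ s.fv := hc ⟨rfl, hvL⟩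
          exact .inr ⟨x, rfl, by simp [hAf], hf ▸ hxs, by simp, hw x hxs⟩
    have hu : u ∈ freeVars {.tens r a u, .der a x} := by simp [hAf]
    refine ⟨hA.glue ih hu hAB, ?_, ?_⟩
    · rw [freeVars_glue hu ⟨k, hk, hku⟩ hAB, hAf, hf]
      ext y; simp only [Term.fv, Set.mem_union, Set.mem_sdiff, Set.mem_singleton_iff]; grind
    · rintro y hy ((hy' | hy') | hy')
      · cases hy'
      · cases hy'
      · refine hw y ?_ hy'
        rcases hy with rfl | hy
        · exact hc ⟨rfl, mem_nodes_tgt hy' (by simp [Link.tgt])⟩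
        · exact hy
  | appLam x t s q u L W L' r a _ hc hW _ hsh hdm hrW hrL haW haL hb ih ih' =>
    obtain ⟨ih, hf, hw⟩ := ih
    obtain ⟨ih', hf', hw'⟩ := ih'
    obtain ⟨k, hk, hku⟩ : ∃ l ∈ L', Node.e u ∈ l.src := ih'.root_out
    have huL : u ∈ eNodes L' := mem_nodes_src hk hku
    have hus : u ∉ s.fv := hf' ▸ root_notMem_freeVars ih'
    have huW : u ∉ eNodes W := fun h => hus (hsh ⟨h, huL⟩).2
    have hru : r ≠ u := fun hru => hrL (hru ▸ huL)
    have hT := headLink_tens a hru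
    have hWl : Leveled ∅ ⟨W, q, box⟩ := hW ▸ ih.addWeak (Set.finite_singleton x) hc
    have hWf : freeVars W = t.fv ∪ {x} := hW ▸ freeVars_addWeak hc hf
    have hWw : ∀ y ∈ t.fv, Link.weak y ∉ W := fun y hy => by
      rw [hW, weak_mem_addWeak]; simp [hw y hy, hy]
    have hx : x ∈ freeVars W := by simp [hWf]
    obtain ⟨kq, hkq, hq⟩ := hWl.root_out
    have hE : ∀ y ∈ ({u} : Set ℕ), y ∉ eNodes W := by rintro y rfl; exact huW
    have hA := Leveled.abs hT hWl hb hx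
      (fun y hy hyx => hWw y ((hWf ▸ hy : y ∈ t.fv ∪ {x}).resolve_right hyx)) hrW haW hE
    have hAf := hT.freeVars_abs ⟨kq, hkq, hq⟩ hrW hx hE
    have hAn : ∀ v ∈ nodes ({.tens r a u, .par a x q} ∪ W),
        v = .e r ∨ v = .m a ∨ v = .e u ∨ v ∈ nodes W := by
      rintro v ⟨l, (rfl | rfl) | hl, hv⟩
      · have : v = .e r ∨ v = .m a ∨ v = .e u := by simpa [Link.src, Link.tgt] using hv
        tauto
      · have : (v = .m a ∨ v = .e x) ∨ v = .e q := by simpa [Link.src, Link.tgt] using hv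
        rcases this with (rfl | rfl) | rfl
        · simp
        · exact .inr (.inr (.inr hx.1))
        · exact .inr (.inr (.inr (mem_nodes_src hkq hq)))
      · exact .inr (.inr (.inr ⟨l, hl, hv⟩))
    have hwA : ∀ y ∈ t.fv, Link.weak y ∉ ({.tens r a u, .par a x q} ∪ W : Set Link) :=
      fun y hy => by simp [hWw y hy]
    have hAB : ∀ v ∈ nodes ({.tens r a u, .par a x q} ∪ W), v ∈ nodes L' → v = .e u ∨
        ∃ y, v = .e y ∧ y ∈ freeVars ({.tens r a u, .par a x q} ∪ W) ∧ y ∈ freeVars L' ∧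
        Link.weak y ∉ ({.tens r a u, .par a x q} ∪ W : Set Link) ∧ Link.weak y ∉ L' := by
      intro v hv hvL
      rcases hAn v hv with rfl | rfl | rfl | hvW
      · exact absurd hvL hrL
      · exact absurd hvL haL
      · exact .inl rfl
      · rcases v with y | b
        · obtain ⟨⟨h1, h2⟩, h3⟩ := hsh ⟨hvW, hvL⟩
          exact .inr ⟨y, rfl, by rw [hAf, hWf]; exact .inr ⟨.inl h1, h2⟩, hf' ▸ h3, hwA y h1,
            hw' y h3⟩
        · exact absurd hvL (Set.disjoint_left.mp hdm hvW)
    have hu : u ∈ freeVars ({.tens r a u, .par a x q} ∪ W) := by simp [hAf]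
    refine ⟨hA.glue ih' hu hAB, ?_, ?_⟩
    · rw [freeVars_glue hu ⟨k, hk, hku⟩ hAB, hAf, hWf, hf']
      have : u ∉ t.fv \ {x} := fun h => huW ((hWf ▸ .inl h.1 : u ∈ freeVars W)).1
      ext y
      simp only [Term.fv, Set.mem_union, Set.mem_sdiff, Set.mem_singleton_iff] at this ⊢
      grind
    · rintro y hy (hy' | hy')
      · have hyW : Link.weak y ∈ W := by simpa using hy'
        rcases hy with hy | hy
        · exact hWw y hy.1 hyW
        · have hyL : y ∈ freeVars L' := hf' ▸ hy
          exact hWw y (hsh ⟨mem_nodes_tgt hyW (by simp [Link.tgt]), hyL.1⟩).1.1 hyW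
      · rcases hy with hy | hy
        · exact hw' y (hsh ⟨(hWf ▸ .inl hy.1 : y ∈ freeVars W).1,
            mem_nodes_tgt hy' (by simp [Link.tgt])⟩).2 hy'
        · exact hw' y hy hy'
  | esub t x s r L W L' _ hc hW _ hsh hdm ih ih' =>
    obtain ⟨ih, hf, hw⟩ := ih
    obtain ⟨ih', hf', hw'⟩ := ih'
    obtain ⟨k, hk, hku⟩ : ∃ l ∈ L', Node.e x ∈ l.src := ih'.root_out
    have hxs : x ∉ s.fv := hf' ▸ root_notMem_freeVars ih'
    have hWl : Leveled ∅ ⟨W, r, box⟩ := hW ▸ ih.addWeak (Set.finite_singleton x) hc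
    have hWf : freeVars W = t.fv ∪ {x} := hW ▸ freeVars_addWeak hc hf
    have hWw : ∀ y ∈ t.fv, Link.weak y ∉ W := fun y hy => by
      rw [hW, weak_mem_addWeak]; simp [hw y hy, hy]
    have hx : x ∈ freeVars W := by simp [hWf]
    have hAB : ∀ v ∈ nodes W, v ∈ nodes L' → v = .e x ∨
        ∃ y, v = .e y ∧ y ∈ freeVars W ∧ y ∈ freeVars L' ∧ Link.weak y ∉ W ∧ Link.weak y ∉ L' := by
      intro v hvW hvL
      rcases v with y | b
      · rcases hsh ⟨hvW, hvL⟩ with h1 | ⟨h1, h2⟩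
        · exact .inl (congrArg Node.e h1)
        · exact .inr ⟨y, rfl, hWf ▸ .inl h1, hf' ▸ h2, hWw y h1, hw' y h2⟩
      · exact absurd hvL (Set.disjoint_left.mp hdm hvW)
    refine ⟨(hWl.mono _).glue ih' hx hAB, ?_, ?_⟩
    · rw [freeVars_glue hx ⟨k, hk, hku⟩ hAB, hWf, hf']
      ext y; simp only [Term.fv, Set.mem_union, Set.mem_sdiff, Set.mem_singleton_iff]; grind
    · rintro y hy (hy' | hy')
      · rcases hy with hy | hy
        · exact hWw y hy.1 hy'
        · rcases hsh ⟨mem_nodes_tgt hy' (by simp [Link.tgt]), (hf' ▸ hy : y ∈ freeVars L').1⟩ with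
            h1 | h1
          · exact hxs (h1 ▸ hy)
          · exact hWw y h1.1 hy'
      · rcases hy with hy | hy
        · rcases hsh ⟨(hWf ▸ .inl hy.1 : y ∈ freeVars W).1,
            mem_nodes_tgt hy' (by simp [Link.tgt])⟩ with h1 | h1
          · exact hy.2 h1
          · exact hw' y h1.2 hy'
        · exact hw' y hy hy'

theorem IsProofNet.leveled {G : PreNet} (h : IsProofNet G) : Leveled ∅ G := by
  obtain ⟨t, X, L, hL, hX, hG⟩ := h
  have := hL.leveled.1.addWeak X.finite_toSet hX
  rwa [← hG] at this

/-! ### The multiplicative step -/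

theorem acyclic_of_lex {α β : Type*} {R : α → α → Prop} {S : β → β → Prop}
    (hS : ∀ v, ¬ Relation.TransGen S v v) (φ ψ : α → β)
    (h : ∀ u v, R u v → Relation.TransGen S (φ u) (φ v) ∨
      (φ u = φ v ∧ Relation.TransGen S (ψ u) (ψ v))) (v : α) : ¬ Relation.TransGen R v v := by
  have key : ∀ u w, Relation.TransGen R u w → Relation.TransGen S (φ u) (φ w) ∨
      (φ u = φ w ∧ Relation.TransGen S (ψ u) (ψ w)) := by
    intro u w huw
    induction huw with
    | single h1 => exact h _ _ h1
    | tail _ h1 ih =>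
      rcases ih with ih | ⟨ih, ih'⟩ <;> rcases h _ _ h1 with h2 | ⟨h2, h2'⟩
      · exact .inl (ih.trans h2)
      · exact .inl (h2 ▸ ih)
      · exact .inl (ih ▸ h2)
      · exact .inr ⟨ih.trans h2, ih'.trans h2'⟩
  intro hv
  rcases key v v hv with h1 | ⟨-, h1⟩ <;> exact hS _ h1

/-- The two links of a multiplicative cut in a levelled net. -/
structure MultCut (G : PreNet) (s a u x r : ℕ) : Prop where
  leveled : Leveled ∅ G
  tens_mem : Link.tens s a u ∈ G.links
  par_mem : Link.par a x r ∈ G.links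

namespace MultCut

variable {G : PreNet} {s a u x r : ℕ}

theorem tens_mem_box_iff (h : MultCut G s a u x r) {p : Link} (hp : p ∈ G.links)
    (hpp : p.IsPar) : Link.tens s a u ∈ G.box p ↔ Link.par a x r ∈ G.box p := by
  have hs : Node.m a ∈ (Link.par a x r).src := by simp [Link.src]
  have ht : Node.m a ∈ (Link.tens s a u).tgt := by simp [Link.tgt]
  constructor
  · intro h1
    rcases h.leveled.level_eq _ _ h.par_mem _ h.tens_mem hs ht (Link.not_isDer_of_m_tgt ht) p hp hpp
      (.inl h1) with h2 | ⟨-, y, hy⟩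
    · exact h2
    · cases hy
  · intro h1
    rcases h.leveled.level_le _ _ h.par_mem _ h.tens_mem hs ht p hp hpp (.inl h1) with h2 | rfl
    · exact h2
    · exact absurd hpp (Link.not_isPar_of_m_tgt ht)

theorem tens_notMem_box (h : MultCut G s a u x r) :
    Link.tens s a u ∉ G.box (.par a x r) := fun h1 =>
  h.leveled.box_irrefl _ h.par_mem (Link.isPar_par ..)
    ((h.tens_mem_box_iff h.par_mem (Link.isPar_par ..)).1 h1)

theorem s_ne_r (h : MultCut G s a u x r) : s ≠ r := by
  rintro rfl
  exact h.tens_notMem_box (h.leveled.mem_box_of_src_root h.par_mem h.tens_mem (by simp [Link.src]))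

theorem s_ne_u (h : MultCut G s a u x r) : s ≠ u := by
  rintro rfl
  exact h.leveled.acyclic (.e s) (.single (.link _ h.tens_mem (by rintro ⟨_, _, _, h⟩; cases h)
    (by simp [Link.src]) (by simp [Link.tgt])))

theorem s_ne_x (h : MultCut G s a u x r) : s ≠ x := by
  rintro rfl
  cases h.leveled.src_eq_par h.par_mem h.tens_mem (by simp [Link.src])

theorem u_ne_r (h : MultCut G s a u x r) : u ≠ r := by
  rintro rfl
  cases h.leveled.tgt_eq_par h.par_mem h.tens_mem (by simp [Link.tgt])

theorem u_ne_x (h : MultCut G s a u x r) : u ≠ x := by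
  rintro rfl
  exact h.tens_notMem_box
    (h.leveled.mem_box_of_tgt_variable h.par_mem h.tens_mem (by simp [Link.tgt]))

theorem x_ne_r (h : MultCut G s a u x r) : x ≠ r := by
  rintro rfl
  exact h.leveled.box_irrefl _ h.par_mem (Link.isPar_par ..)
    (h.leveled.mem_box_of_tgt_variable h.par_mem h.par_mem (by simp [Link.tgt]))

theorem src_ne (h : MultCut G s a u x r) {k : Link} {v : Node}
    (hk : k ∈ G.links \ {.tens s a u, .par a x r}) (hv : v ∈ k.src) :
    v ≠ .e s ∧ v ≠ .e x ∧ v ≠ .m a := by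
  simp only [Set.mem_sdiff, Set.mem_insert_iff, Set.mem_singleton_iff, not_or] at hk
  refine ⟨?_, ?_, ?_⟩ <;> rintro rfl
  · exact hk.2.1 (h.leveled.out_unique _ k hk.1 _ h.tens_mem hv (by simp [Link.src]))
  · exact hk.2.2 (h.leveled.out_unique _ k hk.1 _ h.par_mem hv (by simp [Link.src]))
  · exact hk.2.2 (h.leveled.out_unique _ k hk.1 _ h.par_mem hv (by simp [Link.src]))

theorem tgt_ne (h : MultCut G s a u x r) {k : Link} {v : Node}
    (hk : k ∈ G.links \ {.tens s a u, .par a x r}) (hv : v ∈ k.tgt) :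
    v ≠ .e r ∧ v ≠ .e u ∧ v ≠ .m a := by
  simp only [Set.mem_sdiff, Set.mem_insert_iff, Set.mem_singleton_iff, not_or] at hk
  have hd : ¬ (Link.tens s a u).IsDer := by rintro ⟨_, _, h⟩; cases h
  refine ⟨?_, ?_, ?_⟩ <;> rintro rfl
  · exact hk.2.2 (h.leveled.tgt_eq_par h.par_mem hk.1 hv)
  · exact hd (h.leveled.in_unique _ k hk.1 _ h.tens_mem hv (by simp [Link.tgt]) hk.2.1).2
  · exact hd (h.leveled.in_unique _ k hk.1 _ h.tens_mem hv (by simp [Link.tgt]) hk.2.1).2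

/-- The identification of nodes in a multiplicative step. -/
theorem map_merge (h : MultCut G s a u x r) {σ : ℕ → ℕ}
    (hσ : σ = fun z => if z = r then s else if z = x then u else z) (v : Node) :
    (v = .e r ∧ v.map σ id = .e s) ∨ (v = .e x ∧ v.map σ id = .e u) ∨
      (v ≠ .e r ∧ v ≠ .e x ∧ v.map σ id = v) := by
  have := h.x_ne_r
  subst hσ
  rcases v with z | b
  · simp only [Node.map, Node.e.injEq]
    grind
  · simp [Node.map]

/-- A multiplicative step preserves levelled nets. Merged nodes take their incoming link from `s`
and `x`, and their outgoing link from `r` and `u`. -/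
theorem leveled_step (h : MultCut G s a u x r) {G' : PreNet} {σ : ℕ → ℕ} {K : Set Link}
    (hσ : σ = fun z => if z = r then s else if z = x then u else z)
    (hK : K = G.links \ {.tens s a u, .par a x r})
    (links : G'.links = Link.map σ id '' K)
    (root : G'.root = G.root)
    (box : ∀ p ∈ K, p.IsPar → G'.box (p.map σ id) = Link.map σ id '' (G.box p ∩ K)) :
    Leveled ∅ G' := by
  have hG := h.leveled
  have hsr := h.s_ne_r; have hsu := h.s_ne_u; have hsx := h.s_ne_x
  have hur := h.u_ne_r; have hux := h.u_ne_x; have hxr := h.x_ne_r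
  have hsrc : ∀ k ∈ K, ∀ v ∈ k.src, v ≠ .e s ∧ v ≠ .e x ∧ v ≠ .m a :=
    fun k hk v hv => h.src_ne (hK ▸ hk) hv
  have htgt : ∀ k ∈ K, ∀ v ∈ k.tgt, v ≠ .e r ∧ v ≠ .e u ∧ v ≠ .m a :=
    fun k hk v hv => h.tgt_ne (hK ▸ hk) hv
  have hmap := h.map_merge hσ
  have hT := h.tens_mem
  have hP := h.par_mem
  have hTP := fun {p} => h.tens_mem_box_iff (p := p)
  set T := Link.tens s a u with hTdef
  set P := Link.par a x r with hPdef
  have hPp : P.IsPar := Link.isPar_par ..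
  have hTs : ∀ v, v ∈ T.src ↔ v = .e s := by simp [hTdef, Link.src]
  have hTt : ∀ v, v ∈ T.tgt ↔ v = .m a ∨ v = .e u := by simp [hTdef, Link.tgt]
  have hPs : ∀ v, v ∈ P.src ↔ v = .m a ∨ v = .e x := by simp [hPdef, Link.src]
  have hPt : ∀ v, v ∈ P.tgt ↔ v = .e r := by simp [hPdef, Link.tgt]
  have hTp : ¬ T.IsPar := Link.not_isPar_of_m_tgt ((hTt _).2 (.inl rfl))
  have hTd : ¬ T.IsDer := Link.not_isDer_of_m_tgt ((hTt _).2 (.inl rfl))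
  have hTw : ¬ T.IsWeak := Link.not_isWeak_of_m_tgt ((hTt _).2 (.inl rfl))
  have hPd : ¬ P.IsDer := Link.not_isDer_of_isPar hPp
  have hKm : ∀ k, k ∈ K ↔ k ∈ G.links ∧ k ≠ T ∧ k ≠ P := by simp [hK]
  have hKL : ∀ k ∈ K, k ∈ G.links := fun k hk => ((hKm k).1 hk).1
  have hsinj : ∀ k ∈ K, ∀ v ∈ k.src, ∀ k' ∈ K, ∀ v' ∈ k'.src,
      v.map σ id = v'.map σ id → v = v' := by
    intro k hk v hv k' hk' v' hv'
    have := hsrc k hk v hv; have := hsrc k' hk' v' hv'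
    have := hmap v; have := hmap v'
    grind
  have htinj : ∀ k ∈ K, ∀ v ∈ k.tgt, ∀ k' ∈ K, ∀ v' ∈ k'.tgt,
      v.map σ id = v'.map σ id → v = v' := by
    intro k hk v hv k' hk' v' hv'
    have := htgt k hk v hv; have := htgt k' hk' v' hv'
    have := hmap v; have := hmap v'
    grind
  have hst : ∀ k ∈ K, ∀ v ∈ k.src, ∀ k' ∈ K, ∀ v' ∈ k'.tgt, v.map σ id = v'.map σ id →
      v = v' ∨ (v = .e r ∧ v' = .e s) ∨ (v = .e u ∧ v' = .e x) := by
    intro k hk v hv k' hk' v' hv'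
    have := hsrc k hk v hv; have := htgt k' hk' v' hv'
    have := hmap v; have := hmap v'
    grind
  have hrs : (Node.e r).map σ id = .e s := by have := hmap (.e r); grind
  have hxu : (Node.e x).map σ id = .e u := by have := hmap (.e x); grind
  have hid : ∀ v : Node, v ≠ .e r → v ≠ .e x → v.map σ id = v := by
    intro v h1 h2; have := hmap v; grind
  have hinj : ∀ k ∈ K, ∀ k' ∈ K, k.map σ id = k'.map σ id → k = k' := by
    intro k hk k' hk' heq
    by_cases hw : k.IsWeak
    · have hw' : k'.IsWeak := Link.isWeak_map.1 (heq ▸ Link.isWeak_map.2 hw)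
      obtain ⟨z, rfl⟩ := hw
      obtain ⟨z', rfl⟩ := hw'
      have := htinj _ hk (.e z) (by simp [Link.tgt]) _ hk' (.e z') (by simp [Link.tgt])
        (by simpa [Link.map, Node.map] using heq)
      cases this; rfl
    · obtain ⟨v, hv⟩ := Link.exists_src hw
      have h1 : v.map σ id ∈ (k'.map σ id).src := by
        rw [← heq, Link.src_map]; exact ⟨v, hv, rfl⟩
      rw [Link.src_map] at h1
      obtain ⟨v', hv', h2⟩ := h1
      obtain rfl := hsinj k' hk' v' hv' k hk v hv h2
      exact hG.out_unique _ k (hKL k hk) k' (hKL k' hk') hv hv'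
  have hbox : ∀ p ∈ K, p.IsPar → ∀ k ∈ K, k.map σ id ∈ G'.box (p.map σ id) ↔ k ∈ G.box p := by
    intro p hp hpp k hk
    rw [box p hp hpp]
    constructor
    · rintro ⟨k', ⟨h1, h2⟩, h3⟩
      exact hinj k' h2 k hk h3 ▸ h1
    · exact fun h1 => ⟨k, ⟨h1, hk⟩, rfl⟩
  have hmem : ∀ l ∈ G'.links, ∃ k ∈ K, k.map σ id = l := fun l hl => by rw [links] at hl; exact hl
  have hmem' : ∀ k ∈ K, k.map σ id ∈ G'.links := fun k hk => links ▸ ⟨k, hk, rfl⟩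
  have hs' : ∀ (k : Link) (v : Node),
      v ∈ (k.map σ id).src ↔ ∃ w ∈ k.src, w.map σ id = v := fun k v => by
    rw [Link.src_map]; rfl
  have ht' : ∀ (k : Link) (v : Node),
      v ∈ (k.map σ id).tgt ↔ ∃ w ∈ k.tgt, w.map σ id = v := fun k v => by
    rw [Link.tgt_map]; rfl
  have hpar : ∀ p ∈ G'.links, p.IsPar → ∃ q ∈ K, q.IsPar ∧ q.map σ id = p := by
    intro p hp hpp
    obtain ⟨q, hq, rfl⟩ := hmem p hp
    exact ⟨q, hq, Link.isPar_map.1 hpp, rfl⟩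
  have hout : ∀ p ∈ K, p.IsPar → ∀ k ∈ K, ∀ v : Node,
      G'.OutLevel (p.map σ id) (v.map σ id) (k.map σ id) ↔ G.OutLevel p v k := by
    intro p hp hpp k hk v
    refine or_congr (hbox p hp hpp k hk) (and_congr ⟨hinj k hk p hp, fun h => h ▸ rfl⟩ ?_)
    cases v <;> simp [Node.map]
  have hin : ∀ p ∈ K, p.IsPar → ∀ k ∈ K,
      G'.InLevel (p.map σ id) (k.map σ id) ↔ G.InLevel p k := by
    intro p hp hpp k hk
    exact or_congr (hbox p hp hpp k hk) ⟨hinj k hk p hp, fun h => h ▸ rfl⟩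
  have hboxK : ∀ p ∈ K, p.IsPar → ∀ l ∈ G'.box (p.map σ id),
      ∃ k ∈ K, k ∈ G.box p ∧ k.map σ id = l := by
    intro p hp hpp l hl
    rw [box p hp hpp] at hl
    obtain ⟨k, ⟨h1, h2⟩, h3⟩ := hl
    exact ⟨k, h2, h1, h3⟩
  constructor
  case finite => rw [links]; exact (hG.finite.subset hKL).image _
  case box_subset =>
    intro p hp hpp l hl
    obtain ⟨q, hq, hqp, rfl⟩ := hpar p hp hpp
    obtain ⟨k, hk, -, rfl⟩ := hboxK q hq hqp l hl
    exact hmem' k hk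
  case box_irrefl =>
    intro p hp hpp hc
    obtain ⟨q, hq, hqp, rfl⟩ := hpar p hp hpp
    exact hG.box_irrefl q (hKL q hq) hqp ((hbox q hq hqp q hq).1 hc)
  case box_trans =>
    intro p hp hpp p' hp' hpp' l hl
    obtain ⟨q, hq, hqp, rfl⟩ := hpar p hp hpp
    obtain ⟨q', hq', hqq, rfl⟩ := hboxK q hq hqp p' hp'
    have hqp' := Link.isPar_map.1 hpp'
    obtain ⟨k, hk, hkq, rfl⟩ := hboxK q' hq' hqp' l hl
    exact (hbox q hq hqp k hk).2 (hG.box_trans q (hKL q hq) hqp q' hqq hqp' hkq)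
  case box_laminar =>
    intro p hp hpp p' hp' hpp' l hl hl'
    obtain ⟨q, hq, hqp, rfl⟩ := hpar p hp hpp
    obtain ⟨q', hq', hqp', rfl⟩ := hpar p' hp' hpp'
    obtain ⟨k, hk, hkq, rfl⟩ := hboxK q hq hqp l hl
    have := (hbox q' hq' hqp' k hk).1 hl'
    rcases hG.box_laminar q (hKL q hq) hqp q' (hKL q' hq') hqp' k hkq this with rfl | h1 | h1
    · exact .inl rfl
    · exact .inr (.inl ((hbox q' hq' hqp' q hq).2 h1))
    · exact .inr (.inr ((hbox q hq hqp q' hq').2 h1))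
  case in_unique =>
    intro v l hl l' hl' hv hv' hne
    obtain ⟨k, hk, rfl⟩ := hmem l hl
    obtain ⟨k', hk', rfl⟩ := hmem l' hl'
    obtain ⟨w, hw, rfl⟩ := (ht' _ _).1 hv
    obtain ⟨w', hw', h1⟩ := (ht' _ _).1 hv'
    obtain rfl := htinj k' hk' w' hw' k hk w hw h1
    rw [Link.isDer_map, Link.isDer_map]
    exact hG.in_unique w' k (hKL k hk) k' (hKL k' hk') hw hw' fun h => hne (h ▸ rfl)
  case out_unique =>
    intro v l hl l' hl' hv hv'
    obtain ⟨k, hk, rfl⟩ := hmem l hl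
    obtain ⟨k', hk', rfl⟩ := hmem l' hl'
    obtain ⟨w, hw, rfl⟩ := (hs' _ _).1 hv
    obtain ⟨w', hw', h1⟩ := (hs' _ _).1 hv'
    obtain rfl := hsinj k' hk' w' hw' k hk w hw h1
    rw [hG.out_unique w' k (hKL k hk) k' (hKL k' hk') hw hw']
  case of_no_in =>
    intro v l hl hv hno
    obtain ⟨k, hk, rfl⟩ := hmem l hl
    obtain ⟨w, hw, rfl⟩ := (hs' _ _).1 hv
    have hno' : ∀ k' ∈ K, ∀ w' ∈ k'.tgt, w'.map σ id ≠ w.map σ id := fun k' hk' w' hw' heq =>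
      hno _ (hmem' k' hk') ((ht' _ _).2 ⟨w', hw', heq⟩)
    have hws := hsrc k hk w hw
    by_cases hwr : w = .e r
    · -- the root of the box takes the place of `s`
      subst hwr
      have hsin : ∀ l' ∈ G.links, Node.e s ∉ l'.tgt := by
        intro l' hl' hv'
        have hl'K : l' ∈ K := (hKm l').2 ⟨hl', by rintro rfl; simp [hTt, hsu] at hv', by
          rintro rfl; simp [hPt, hsr] at hv'⟩
        exact hno' l' hl'K _ hv' (by rw [hrs, hid] <;> simp [hsr, hsx])
      obtain ⟨h1, h2⟩ := hG.of_no_in _ T hT ((hTs _).2 rfl) hsin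
      refine ⟨by rw [hrs, root, h1], fun p hp hpp ho => ?_⟩
      obtain ⟨q, hq, hqp, rfl⟩ := hpar p hp hpp
      rw [hout q hq hqp k hk] at ho
      have hqL := (hKm q).1 hq
      rcases hG.level_le _ k (hKL k hk) P hP hw ((hPt _).2 rfl) q hqL.1 hqp ho with h3 | h3
      · exact h2 q hqL.1 hqp (.inl ((hTP hqL.1 hqp).2 h3))
      · exact hqL.2.2 h3.symm
    have hin0 : ∀ l' ∈ G.links, w ∉ l'.tgt := by
      intro l' hl' hv'
      by_cases hwu : w = .e u
      · subst hwu
        obtain ⟨kx, hkx, hkxt⟩ := hG.exists_tgt_variable hP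
        have hkxL := hG.box_subset _ hP hPp hkx
        refine hno' kx ((hKm kx).2 ⟨hkxL, ?_, ?_⟩) _ hkxt (by rw [hxu, hid] <;> simp [hur, hux])
        · rintro rfl; simp [hTt, hux.symm] at hkxt
        · rintro rfl; simp [hPt, hxr] at hkxt
      · refine hno' l' ((hKm l').2 ⟨hl', ?_, ?_⟩) _ hv' rfl
        · rintro rfl
          rcases (hTt _).1 hv' with h1 | h1
          · exact hws.2.2 h1
          · exact hwu h1
        · rintro rfl
          exact hwr ((hPt _).1 hv')
    obtain ⟨h1, h2⟩ := hG.of_no_in w k (hKL k hk) hw hin0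
    refine ⟨by rw [root, ← h1, hid _ hwr hws.2.1], fun p hp hpp ho => ?_⟩
    obtain ⟨q, hq, hqp, rfl⟩ := hpar p hp hpp
    exact h2 q (hKL q hq) hqp ((hout q hq hqp k hk w).1 ho)
  case of_no_out =>
    intro v l hl hv hno
    obtain ⟨k, hk, rfl⟩ := hmem l hl
    obtain ⟨w, hw, rfl⟩ := (ht' _ _).1 hv
    have hno' : ∀ k' ∈ K, ∀ w' ∈ k'.src, w'.map σ id ≠ w.map σ id := fun k' hk' w' hw' heq =>
      hno _ (hmem' k' hk') ((hs' _ _).2 ⟨w', hw', heq⟩)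
    have hwt := htgt k hk w hw
    have hout0 : ∀ l' ∈ G.links, w ∉ l'.src := by
      intro l' hl' hv'
      by_cases hwx : w = .e x
      · subst hwx
        -- `u` has an outgoing link, since a `⊗`-link ends there
        obtain ⟨ku, hku, hkus⟩ : ∃ ku ∈ G.links, Node.e u ∈ ku.src := by
          by_contra! hc
          rcases hG.of_no_out (.e u) T hT ((hTt _).2 (.inr rfl)) hc with
            h1 | ⟨h1 | ⟨-, y, hy, -⟩, -⟩
          · exact hTd h1
          · exact hTw h1
          · exact hy.elim
        refine hno' ku ((hKm ku).2 ⟨hku, ?_, ?_⟩) _ hkus (by rw [hxu, hid] <;> simp [hur, hux])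
        · rintro rfl; simp [hTs, hsu.symm] at hkus
        · rintro rfl; simp [hPs, hux] at hkus
      by_cases hws : w = .e s
      · subst hws
        obtain ⟨kr, hkr, hkrs⟩ := hG.exists_src_root hP
        have hkrL := hG.box_subset _ hP hPp hkr
        refine hno' kr ((hKm kr).2 ⟨hkrL, ?_, ?_⟩) _ hkrs (by rw [hrs, hid] <;> simp [hsr, hsx])
        · rintro rfl; simp [hTs, hsr.symm] at hkrs
        · rintro rfl; simp [hPs, hxr.symm] at hkrs
      · refine hno' l' ((hKm l').2 ⟨hl', ?_, ?_⟩) _ hv' rfl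
        · rintro rfl
          exact hws ((hTs _).1 hv')
        · rintro rfl
          rcases (hPs _).1 hv' with h1 | h1
          · exact hwt.2.2 h1
          · exact hwx h1
    rw [Link.isDer_map, Link.isWeak_map]
    rcases hG.of_no_out w k (hKL k hk) hw hout0 with h1 | ⟨h1 | ⟨-, y, hy, -⟩, h2⟩
    · exact .inl h1
    · refine .inr ⟨.inl h1, fun p hp hpp hc => ?_⟩
      obtain ⟨q, hq, hqp, rfl⟩ := hpar p hp hpp
      exact h2 q (hKL q hq) hqp ((hbox q hq hqp k hk).1 hc)
    · exact hy.elim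
  case root_out =>
    obtain ⟨l, hl, hr⟩ := hG.root_out
    by_cases hlT : l = T
    · subst hlT
      have hrs' : G.root = s := by simpa [hTs] using hr
      obtain ⟨kr, hkr, hkrs⟩ := hG.exists_src_root hP
      have hkrL := hG.box_subset _ hP hPp hkr
      refine ⟨_, hmem' kr ((hKm kr).2 ⟨hkrL, ?_, ?_⟩), (hs' _ _).2 ⟨_, hkrs, ?_⟩⟩
      · rintro rfl; simp [hTs, hsr.symm] at hkrs
      · rintro rfl; simp [hPs, hxr.symm] at hkrs
      · rw [hrs, root, hrs']
    · have hrx : G.root ≠ x := by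
        rintro rfl
        obtain ⟨kx, hkx, hkxt⟩ := hG.exists_tgt_variable hP
        exact hG.root_in kx (hG.box_subset _ hP hPp hkx) hkxt
      have hrr : G.root ≠ r := by
        intro hc
        exact hG.root_in P hP ((hPt _).2 (by rw [hc]))
      refine ⟨_, hmem' l ((hKm l).2 ⟨hl, hlT, ?_⟩), (hs' _ _).2 ⟨_, hr, ?_⟩⟩
      · rintro rfl; simp [hPs, hrx] at hr
      · rw [root, hid] <;> simp [hrr, hrx]
  case root_in =>
    intro l hl hv
    obtain ⟨k, hk, rfl⟩ := hmem l hl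
    obtain ⟨w, hw, h1⟩ := (ht' _ _).1 hv
    rw [root] at h1
    rcases hmap w with ⟨rfl, h2⟩ | ⟨rfl, h2⟩ | ⟨-, -, h2⟩
    · exact (htgt k hk _ hw).1 rfl
    · exact hG.root_in T hT ((hTt _).2 (.inr (h1.symm.trans h2)))
    · exact hG.root_in k (hKL k hk) (by rwa [← h1, h2])
  case level_le =>
    intro v l hl l' hl' hv hv' p hp hpp ho
    obtain ⟨k, hk, rfl⟩ := hmem l hl
    obtain ⟨k', hk', rfl⟩ := hmem l' hl'
    obtain ⟨w, hw, rfl⟩ := (hs' _ _).1 hv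
    obtain ⟨w', hw', h1⟩ := (ht' _ _).1 hv'
    obtain ⟨q, hq, hqp, rfl⟩ := hpar p hp hpp
    rw [hout q hq hqp k hk] at ho
    rw [hin q hq hqp k' hk']
    have hqL := (hKm q).1 hq
    rcases hst k hk w hw k' hk' w' hw' h1.symm with rfl | ⟨rfl, rfl⟩ | ⟨rfl, rfl⟩
    · exact hG.level_le w k (hKL k hk) k' (hKL k' hk') hw hw' q (hKL q hq) hqp ho
    · have h3 := (hG.level_le _ k (hKL k hk) P hP hw ((hPt _).2 rfl) q hqL.1 hqp ho).resolve_right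
        hqL.2.2.symm
      exact hG.level_le _ T hT k' (hKL k' hk') ((hTs _).2 rfl) hw' q hqL.1 hqp
        (.inl ((hTP hqL.1 hqp).2 h3))
    · have h3 := (hG.level_le _ k (hKL k hk) T hT hw ((hTt _).2 (.inr rfl)) q hqL.1 hqp
        ho).resolve_right hqL.2.1.symm
      exact hG.level_le _ P hP k' (hKL k' hk') ((hPs _).2 (.inr rfl)) hw' q hqL.1 hqp
        (.inl ((hTP hqL.1 hqp).1 h3))
  case level_eq =>
    intro v l hl l' hl' hv hv' hd p hp hpp hi
    obtain ⟨k, hk, rfl⟩ := hmem l hl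
    obtain ⟨k', hk', rfl⟩ := hmem l' hl'
    obtain ⟨w, hw, rfl⟩ := (hs' _ _).1 hv
    obtain ⟨w', hw', h1⟩ := (ht' _ _).1 hv'
    obtain ⟨q, hq, hqp, rfl⟩ := hpar p hp hpp
    rw [Link.isDer_map] at hd
    rw [hout q hq hqp k hk]
    rw [hin q hq hqp k' hk'] at hi
    have hqL := (hKm q).1 hq
    rcases hst k hk w hw k' hk' w' hw' h1.symm with rfl | ⟨rfl, rfl⟩ | ⟨rfl, rfl⟩
    · exact hG.level_eq w k (hKL k hk) k' (hKL k' hk') hw hw' hd q (hKL q hq) hqp hi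
    · have h3 := (hG.level_eq _ T hT k' (hKL k' hk') ((hTs _).2 rfl) hw' hd q hqL.1 hqp
        hi).resolve_right fun h => hqL.2.1 h.1.symm
      exact hG.level_eq _ k (hKL k hk) P hP hw ((hPt _).2 rfl) hPd q hqL.1 hqp
        (.inl ((hTP hqL.1 hqp).1 h3))
    · have h3 := (hG.level_eq _ P hP k' (hKL k' hk') ((hPs _).2 (.inr rfl)) hw' hd q hqL.1 hqp
        hi).resolve_right fun h => hqL.2.2 h.1.symm
      exact hG.level_eq _ k (hKL k hk) T hT hw ((hTt _).2 (.inr rfl)) hTd q hqL.1 hqp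
        (.inl ((hTP hqL.1 hqp).2 h3))
  case variable_in =>
    intro y l hl l' hl' hlp hv hv'
    obtain ⟨k, hk, rfl⟩ := hmem l hl
    obtain ⟨k', hk', rfl⟩ := hmem l' hl'
    obtain ⟨w, hw, h0⟩ := (hs' _ _).1 hv
    obtain ⟨w', hw', h1⟩ := (ht' _ _).1 hv'
    rw [Link.isPar_map] at hlp
    rw [Link.isDer_map, Link.isWeak_map]
    have hwe : ∃ z, w = .e z := by
      cases w with
      | e z => exact ⟨z, rfl⟩
      | m b => simp [Node.map] at h0
    obtain ⟨z, rfl⟩ := hwe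
    rcases hst k hk _ hw k' hk' w' hw' (h0.trans h1.symm) with rfl | ⟨h3, rfl⟩ | ⟨h3, rfl⟩
    · exact hG.variable_in z k (hKL k hk) k' (hKL k' hk') hlp hw hw'
    · cases h3
      rcases hG.variable_in r k (hKL k hk) P hP hlp hw ((hPt _).2 rfl) with h4 | ⟨y, h4⟩
      · exact absurd h4 hPd
      · simp [hPdef] at h4
    · cases h3
      rcases hG.variable_in u k (hKL k hk) T hT hlp hw ((hTt _).2 (.inr rfl)) with h4 | h4
      · exact absurd h4 hTd
      · exact absurd h4 hTw
  case acyclic =>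
    -- The inner nodes of the box are ordered as in the box, and put in the place of `s` in the
    -- order of the other nodes.
    classical
    let N : Set Node := {v | ∃ k ∈ G.box P, v ∈ k.src}
    have hbs : G.box P ⊆ G.links := hG.box_subset _ hP hPp
    have hNout : ∀ k ∈ G.links, ∀ v ∈ k.src, v ∈ N → k ∈ G.box P := by
      rintro k hk v hv ⟨k', hk', hv'⟩
      rwa [hG.out_unique v k hk k' (hbs hk') hv hv']
    have hNin : ∀ k ∈ K, ∀ v ∈ k.tgt, v ∈ N → k ∈ G.box P := by
      rintro k hk v hv ⟨k', hk', hv'⟩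
      exact (hG.in_mem_box hP hPp hk' (hKL k hk) hv' hv).resolve_right ((hKm k).1 hk).2.2
    have hTN : T ∉ G.box P := h.tens_notMem_box
    have hPN : P ∉ G.box P := hG.box_irrefl _ hP hPp
    have hsN : Node.e s ∉ N := fun hc => hTN (hNout T hT _ ((hTs _).2 rfl) hc)
    have hxN : Node.e x ∉ N := fun hc => hPN (hNout P hP _ ((hPs _).2 (.inr rfl)) hc)
    have huN : Node.e u ∉ N := by
      rintro ⟨k, hk, hv⟩
      rcases hG.level_le _ k (hbs hk) T hT hv ((hTt _).2 (.inr rfl)) P hP hPp (.inl hk) with h1 | h1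
      · exact hTN h1
      · exact hTp (h1 ▸ hPp)
    have hrN : Node.e r ∈ N := hG.exists_src_root hP
    have fsa : G.Flow (.e s) (.m a) := .link T hT hTp ((hTs _).2 rfl) ((hTt _).2 (.inl rfl))
    have fsu : G.Flow (.e s) (.e u) := .link T hT hTp ((hTs _).2 rfl) ((hTt _).2 (.inr rfl))
    have fab : ∀ v ∈ nodes (G.box P), G.Flow (.m a) v := fun v hv => .box a x r hP hv
    let φ : Node → Node := fun v => if v ∈ N then .e s else v
    let ψ : Node → Node := fun v => if v = .e s then .e r else v
    have φin : ∀ v ∈ N, φ v = .e s := fun v hv => if_pos hv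
    have φout : ∀ v, v ∉ N → φ v = v := fun v hv => if_neg hv
    have ψs : ψ (.e s) = .e r := if_pos rfl
    have ψid : ∀ v, v ≠ .e s → ψ v = v := fun v hv => if_neg hv
    have ψN : ∀ v ∈ N, ψ v = v := fun v hv => ψid v fun hc => hsN (hc ▸ hv)
    have φs : φ (.e s) = .e s := φout _ hsN
    -- the image in the net of a node of the box
    have inner : ∀ w ∈ nodes (G.box P),
        (φ (w.map σ id) = .e s ∧ ψ (w.map σ id) = w) ∨
          Relation.TransGen G.Flow (.e s) (φ (w.map σ id)) := by
      intro w hw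
      rcases hmap w with ⟨rfl, h2⟩ | ⟨rfl, h2⟩ | ⟨-, -, h2⟩ <;> rw [h2]
      · exact .inl ⟨φs, ψs⟩
      · rw [φout _ huN]; exact .inr (.single fsu)
      · by_cases hwN : w ∈ N
        · exact .inl ⟨φin w hwN, ψN w hwN⟩
        · rw [φout w hwN]; exact .inr (.tail (.single fsa) (fab w hw))
    refine acyclic_of_lex hG.acyclic φ ψ ?_
    rintro v' w' (⟨l, hl, hlp, hv', hw'⟩ | ⟨b, y, q, hq, hw⟩)
    · obtain ⟨k, hk, rfl⟩ := hmem l hl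
      obtain ⟨v, hv, rfl⟩ := (hs' _ _).1 hv'
      obtain ⟨w, hw, rfl⟩ := (ht' _ _).1 hw'
      rw [Link.isPar_map] at hlp
      have fvw : G.Flow v w := .link k (hKL k hk) hlp hv hw
      by_cases hkP : k ∈ G.box P
      · have h1 : φ (v.map σ id) = .e s ∧ ψ (v.map σ id) = v := by
          have hvN : v ∈ N := ⟨k, hkP, hv⟩
          rcases hmap v with ⟨rfl, h2⟩ | ⟨rfl, h2⟩ | ⟨-, -, h2⟩ <;> rw [h2]
          · exact ⟨φs, ψs⟩
          · exact absurd hvN hxN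
          · exact ⟨φin v hvN, ψN v hvN⟩
        rw [h1.1, h1.2]
        rcases inner w (mem_nodes_tgt hkP hw) with ⟨h2, h3⟩ | h2
        · rw [h2, h3]; exact .inr ⟨rfl, .single fvw⟩
        · exact .inl h2
      · have hvN : v ∉ N := fun hc => hkP (hNout k (hKL k hk) v hv hc)
        have hwN : w ∉ N := fun hc => hkP (hNin k hk w hw hc)
        have hwx : w ≠ .e x := by
          rintro rfl
          exact hkP (hG.mem_box_of_tgt_variable hP (hKL k hk) hw)
        rw [hid v (fun hc => hvN (hc ▸ hrN)) (hsrc k hk v hv).2.1,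
          hid w (htgt k hk w hw).1 hwx, φout v hvN, φout w hwN]
        exact .inl (.single fvw)
    · obtain ⟨p, hp, hpp, hpq⟩ := hpar _ hq (Link.isPar_par ..)
      obtain ⟨y', q', rfl⟩ : ∃ y' q', p = .par b y' q' := by
        obtain ⟨b', y', q', rfl⟩ := hpp
        simp only [Link.map, Link.par.injEq, id] at hpq
        exact ⟨y', q', by rw [hpq.1]⟩
      obtain ⟨l, hl, hwl⟩ := hw
      rw [← hpq] at hl
      obtain ⟨k, hk, hkp, rfl⟩ := hboxK _ hp hpp l hl
      obtain ⟨w, hw, rfl⟩ : ∃ w, (w ∈ k.src ∨ w ∈ k.tgt) ∧ w.map σ id = w' := by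
        rcases hwl with h1 | h1
        · obtain ⟨w, h2, h3⟩ := (hs' _ _).1 h1; exact ⟨w, .inl h2, h3⟩
        · obtain ⟨w, h2, h3⟩ := (ht' _ _).1 h1; exact ⟨w, .inr h2, h3⟩
      have hpL := hKL _ hp
      have hwn : w ∈ nodes (G.box (.par b y' q')) := ⟨k, hkp, hw⟩
      have fbw : G.Flow (.m b) w := .box b y' q' hpL hwn
      by_cases hpP : Link.par b y' q' ∈ G.box P
      · have hbN : Node.m b ∈ N := ⟨_, hpP, by simp [Link.src]⟩
        rw [φin _ hbN, ψN _ hbN]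
        rcases inner w (nodes_mono (hG.box_trans _ hP hPp _ hpP hpp) hwn) with ⟨h2, h3⟩ | h2
        · rw [h2, h3]; exact .inr ⟨rfl, .single fbw⟩
        · exact .inl h2
      · have hbN : Node.m b ∉ N := fun hc => hpP (hNout _ hpL _ (by simp [Link.src]) hc)
        rw [φout _ hbN]
        left
        -- a link of `P`'s box in the box of `p` puts the whole cut into the box of `p`
        have hcut : k ∈ G.box P → Link.tens s a u ∈ G.box (.par b y' q') := by
          intro hkP
          refine (hTP hpL hpp).2 ?_
          rcases hG.box_laminar _ hP hPp _ hpL hpp k hkP hkp with h1 | h1 | h1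
          · exact absurd h1.symm ((hKm _).1 hp).2.2
          · exact h1
          · exact absurd h1 hpP
        have fs : k ∈ G.box P → G.Flow (.m b) (.e s) := fun hkP =>
          .box b y' q' hpL (mem_nodes_src (hcut hkP) ((hTs _).2 rfl))
        have fu : k ∈ G.box P → G.Flow (.m b) (.e u) := fun hkP =>
          .box b y' q' hpL (mem_nodes_tgt (hcut hkP) ((hTt _).2 (.inr rfl)))
        have hNk : w ∈ N → k ∈ G.box P := fun hwN => hw.elim
          (fun h => hNout k (hKL k hk) w h hwN) (fun h => hNin k hk w h hwN)
        rcases hmap w with ⟨rfl, h2⟩ | ⟨rfl, h2⟩ | ⟨-, -, h2⟩ <;> rw [h2]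
        · rw [φs]; exact .single (fs (hNk hrN))
        · rw [φout _ huN]
          refine .single (fu ?_)
          rcases hw with h3 | h3
          · exact absurd rfl (hsrc k hk _ h3).2.1
          · exact hG.mem_box_of_tgt_variable hP (hKL k hk) h3
        · by_cases hwN : w ∈ N
          · rw [φin w hwN]; exact .single (fs (hNk hwN))
          · rw [φout w hwN]; exact .single fbw

end MultCut

/-! ### The content of an exponential cut -/

/-- The two links adjacent to an `m`-node are in the same boxes. -/
theorem Leveled.mem_box_iff_of_m {G : PreNet} (h : Leveled ∅ G) {p l l' : Link} {b : ℕ}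
    (hp : p ∈ G.links) (hpp : p.IsPar) (hl : l ∈ G.links) (hl' : l' ∈ G.links)
    (hb : Node.m b ∈ l.src) (hb' : Node.m b ∈ l'.tgt) : l ∈ G.box p ↔ l' ∈ G.box p := by
  constructor
  · intro h1
    rcases h.level_le _ l hl l' hl' hb hb' p hp hpp (.inl h1) with h2 | rfl
    · exact h2
    · exact absurd hpp (Link.not_isPar_of_m_tgt hb')
  · intro h1
    rcases h.level_eq _ l hl l' hl' hb hb' (Link.not_isDer_of_m_tgt hb') p hp hpp (.inl h1) with
      h2 | ⟨-, y, hy⟩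
    · exact h2
    · cases hy

/-- The `!`-link of an exponential cut in a levelled net, and the part of the net below it. -/
structure ExpCut (G : PreNet) (x a : ℕ) (H : Set Link) (ys : Set ℕ) : Prop where
  leveled : Leveled ∅ G
  bang_mem : Link.bang x a ∈ G.links
  content : Content G a H ys

/-- The nodes of `H` other than its top node `a` and its targets `ys`. -/
def Inner (H : Set Link) (a : ℕ) (ys : Set ℕ) : Set Node :=
  {v | v ∈ nodes H ∧ v ≠ .m a ∧ ∀ y ∈ ys, v ≠ .e y}

namespace ExpCut

variable {G : PreNet} {x a : ℕ} {H : Set Link} {ys : Set ℕ}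

theorem subset (c : ExpCut G x a H ys) : H ⊆ G.links := by
  rcases c.content with ⟨y, hy⟩ | ⟨z, r, hp⟩
  · simpa using hy
  · exact Set.union_subset (by simpa using hp) (c.leveled.box_subset _ hp (Link.isPar_par ..))

theorem exists_top (c : ExpCut G x a H ys) : ∃ h ∈ H, Node.m a ∈ h.src := by
  rcases c.content with ⟨y, hy⟩ | ⟨z, r, hp⟩
  · exact ⟨_, rfl, by simp [Link.src]⟩
  · exact ⟨_, .inl rfl, by simp [Link.src]⟩

theorem top_notMem_box (c : ExpCut G x a H ys) {p h : Link} (hp : p ∈ H) (hpp : p.IsPar)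
    (hh : h ∈ G.links) (ha : Node.m a ∈ h.src) : h ∉ G.box p := by
  rcases c.content with ⟨y, hy⟩ | ⟨z, r, hP⟩
  · obtain rfl : p = _ := hp
    obtain ⟨_, _, _, h⟩ := hpp; cases h
  · have hPp := Link.isPar_par a z r
    obtain rfl := c.leveled.out_unique _ h hh _ hP ha (by simp [Link.src])
    intro h1
    rcases hp with rfl | hp
    · exact c.leveled.box_irrefl _ hP hPp h1
    · exact c.leveled.box_irrefl _ hP hPp (c.leveled.box_trans _ hP hPp p hp hpp h1)

theorem box_subset (c : ExpCut G x a H ys) {p : Link} (hp : p ∈ H) (hpp : p.IsPar) :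
    G.box p ⊆ H := by
  rcases c.content with ⟨y, hy⟩ | ⟨z, r, hP⟩
  · obtain rfl : p = _ := hp
    obtain ⟨_, _, _, h⟩ := hpp; cases h
  · rcases hp with rfl | hp
    · exact Set.subset_union_right
    · exact (c.leveled.box_trans _ hP (Link.isPar_par ..) p hp hpp).trans Set.subset_union_right

theorem bang_notMem (c : ExpCut G x a H ys) : Link.bang x a ∉ H := by
  have hb := c.bang_mem
  rcases c.content with ⟨y, hy⟩ | ⟨z, r, hP⟩
  · simp
  · rintro (h1 | h1)
    · cases h1
    · exact c.leveled.box_irrefl _ hP (Link.isPar_par ..)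
        ((c.leveled.mem_box_iff_of_m hP (Link.isPar_par ..) hP hb (b := a) (by simp [Link.src])
          (by simp [Link.tgt])).2 h1)

theorem eq_bang (c : ExpCut G x a H ys) {l : Link} (hl : l ∈ G.links) (ha : Node.m a ∈ l.tgt) :
    l = .bang x a := by
  by_contra hne
  exact Link.not_isDer_of_m_tgt ha
    (c.leveled.in_unique _ l hl _ c.bang_mem ha (by simp [Link.tgt]) hne).1

theorem mem_of_src_m (c : ExpCut G x a H ys) {l : Link} (hl : l ∈ G.links)
    (ha : Node.m a ∈ l.src) : l ∈ H := by
  obtain ⟨h, hh, hv⟩ := c.exists_top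
  rwa [c.leveled.out_unique _ l hl h (c.subset hh) ha hv]

/-- All of `H` is at the level of the `!`-link. -/
theorem mem_box_iff (c : ExpCut G x a H ys) {p h : Link} (hp : p ∈ G.links) (hpp : p.IsPar)
    (hpH : p ∉ H) (hh : h ∈ H) : h ∈ G.box p ↔ Link.bang x a ∈ G.box p := by
  have hb := c.bang_mem
  rcases c.content with ⟨y, hy⟩ | ⟨z, r, hP⟩
  · obtain rfl : h = _ := hh
    exact c.leveled.mem_box_iff_of_m hp hpp hy hb (b := a) (by simp [Link.src]) (by simp [Link.tgt])
  · have hPp := Link.isPar_par a z r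
    rw [← c.leveled.mem_box_iff_of_m hp hpp hP hb (b := a) (by simp [Link.src])
      (by simp [Link.tgt])]
    rcases hh with rfl | hh
    · rfl
    · constructor
      · intro h1
        rcases c.leveled.box_laminar _ hP hPp p hp hpp h hh h1 with h2 | h2 | h2
        · exact absurd (.inl h2.symm) hpH
        · exact h2
        · exact absurd (.inr h2) hpH
      · exact fun h1 => c.leveled.box_trans p hp hpp _ h1 hPp hh

theorem mem_nodes_box {G : PreNet} (hG : Leveled ∅ G) {z r : ℕ} {v : Node}
    (hP : Link.par a z r ∈ G.links) (hv : v ∈ nodes ({.par a z r} ∪ G.box (.par a z r)))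
    (ha : v ≠ .m a) : v ∈ nodes (G.box (.par a z r)) := by
  obtain ⟨l, rfl | hl, hv⟩ := hv
  · have : (v = .m a ∨ v = .e z) ∨ v = .e r := by simpa [Link.src, Link.tgt] using hv
    rcases this with (h1 | rfl) | rfl
    · exact absurd h1 ha
    · exact (hG.mem_freeVars_variable hP).1
    · obtain ⟨k, hk, hr⟩ := hG.exists_src_root hP
      exact mem_nodes_src hk hr
  · exact ⟨l, hl, hv⟩

theorem flow_m (c : ExpCut G x a H ys) {v : Node} (hv : v ∈ nodes H) (ha : v ≠ .m a) :
    G.Flow (.m a) v := by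
  rcases c.content with ⟨y, hy⟩ | ⟨z, r, hP⟩
  · obtain ⟨l, rfl, hv⟩ := hv
    have : v = .m a ∨ v = .e y := by simpa [Link.src, Link.tgt] using hv
    rcases this with rfl | rfl
    · exact absurd rfl ha
    · exact .link _ hy (by rintro ⟨_, _, _, h⟩; cases h) (by simp [Link.src]) (by simp [Link.tgt])
  · exact .box a z r hP (mem_nodes_box c.leveled hP hv ha)

theorem flow_bang (c : ExpCut G x a H ys) : G.Flow (.e x) (.m a) :=
  .link _ c.bang_mem (by rintro ⟨_, _, _, h⟩; cases h) (by simp [Link.src]) (by simp [Link.tgt])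

theorem x_notMem_nodes (c : ExpCut G x a H ys) : Node.e x ∉ nodes H := fun hx =>
  c.leveled.acyclic _ (.tail (.single c.flow_bang) (c.flow_m hx (by simp)))

theorem inner_adjacent (c : ExpCut G x a H ys) {v : Node} (hv : v ∈ Inner H a ys) :
    (∀ l ∈ G.links, v ∈ l.src → l ∈ H) ∧ (∀ l ∈ G.links, v ∈ l.tgt → l ∈ H) ∧
      (∃ l ∈ H, v ∈ l.src) ∧ ∃ l ∈ H, v ∈ l.tgt := by
  obtain ⟨hn, ha, hy⟩ := hv
  have hG := c.leveled
  rcases c.content with ⟨y, hy'⟩ | ⟨z, r, hP⟩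
  · obtain ⟨l, rfl, hv⟩ := hn
    have : v = .m a ∨ v = .e y := by simpa [Link.src, Link.tgt] using hv
    rcases this with rfl | rfl
    · exact absurd rfl ha
    · exact absurd rfl (hy y rfl)
  · have hPp := Link.isPar_par a z r
    have hs := hG.box_subset _ hP hPp
    have hvb := mem_nodes_box hG hP hn ha
    have hin : ∃ l ∈ ({.par a z r} ∪ G.box (.par a z r) : Set Link), v ∈ l.tgt := by
      by_cases hvr : v = .e r
      · exact ⟨_, .inl rfl, by simp [Link.tgt, hvr]⟩
      · obtain ⟨l, hl, hv⟩ := hG.exists_in_of_mem_nodes hP hvb hvr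
        exact ⟨l, .inr hl, hv⟩
    by_cases hout : ∃ k ∈ G.box (.par a z r), v ∈ k.src
    · obtain ⟨k, hk, hv⟩ := hout
      refine ⟨fun l hl hvl => .inr ?_, fun l hl hvl => ?_, ⟨k, .inr hk, hv⟩, hin⟩
      · rwa [hG.out_unique v l hl k (hs hk) hvl hv]
      · exact (hG.in_mem_box hP hPp hk hl hv hvl).symm
    · push Not at hout
      obtain ⟨y, rfl⟩ : ∃ y, v = .e y := by
        rcases v with y | b
        · exact ⟨y, rfl⟩
        · obtain ⟨k, ⟨hk, hv⟩, -⟩ := ((hG.boxNet hP).graphConditions.multiplicative b hvb).2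
          exact absurd hv (hout k hk)
      obtain rfl : y = z := by
        by_contra hne
        exact hy y ⟨⟨hvb, hout⟩, hne⟩ rfl
      refine ⟨fun l hl hvl => .inl (hG.src_eq_par hP hl hvl),
        fun l hl hvl => .inr (hG.mem_box_of_tgt_variable hP hl hvl),
        ⟨_, .inl rfl, by simp [Link.src]⟩, hin⟩

theorem target_adjacent (c : ExpCut G x a H ys) {y : ℕ} (hy : y ∈ ys) :
    (∀ h ∈ H, Node.e y ∉ h.src) ∧ (∃ h ∈ H, Node.e y ∈ h.tgt) ∧
      ∀ h ∈ H, Node.e y ∈ h.tgt → h.IsDer := by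
  have hG := c.leveled
  rcases c.content with ⟨y', hy'⟩ | ⟨z, r, hP⟩
  · obtain rfl : y = y' := hy
    simp [Link.src, Link.tgt, Link.IsDer]
  · obtain ⟨hy, hyz⟩ := hy
    have hyr : y ≠ r := fun h => hG.not_mem_freeVars_root hP (h ▸ hy)
    refine ⟨?_, ?_, ?_⟩
    · rintro h (rfl | hh) hv
      · exact hyz (by simpa [Link.src] using hv)
      · exact hy.2 h hh hv
    · obtain ⟨l, hl, hv⟩ := hG.exists_in_of_mem_nodes hP hy.1 (by simpa using hyr)
      exact ⟨l, .inr hl, hv⟩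
    · rintro h (rfl | hh) hv
      · exact absurd (by simpa [Link.tgt] using hv) hyr
      · exact hG.isDer_of_tgt_freeVars hP hy hyz hh hv

theorem target_ne (c : ExpCut G x a H ys) {y : ℕ} (hy : y ∈ ys) : y ≠ x := by
  rintro rfl
  obtain ⟨h, hh, hv⟩ := (c.target_adjacent hy).2.1
  exact c.x_notMem_nodes (mem_nodes_tgt hh hv)

/-- The nodes of `H`: the top node, the targets, and the inner nodes. -/
theorem node_cases {v : Node} (hv : v ∈ nodes H) :
    v = .m a ∨ (∃ y ∈ ys, v = .e y) ∨ v ∈ Inner H a ys := by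
  by_cases h1 : v = .m a
  · exact .inl h1
  by_cases h2 : ∃ y ∈ ys, v = .e y
  · exact .inr (.inl h2)
  · push Not at h2
    exact .inr (.inr ⟨hv, h1, h2⟩)

/-! ### The exponential step on a weakening -/

/-- An exponential step on a weakening preserves levelled nets. -/
theorem leveled_weak (c : ExpCut G x a H ys) {G' : PreNet} {Y : Set ℕ} {K : Set Link}
    (weak_mem : Link.weak x ∈ G.links)
    (hK : K = G.links \ ({.bang x a, .weak x} ∪ H))
    (hY : Y = {y | y ∈ ys ∧ ∀ l ∈ K, Node.e y ∉ l.tgt})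
    (links : G'.links = K ∪ Link.weak '' Y)
    (root : G'.root = G.root)
    (box : ∀ b z q, .par b z q ∈ K → G'.box (.par b z q) =
      (G.box (.par b z q) ∩ K) ∪ {l | ∃ y ∈ Y, l = .weak y ∧ .bang x a ∈ G.box (.par b z q) ∧
        (y ∉ freeVars (G.box (.par b z q)) ∨ y = z)}) :
    Leveled ∅ G' := by
  have hG := c.leveled
  have hB := c.bang_mem
  have hKm : ∀ k, k ∈ K ↔ k ∈ G.links ∧ k ≠ .bang x a ∧ k ≠ .weak x ∧ k ∉ H := by
    intro k; rw [hK]; simp [and_assoc]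
  have hKL : ∀ k ∈ K, k ∈ G.links := fun k hk => ((hKm k).1 hk).1
  have hKH : ∀ k ∈ K, k ∉ H := fun k hk => ((hKm k).1 hk).2.2.2
  have hwd : ∀ y, ¬ (Link.weak y).IsDer := by rintro y ⟨_, _, h⟩; cases h
  have hwp : ∀ y, ¬ (Link.weak y).IsPar := by rintro y ⟨_, _, _, h⟩; cases h
  have hws : ∀ y v, v ∉ (Link.weak y).src := by simp [Link.src]
  have hwt : ∀ y v, v ∈ (Link.weak y).tgt ↔ v = .e y := by simp [Link.tgt]
  have hxin : ∀ l ∈ G.links, Node.e x ∈ l.tgt → l = .weak x := fun l hl hv => by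
    by_contra hne
    exact hwd _ (hG.in_unique _ l hl _ weak_mem hv ((hwt _ _).2 rfl) hne).2
  have hxout : ∀ l ∈ G.links, Node.e x ∈ l.src → l = .bang x a := fun l hl hv =>
    hG.out_unique _ l hl _ hB hv (by simp [Link.src])
  -- the nodes of `K` are not inner nodes of the erased part
  have hKs : ∀ k ∈ K, ∀ v ∈ k.src, v ≠ .e x ∧ v ≠ .m a ∧ v ∉ Inner H a ys := by
    refine fun k hk v hv => ⟨?_, ?_, fun hc => hKH k hk ((c.inner_adjacent hc).1 k (hKL k hk) hv)⟩
    · rintro rfl; exact ((hKm k).1 hk).2.1 (hxout k (hKL k hk) hv)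
    · rintro rfl; exact hKH k hk (c.mem_of_src_m (hKL k hk) hv)
  have hKt : ∀ k ∈ K, ∀ v ∈ k.tgt, v ≠ .e x ∧ v ≠ .m a ∧ v ∉ Inner H a ys := by
    refine fun k hk v hv => ⟨?_, ?_, fun hc => hKH k hk ((c.inner_adjacent hc).2.1 k (hKL k hk) hv)⟩
    · rintro rfl; exact ((hKm k).1 hk).2.2.1 (hxin k (hKL k hk) hv)
    · rintro rfl; exact ((hKm k).1 hk).2.1 (c.eq_bang (hKL k hk) hv)
  have hYy : ∀ y ∈ Y, y ∈ ys := fun y hy => by rw [hY] at hy; exact hy.1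
  have hYK : ∀ y ∈ Y, ∀ l ∈ K, Node.e y ∉ l.tgt := fun y hy => by rw [hY] at hy; exact hy.2
  have hYL : ∀ y ∈ Y, Link.weak y ∉ G.links := by
    intro y hy hw
    obtain ⟨h, hh, hv⟩ := (c.target_adjacent (hYy y hy)).2.1
    refine hwd y (hG.in_unique _ _ hw h (c.subset hh) ((hwt _ _).2 rfl) hv ?_).1
    rintro rfl
    exact hwd y ((c.target_adjacent (hYy y hy)).2.2 _ hh hv)
  have hYout : ∀ y ∈ Y, ∀ l ∈ G.links, Node.e y ∈ l.src → l ∈ K := by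
    refine fun y hy l hl hv => (hKm l).2 ⟨hl, ?_, ?_, fun hc =>
      (c.target_adjacent (hYy y hy)).1 l hc hv⟩
    · rintro rfl; exact c.target_ne (hYy y hy) (by simpa [Link.src] using hv)
    · rintro rfl; exact hws _ _ hv
  have hbK : ∀ p ∈ K, p.IsPar → ∀ k ∈ K, k ∈ G'.box p ↔ k ∈ G.box p := by
    rintro _ hp ⟨b, z, q, rfl⟩ k hk
    rw [box b z q hp]
    constructor
    · rintro (h1 | ⟨y, hy, rfl, -⟩)
      · exact h1.1
      · exact absurd (hKL _ hk) (hYL y hy)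
    · exact fun h1 => .inl ⟨h1, hk⟩
  -- a new weakening is at the level of the outgoing link of its node
  have hbW : ∀ p ∈ K, p.IsPar → ∀ y ∈ Y, Link.weak y ∈ G'.box p ↔
      ∃ l ∈ K, Node.e y ∈ l.src ∧ G.OutLevel p (.e y) l := by
    rintro _ hp ⟨b, z, q, rfl⟩ y hy
    obtain ⟨-, ⟨h, hh, hhy⟩, hder⟩ := c.target_adjacent (hYy y hy)
    have hpp := Link.isPar_par b z q
    have hiff := c.mem_box_iff (hKL _ hp) hpp (hKH _ hp) hh
    rw [box b z q hp]
    constructor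
    · rintro (h1 | ⟨y', hy', he, h1, h2⟩)
      · exact absurd (hKL _ h1.2) (hYL y hy)
      · cases he
        rcases h2 with h2 | rfl
        · obtain ⟨l, hl, hv⟩ : ∃ l ∈ G.box (.par b z q), Node.e y ∈ l.src := by
            by_contra! hc
            exact h2 ⟨mem_nodes_tgt (hiff.2 h1) hhy, hc⟩
          exact ⟨l, hYout y hy l (hG.box_subset _ (hKL _ hp) hpp hl) hv, hv, .inl hl⟩
        · exact ⟨_, hp, by simp [Link.src], .inr ⟨rfl, y, rfl⟩⟩
    · rintro ⟨l, hl, hv, ho⟩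
      refine .inr ⟨y, hy, rfl, hiff.1 ?_, ?_⟩
      · rcases hG.level_le _ l (hKL l hl) h (c.subset hh) hv hhy _ (hKL _ hp) hpp ho with h1 | h1
        · exact h1
        · exact absurd (h1 ▸ hh) (hKH _ hp)
      · rcases ho with h1 | ⟨rfl, -⟩
        · exact .inl fun hf => hf.2 l h1 hv
        · right; simpa [Link.src] using hv
  have hmem : ∀ l ∈ G'.links, l ∈ K ∨ ∃ y ∈ Y, l = .weak y := by
    intro l hl
    rw [links] at hl
    exact hl.imp_right fun ⟨y, hy, h⟩ => ⟨y, hy, h.symm⟩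
  have hmemK : ∀ k ∈ K, k ∈ G'.links := fun k hk => links ▸ .inl hk
  have hmemY : ∀ y ∈ Y, Link.weak y ∈ G'.links := fun y hy => links ▸ .inr ⟨y, hy, rfl⟩
  have hpar : ∀ p ∈ G'.links, p.IsPar → p ∈ K := by
    intro p hp hpp
    rcases hmem p hp with h1 | ⟨y, hy, rfl⟩
    · exact h1
    · exact absurd hpp (hwp y)
  have hsrc : ∀ l ∈ G'.links, ∀ v ∈ l.src, l ∈ K := by
    intro l hl v hv
    rcases hmem l hl with h1 | ⟨y, hy, rfl⟩
    · exact h1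
    · exact absurd hv (hws _ _)
  have hbm : ∀ p ∈ K, p.IsPar → ∀ l ∈ G'.box p, l ∈ K ∨ ∃ y ∈ Y, l = .weak y := by
    rintro _ hp ⟨b, z, q, rfl⟩ l hl
    rw [box b z q hp] at hl
    rcases hl with h1 | ⟨y, hy, h1, -⟩
    · exact .inl h1.2
    · exact .inr ⟨y, hy, h1⟩
  have hout : ∀ p ∈ K, p.IsPar → ∀ k ∈ K, ∀ v, G'.OutLevel p v k ↔ G.OutLevel p v k :=
    fun p hp hpp k hk v => or_congr_left (hbK p hp hpp k hk)
  have hin : ∀ p ∈ K, p.IsPar → ∀ k ∈ K, G'.InLevel p k ↔ G.InLevel p k :=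
    fun p hp hpp k hk => or_congr_left (hbK p hp hpp k hk)
  constructor
  case finite =>
    rw [links]
    refine (hG.finite.subset hKL).union (Set.Finite.image _ ?_)
    have : (Node.e '' Y).Finite := by
      refine Set.Finite.subset (s := ⋃ l ∈ G.links, l.tgt) (hG.finite.biUnion fun l _ => ?_) ?_
      · cases l <;> simp [Link.tgt]
      · rintro _ ⟨y, hy, rfl⟩
        obtain ⟨h, hh, hv⟩ := (c.target_adjacent (hYy y hy)).2.1
        exact Set.mem_biUnion (c.subset hh) hv
    exact this.of_finite_image fun _ _ _ _ h => by simpa using h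
  case box_subset =>
    intro p hp hpp l hl
    rcases hbm p (hpar p hp hpp) hpp l hl with h1 | ⟨y, hy, rfl⟩
    · exact hmemK l h1
    · exact hmemY y hy
  case box_irrefl =>
    intro p hp hpp hc
    have hpK := hpar p hp hpp
    exact hG.box_irrefl p (hKL p hpK) hpp ((hbK p hpK hpp p hpK).1 hc)
  case box_trans =>
    intro p hp hpp p' hp' hpp' l hl
    have hpK := hpar p hp hpp
    have hpK' : p' ∈ K := by
      rcases hbm p hpK hpp p' hp' with h1 | ⟨y, hy, rfl⟩
      · exact h1
      · exact absurd hpp' (hwp y)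
    have hp2 := (hbK p hpK hpp p' hpK').1 hp'
    have hsub := hG.box_trans p (hKL p hpK) hpp p' hp2 hpp'
    rcases hbm p' hpK' hpp' l hl with h1 | ⟨y, hy, rfl⟩
    · exact (hbK p hpK hpp l h1).2 (hsub ((hbK p' hpK' hpp' l h1).1 hl))
    · obtain ⟨k, hk, hv, h1⟩ := (hbW p' hpK' hpp' y hy).1 hl
      refine (hbW p hpK hpp y hy).2 ⟨k, hk, hv, .inl ?_⟩
      rcases h1 with h1 | ⟨rfl, -⟩
      · exact hsub h1
      · exact hp2
  case box_laminar =>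
    intro p hp hpp p' hp' hpp' l hl hl'
    have hpK := hpar p hp hpp
    have hpK' := hpar p' hp' hpp'
    rw [hbK p' hpK' hpp' p hpK, hbK p hpK hpp p' hpK']
    have hlam := hG.box_laminar p (hKL p hpK) hpp p' (hKL p' hpK') hpp'
    rcases hbm p hpK hpp l hl with h1 | ⟨y, hy, rfl⟩
    · exact hlam l ((hbK p hpK hpp l h1).1 hl) ((hbK p' hpK' hpp' l h1).1 hl')
    · obtain ⟨k, hk, hv, h1⟩ := (hbW p hpK hpp y hy).1 hl
      obtain ⟨k', hk', hv', h2⟩ := (hbW p' hpK' hpp' y hy).1 hl'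
      obtain rfl := hG.out_unique _ k (hKL k hk) k' (hKL k' hk') hv hv'
      rcases h1 with h1 | ⟨rfl, -⟩ <;> rcases h2 with h2 | ⟨rfl, -⟩
      · exact hlam k h1 h2
      · exact .inr (.inr h1)
      · exact .inr (.inl h2)
      · exact .inl rfl
  case in_unique =>
    intro v l hl l' hl' hv hv' hne
    rcases hmem l hl with h1 | ⟨y, hy, rfl⟩ <;> rcases hmem l' hl' with h2 | ⟨y', hy', rfl⟩
    · exact hG.in_unique v l (hKL l h1) l' (hKL l' h2) hv hv' hne
    · obtain rfl := (hwt _ _).1 hv'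
      exact absurd hv (hYK y' hy' l h1)
    · obtain rfl := (hwt _ _).1 hv
      exact absurd hv' (hYK y hy l' h2)
    · obtain rfl := (hwt _ _).1 hv
      have := (hwt _ _).1 hv'
      cases this
      exact absurd rfl hne
  case out_unique =>
    intro v l hl l' hl' hv hv'
    exact hG.out_unique v l (hKL l (hsrc l hl v hv)) l' (hKL l' (hsrc l' hl' v hv')) hv hv'
  case of_no_in =>
    intro v k hk hv hno
    replace hk := hsrc k hk v hv
    have hvs := hKs k hk v hv
    obtain ⟨h1, h2⟩ := hG.of_no_in v k (hKL k hk) hv fun l hl hvl => by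
      by_cases hlK : l ∈ K
      · exact hno l (hmemK l hlK) hvl
      by_cases hlB : l = .bang x a
      · subst hlB; exact hvs.2.1 (by simpa [Link.tgt] using hvl)
      by_cases hlw : l = .weak x
      · subst hlw; exact hvs.1 ((hwt _ _).1 hvl)
      have hlH : l ∈ H := by
        by_contra hc; exact hlK ((hKm l).2 ⟨hl, hlB, hlw, hc⟩)
      rcases node_cases (a := a) (ys := ys) (mem_nodes_tgt hlH hvl) with h1 | ⟨y, hy, rfl⟩ | h1
      · exact hvs.2.1 h1
      · have hyY : y ∈ Y := by
          rw [hY]; exact ⟨hy, fun l' hl' => hno l' (hmemK l' hl')⟩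
        exact hno _ (hmemY y hyY) ((hwt _ _).2 rfl)
      · exact hvs.2.2 h1
    refine ⟨by rw [root, h1], fun p hp hpp ho => ?_⟩
    have hpK := hpar p hp hpp
    exact h2 p (hKL p hpK) hpp ((hout p hpK hpp k hk v).1 ho)
  case of_no_out =>
    intro v l hl hv hno
    rcases hmem l hl with hk | ⟨y, hy, rfl⟩
    · have hvt := hKt l hk v hv
      rcases hG.of_no_out v l (hKL l hk) hv fun l' hl' hvl => by
          by_cases hlK : l' ∈ K
          · exact hno l' (hmemK l' hlK) hvl
          by_cases hlB : l' = .bang x a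
          · subst hlB; exact hvt.1 (by simpa [Link.src] using hvl)
          by_cases hlw : l' = .weak x
          · subst hlw; exact hws _ _ hvl
          have hlH : l' ∈ H := by
            by_contra hc; exact hlK ((hKm l').2 ⟨hl', hlB, hlw, hc⟩)
          rcases node_cases (a := a) (ys := ys) (mem_nodes_src hlH hvl) with h1 | ⟨y, hy, rfl⟩ | h1
          · exact hvt.2.1 h1
          · exact (c.target_adjacent hy).1 l' hlH hvl
          · exact hvt.2.2 h1
        with h1 | ⟨h1, h2⟩
      · exact .inl h1
      · refine .inr ⟨h1, fun p hp hpp hc => ?_⟩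
        have hpK := hpar p hp hpp
        exact h2 p (hKL p hpK) hpp ((hbK p hpK hpp l hk).1 hc)
    · refine .inr ⟨.inl ⟨y, rfl⟩, fun p hp hpp hc => ?_⟩
      obtain ⟨k, hk, hvk, -⟩ := (hbW p (hpar p hp hpp) hpp y hy).1 hc
      obtain rfl := (hwt _ _).1 hv
      exact hno k (hmemK k hk) hvk
  case root_out =>
    obtain ⟨k, hk, hr⟩ := hG.root_out
    refine ⟨k, hmemK k ((hKm k).2 ⟨hk, ?_, ?_, fun hc => ?_⟩), root ▸ hr⟩
    · rintro rfl
      have hrx : G.root = x := by simpa [Link.src] using hr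
      exact hG.root_in _ weak_mem ((hwt _ _).2 (by rw [hrx]))
    · rintro rfl; exact hws _ _ hr
    · rcases node_cases (a := a) (ys := ys) (mem_nodes_src hc hr) with h1 | ⟨y, hy, h1⟩ | h1
      · cases h1
      · exact (c.target_adjacent hy).1 k hc (h1 ▸ hr)
      · obtain ⟨l, hl, hv⟩ := (c.inner_adjacent h1).2.2.2
        exact hG.root_in l (c.subset hl) hv
  case root_in =>
    intro l hl hv
    rw [root] at hv
    rcases hmem l hl with hk | ⟨y, hy, rfl⟩
    · exact hG.root_in l (hKL l hk) hv
    · obtain ⟨h, hh, hhv⟩ := (c.target_adjacent (hYy y hy)).2.1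
      exact hG.root_in h (c.subset hh) ((hwt _ _).1 hv ▸ hhv)
  case level_le =>
    intro v k hk l hl hv hv' p hp hpp ho
    replace hk := hsrc k hk v hv
    have hpK := hpar p hp hpp
    rw [hout p hpK hpp k hk] at ho
    rcases hmem l hl with h1 | ⟨y, hy, rfl⟩
    · rw [hin p hpK hpp l h1]
      exact hG.level_le v k (hKL k hk) l (hKL l h1) hv hv' p (hKL p hpK) hpp ho
    · obtain rfl := (hwt _ _).1 hv'
      exact .inl ((hbW p hpK hpp y hy).2 ⟨k, hk, hv, ho⟩)
  case level_eq =>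
    intro v k hk l hl hv hv' hd p hp hpp hi
    replace hk := hsrc k hk v hv
    have hpK := hpar p hp hpp
    rw [hout p hpK hpp k hk]
    rcases hmem l hl with h1 | ⟨y, hy, rfl⟩
    · rw [hin p hpK hpp l h1] at hi
      exact hG.level_eq v k (hKL k hk) l (hKL l h1) hv hv' hd p (hKL p hpK) hpp hi
    · obtain rfl := (hwt _ _).1 hv'
      rcases hi with hi | rfl
      · obtain ⟨k', hk', hvk, h1⟩ := (hbW p hpK hpp y hy).1 hi
        rwa [hG.out_unique _ k (hKL k hk) k' (hKL k' hk') hv hvk]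
      · exact absurd hpp (hwp y)
  case variable_in =>
    intro z k hk l hl hkp hv hv'
    replace hk := hsrc k hk _ hv
    rcases hmem l hl with h1 | ⟨y, hy, rfl⟩
    · exact hG.variable_in z k (hKL k hk) l (hKL l h1) hkp hv hv'
    · exact .inr ⟨y, rfl⟩
  case acyclic =>
    refine fun v hv => hG.acyclic v (hv.lift id ?_)
    rintro u w (⟨l, hl, h1, h2, h3⟩ | ⟨b, z, q, hq, l, hl, hw⟩)
    · exact .link l (hKL l (hsrc l hl u h2)) h1 h2 h3
    · have hqp := Link.isPar_par b z q
      have hqK := hpar _ hq hqp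
      refine .box b z q (hKL _ hqK) ?_
      rcases hbm _ hqK hqp l hl with h1 | ⟨y, hy, rfl⟩
      · exact ⟨l, (hbK _ hqK hqp l h1).1 hl, hw⟩
      · obtain rfl := (hwt _ _).1 (hw.resolve_left (hws _ _))
        rw [box b z q hqK] at hl
        obtain ⟨h, hh, hhv⟩ := (c.target_adjacent (hYy y hy)).2.1
        refine mem_nodes_tgt ((c.mem_box_iff (hKL _ hqK) hqp (hKH _ hqK) hh).2 ?_) hhv
        rcases hl with h1 | ⟨y', hy', he, h1, -⟩
        · exact absurd (hKL _ h1.2) (hYL y hy)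
        · exact h1

end ExpCut

/-! ### The exponential step on derelictions -/

namespace ExpCut

variable {G : PreNet} {x a : ℕ} {H : Set Link} {ys : Set ℕ}

/-- The names of the copies of inner nodes. -/
theorem copy_inner {D : Set ℕ} {f g : ℕ → ℕ → ℕ}
    (hc : IsCopying G a H ys D f g) :
    (∀ b ∈ D, ∀ v ∈ Inner H a ys, v.map (f b) (g b) ∈ nodes G.links →
      v.map (f b) (g b) ∈ Inner H a ys) ∧
    ∀ b ∈ D, ∀ b' ∈ D, ∀ v ∈ Inner H a ys, ∀ v' ∈ Inner H a ys,
      v.map (f b) (g b) = v'.map (f b') (g b') → b = b' ∧ v = v' := by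
  have he : ∀ z, Node.e z ∈ Inner H a ys ↔ z ∈ eNodes H \ ys := by
    intro z
    simp only [Inner, eNodes, Set.mem_ofPred_eq, Set.mem_sdiff]
    constructor
    · rintro ⟨h1, -, h2⟩; exact ⟨h1, fun h => h2 z h rfl⟩
    · rintro ⟨h1, h2⟩
      exact ⟨h1, by simp, fun y hy h => by cases h; exact h2 hy⟩
  have hm : ∀ b, Node.m b ∈ Inner H a ys ↔ b ∈ mNodes H \ {a} := by
    intro b
    simp +contextual [Inner, mNodes]
  constructor
  · rintro b hb (z | d) hv hn
    · rw [he] at hv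
      refine (he _).2 ?_
      by_contra h1
      exact hc.e_fresh b hb z hv ⟨hn, h1⟩
    · rw [hm] at hv
      refine (hm _).2 ?_
      by_contra h1
      exact hc.m_fresh b hb d hv ⟨hn, h1⟩
  · rintro b hb b' hb' (z | d) hv (z' | d') hv' heq
    · obtain ⟨h1, h2⟩ := hc.e_inj b hb b' hb' z ((he _).1 hv) z' ((he _).1 hv')
        (by simpa [Node.map] using heq)
      exact ⟨h1, by rw [h2]⟩
    · simp [Node.map] at heq
    · simp [Node.map] at heq
    · obtain ⟨h1, h2⟩ := hc.m_inj b hb b' hb' d ((hm _).1 hv) d' ((hm _).1 hv')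
        (by simpa [Node.map] using heq)
      exact ⟨h1, by rw [h2]⟩

/-- An exponential step on derelictions preserves levelled nets. Links of the result are links of
`K` or copies `h.map (f b) (g b)` with `h ∈ H`; in the boxes of the net around the cut, the copy
with index `b` behaves as the dereliction from `b` did. -/
theorem leveled_der (c : ExpCut G x a H ys) {G' : PreNet} {D : Set ℕ} {f g : ℕ → ℕ → ℕ}
    {K : Set Link}
    (hD : D = {b | Link.der b x ∈ G.links}) (nonempty : D.Nonempty)
    (copying : IsCopying G a H ys D f g)
    (hK : K = G.links \ ({.bang x a} ∪ H ∪ {l | ∃ b ∈ D, l = .der b x}))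
    (links : G'.links = K ∪ {l | ∃ b ∈ D, l ∈ Link.map (f b) (g b) '' H})
    (root : G'.root = G.root)
    (box : ∀ p ∈ K, p.IsPar → G'.box p =
      (G.box p ∩ K) ∪ {l | ∃ b ∈ D, .der b x ∈ G.box p ∧ l ∈ Link.map (f b) (g b) '' H})
    (box_copy : ∀ b ∈ D, ∀ p ∈ H, p.IsPar →
      G'.box (p.map (f b) (g b)) = Link.map (f b) (g b) '' G.box p) :
    Leveled ∅ G' := by
  have hG := c.leveled
  have hB := c.bang_mem
  obtain ⟨b₀, hb₀⟩ := nonempty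
  have hKm : ∀ k, k ∈ K ↔ k ∈ G.links ∧ k ≠ .bang x a ∧ k ∉ H ∧ ∀ b ∈ D, k ≠ .der b x := by
    intro k
    rw [hK, Set.mem_sdiff, Set.mem_union, Set.mem_union, Set.mem_singleton_iff, Set.mem_ofPred_eq]
    push Not
    rw [and_assoc]
  have hKL : ∀ k ∈ K, k ∈ G.links := fun k hk => ((hKm k).1 hk).1
  have hKH : ∀ k ∈ K, k ∉ H := fun k hk => ((hKm k).1 hk).2.2.1
  have hHL : ∀ h ∈ H, h ∈ G.links := c.subset
  have hDL : ∀ b ∈ D, Link.der b x ∈ G.links := fun b hb => by rw [hD] at hb; exact hb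
  have hds : ∀ b v, v ∈ (Link.der b x).src ↔ v = .m b := by simp [Link.src]
  have hdt : ∀ b v, v ∈ (Link.der b x).tgt ↔ v = .e x := by simp [Link.tgt]
  have hBs : ∀ v, v ∈ (Link.bang x a).src ↔ v = .e x := by simp [Link.src]
  have hBt : ∀ v, v ∈ (Link.bang x a).tgt ↔ v = .m a := by simp [Link.tgt]
  have hdp : ∀ b, ¬ (Link.der b x).IsPar := by rintro b ⟨_, _, _, h⟩; cases h
  have hdH : ∀ b, Link.der b x ∉ H := fun b hc =>
    c.x_notMem_nodes (mem_nodes_tgt hc ((hdt _ _).2 rfl))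
  have hxin : ∀ l ∈ G.links, Node.e x ∈ l.tgt → ∃ b ∈ D, l = .der b x := by
    intro l hl hv
    have hld : l.IsDer := by
      by_cases hne : l = .der b₀ x
      · exact ⟨_, _, hne⟩
      · exact (hG.in_unique _ l hl _ (hDL b₀ hb₀) hv ((hdt _ _).2 rfl) hne).1
    obtain ⟨b, z, rfl⟩ := hld
    obtain rfl : x = z := by simpa [Link.tgt] using hv
    exact ⟨b, by rw [hD]; exact hl, rfl⟩
  have hxout : ∀ l ∈ G.links, Node.e x ∈ l.src → l = .bang x a := fun l hl hv =>
    hG.out_unique _ l hl _ hB hv ((hBs _).2 rfl)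
  have hDout : ∀ b ∈ D, ∀ l ∈ G.links, Node.m b ∈ l.src → l = .der b x := fun b hb l hl hv =>
    hG.out_unique _ l hl _ (hDL b hb) hv ((hds _ _).2 rfl)
  -- the three kinds of nodes of `H`
  have hInner := fun {v} (hv : v ∈ Inner H a ys) => c.inner_adjacent hv
  have hHs : ∀ h ∈ H, ∀ v ∈ h.src, v = .m a ∨ v ∈ Inner H a ys := by
    intro h hh v hv
    rcases node_cases (a := a) (ys := ys) (mem_nodes_src hh hv) with h1 | ⟨y, hy, rfl⟩ | h1
    · exact .inl h1
    · exact absurd hv ((c.target_adjacent hy).1 h hh)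
    · exact .inr h1
  have hHt : ∀ h ∈ H, ∀ v ∈ h.tgt, (∃ y ∈ ys, v = .e y ∧ h.IsDer) ∨ v ∈ Inner H a ys := by
    intro h hh v hv
    rcases node_cases (a := a) (ys := ys) (mem_nodes_tgt hh hv) with rfl | ⟨y, hy, rfl⟩ | h1
    · exact absurd hh (c.eq_bang (hHL h hh) hv ▸ c.bang_notMem)
    · exact .inl ⟨y, hy, rfl, (c.target_adjacent hy).2.2 h hh hv⟩
    · exact .inr h1
  have hKs : ∀ k ∈ K, ∀ v ∈ k.src, v ≠ .e x ∧ v ≠ .m a ∧ v ∉ Inner H a ys ∧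
      ∀ b ∈ D, v ≠ .m b := by
    refine fun k hk v hv => ⟨?_, ?_, fun hc => hKH k hk ((hInner hc).1 k (hKL k hk) hv), ?_⟩
    · rintro rfl; exact ((hKm k).1 hk).2.1 (hxout k (hKL k hk) hv)
    · rintro rfl; exact hKH k hk (c.mem_of_src_m (hKL k hk) hv)
    · rintro b hb rfl; exact ((hKm k).1 hk).2.2.2 b hb (hDout b hb k (hKL k hk) hv)
  have hKt : ∀ k ∈ K, ∀ v ∈ k.tgt, v ≠ .e x ∧ v ≠ .m a ∧ v ∉ Inner H a ys := by
    refine fun k hk v hv => ⟨?_, ?_, fun hc => hKH k hk ((hInner hc).2.1 k (hKL k hk) hv)⟩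
    · rintro rfl
      obtain ⟨b, hb, h1⟩ := hxin k (hKL k hk) hv
      exact ((hKm k).1 hk).2.2.2 b hb h1
    · rintro rfl; exact ((hKm k).1 hk).2.1 (c.eq_bang (hKL k hk) hv)
  -- names of copies
  have htop : ∀ b ∈ D, (Node.m a).map (f b) (g b) = .m b := fun b hb => by
    simp [Node.map, copying.top b hb]
  have hbot : ∀ b ∈ D, ∀ y ∈ ys, (Node.e y).map (f b) (g b) = .e y := fun b hb y hy => by
    simp [Node.map, copying.bottom b hb y hy]
  obtain ⟨hfresh, hinj⟩ := copy_inner copying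
  have hIK : ∀ b ∈ D, ∀ v ∈ Inner H a ys, ∀ k ∈ K,
      v.map (f b) (g b) ∉ k.src ∧ v.map (f b) (g b) ∉ k.tgt := by
    refine fun b hb v hv k hk => ⟨fun h1 => ?_, fun h1 => ?_⟩
    · exact (hKs k hk _ h1).2.2.1 (hfresh b hb v hv (mem_nodes_src (hKL k hk) h1))
    · exact (hKt k hk _ h1).2.2 (hfresh b hb v hv (mem_nodes_tgt (hKL k hk) h1))
  have hID : ∀ b ∈ D, ∀ v ∈ Inner H a ys, ∀ b' ∈ D, v.map (f b) (g b) ≠ .m b' := by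
    intro b hb v hv b' hb' h1
    have h2 := mem_nodes_src (hDL b' hb') ((hds _ _).2 rfl)
    have h3 := hfresh b hb v hv (h1 ▸ h2)
    exact hdH b' ((hInner h3).1 _ (hDL b' hb') ((hds _ _).2 h1))
  have hIy : ∀ b ∈ D, ∀ v ∈ Inner H a ys, ∀ y ∈ ys, v.map (f b) (g b) ≠ .e y := by
    intro b hb v hv y hy h1
    obtain ⟨h, hh, hhy⟩ := (c.target_adjacent hy).2.1
    have h3 := hfresh b hb v hv (h1 ▸ mem_nodes_tgt (hHL h hh) hhy)
    exact h3.2.2 y hy h1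
  have hs' : ∀ (b : ℕ) (k : Link) (v : Node),
      v ∈ (k.map (f b) (g b)).src ↔ ∃ w ∈ k.src, w.map (f b) (g b) = v := fun b k v => by
    rw [Link.src_map]; rfl
  have ht' : ∀ (b : ℕ) (k : Link) (v : Node),
      v ∈ (k.map (f b) (g b)).tgt ↔ ∃ w ∈ k.tgt, w.map (f b) (g b) = v := fun b k v => by
    rw [Link.tgt_map]; rfl
  -- sources and targets of copies
  have cs : ∀ b ∈ D, ∀ h ∈ H, ∀ v ∈ (h.map (f b) (g b)).src,
      (v = .m b ∧ Node.m a ∈ h.src) ∨ ∃ w ∈ h.src, w ∈ Inner H a ys ∧ w.map (f b) (g b) = v := by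
    intro b hb h hh v hv
    obtain ⟨w, hw, rfl⟩ := (hs' _ _ _).1 hv
    rcases hHs h hh w hw with rfl | h1
    · exact .inl ⟨htop b hb, hw⟩
    · exact .inr ⟨w, hw, h1, rfl⟩
  have ct : ∀ b ∈ D, ∀ h ∈ H, ∀ v ∈ (h.map (f b) (g b)).tgt,
      (∃ y ∈ ys, v = .e y ∧ h.IsDer ∧ Node.e y ∈ h.tgt) ∨
        ∃ w ∈ h.tgt, w ∈ Inner H a ys ∧ w.map (f b) (g b) = v := by
    intro b hb h hh v hv
    obtain ⟨w, hw, rfl⟩ := (ht' _ _ _).1 hv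
    rcases hHt h hh w hw with ⟨y, hy, rfl, h1⟩ | h1
    · exact .inl ⟨y, hy, hbot b hb y hy, h1, hw⟩
    · exact .inr ⟨w, hw, h1, rfl⟩
  have cinj : ∀ b ∈ D, ∀ b' ∈ D, ∀ h ∈ H, ∀ h' ∈ H,
      h.map (f b) (g b) = h'.map (f b') (g b') → b = b' ∧ h = h' := by
    intro b hb b' hb' h hh h' hh' heq
    by_cases hw : h.IsWeak
    · have hw' : h'.IsWeak := Link.isWeak_map.1 (heq ▸ Link.isWeak_map.2 hw)
      have hd : ¬ h.IsDer := by obtain ⟨z, rfl⟩ := hw; rintro ⟨_, _, h⟩; cases h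
      have hd' : ¬ h'.IsDer := by obtain ⟨z, rfl⟩ := hw'; rintro ⟨_, _, h⟩; cases h
      obtain ⟨z, rfl⟩ := hw
      obtain ⟨z', rfl⟩ := hw'
      rcases hHt _ hh (.e z) (by simp [Link.tgt]) with ⟨_, _, _, h1⟩ | h1
      · exact absurd h1 hd
      rcases hHt _ hh' (.e z') (by simp [Link.tgt]) with ⟨_, _, _, h2⟩ | h2
      · exact absurd h2 hd'
      obtain ⟨h3, h4⟩ := hinj b hb b' hb' _ h1 _ h2 (by simpa [Link.map, Node.map] using heq)
      cases h4; exact ⟨h3, rfl⟩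
    · obtain ⟨v, hv⟩ := Link.exists_src hw
      have h1 : v.map (f b) (g b) ∈ (h'.map (f b') (g b')).src := by
        rw [← heq, hs']; exact ⟨v, hv, rfl⟩
      rcases hHs h hh v hv with rfl | h2 <;> rcases cs b' hb' h' hh' _ h1 with
        ⟨h3, h4⟩ | ⟨w, h3, h4, h5⟩
      · rw [htop b hb] at h3
        cases h3
        exact ⟨rfl, hG.out_unique _ h (hHL h hh) h' (hHL h' hh') hv h4⟩
      · rw [htop b hb] at h5
        exact absurd h5 (hID b' hb' w h4 b hb)
      · exact absurd h3 (hID b hb v h2 b' hb')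
      · obtain ⟨h6, rfl⟩ := hinj b' hb' b hb w h4 v h2 h5
        exact ⟨h6.symm, hG.out_unique _ h (hHL h hh) h' (hHL h' hh') hv h3⟩
  have cK : ∀ b ∈ D, ∀ h ∈ H, h.map (f b) (g b) ∉ K := by
    intro b hb h hh hc
    by_cases hw : h.IsWeak
    · obtain ⟨z, rfl⟩ := hw
      rcases hHt _ hh (.e z) (by simp [Link.tgt]) with ⟨_, _, _, _, _, h1⟩ | h1
      · cases h1
      · exact (hIK b hb _ h1 _ hc).2 ((ht' _ _ _).2 ⟨_, by simp [Link.tgt], rfl⟩)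
    · obtain ⟨v, hv⟩ := Link.exists_src hw
      have hv' : v.map (f b) (g b) ∈ (h.map (f b) (g b)).src := (hs' _ _ _).2 ⟨v, hv, rfl⟩
      rcases hHs h hh v hv with rfl | h2
      · exact (hKs _ hc _ hv').2.2.2 b hb (htop b hb)
      · exact (hIK b hb v h2 _ hc).1 hv'
  -- boxes
  have hDbox : ∀ p ∈ G.links, p.IsPar → ∀ b ∈ D, Link.bang x a ∈ G.box p →
      Link.der b x ∈ G.box p := by
    intro p hp hpp b hb h1
    rcases hG.level_le (.e x) _ hB _ (hDL b hb) ((hBs _).2 rfl) ((hdt _ _).2 rfl) p hp hpp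
      (.inl h1) with h2 | h2
    · exact h2
    · exact absurd (h2 ▸ hpp) (hdp b)
  have bKK : ∀ p ∈ K, p.IsPar → ∀ k ∈ K, k ∈ G'.box p ↔ k ∈ G.box p := by
    intro p hp hpp k hk
    rw [box p hp hpp]
    constructor
    · rintro (h1 | ⟨b, hb, -, h, hh, rfl⟩)
      · exact h1.1
      · exact absurd hk (cK b hb h hh)
    · exact fun h1 => .inl ⟨h1, hk⟩
  have bKC : ∀ p ∈ K, p.IsPar → ∀ b ∈ D, ∀ h ∈ H,
      h.map (f b) (g b) ∈ G'.box p ↔ Link.der b x ∈ G.box p := by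
    intro p hp hpp b hb h hh
    rw [box p hp hpp]
    constructor
    · rintro (h1 | ⟨b', hb', h1, h', hh', h2⟩)
      · exact absurd h1.2 (cK b hb h hh)
      · exact (cinj b' hb' b hb h' hh' h hh h2).1 ▸ h1
    · exact fun h1 => .inr ⟨b, hb, h1, h, hh, rfl⟩
  have bCC : ∀ b' ∈ D, ∀ p ∈ H, p.IsPar → ∀ b ∈ D, ∀ h ∈ H,
      h.map (f b) (g b) ∈ G'.box (p.map (f b') (g b')) ↔ b = b' ∧ h ∈ G.box p := by
    intro b' hb' p hp hpp b hb h hh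
    rw [box_copy b' hb' p hp hpp]
    constructor
    · rintro ⟨h', hh', h2⟩
      obtain ⟨h3, rfl⟩ := cinj b' hb' b hb h' (c.box_subset hp hpp hh') h hh h2
      exact ⟨h3.symm, hh'⟩
    · rintro ⟨rfl, h1⟩; exact ⟨h, h1, rfl⟩
  have bCm : ∀ b ∈ D, ∀ p ∈ H, p.IsPar → ∀ l ∈ G'.box (p.map (f b) (g b)),
      ∃ h ∈ H, h ∈ G.box p ∧ l = h.map (f b) (g b) := by
    intro b hb p hp hpp l hl
    rw [box_copy b hb p hp hpp] at hl
    obtain ⟨h, hh, rfl⟩ := hl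
    exact ⟨h, c.box_subset hp hpp hh, hh, rfl⟩
  have bCK : ∀ b ∈ D, ∀ p ∈ H, p.IsPar → ∀ k ∈ K, k ∉ G'.box (p.map (f b) (g b)) := by
    intro b hb p hp hpp k hk hc
    obtain ⟨h, hh, -, rfl⟩ := bCm b hb p hp hpp k hc
    exact cK b hb h hh hk
  have hmem : ∀ l ∈ G'.links, l ∈ K ∨ ∃ b ∈ D, ∃ h ∈ H, l = h.map (f b) (g b) := by
    intro l hl
    rw [links] at hl
    exact hl.imp_right fun ⟨b, hb, h, hh, he⟩ => ⟨b, hb, h, hh, he.symm⟩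
  have hmemK : ∀ k ∈ K, k ∈ G'.links := fun k hk => links ▸ .inl hk
  have hmemC : ∀ b ∈ D, ∀ h ∈ H, h.map (f b) (g b) ∈ G'.links := fun b hb h hh =>
    links ▸ .inr ⟨b, hb, h, hh, rfl⟩
  have bKm : ∀ p ∈ K, p.IsPar → ∀ l ∈ G'.box p, l ∈ G'.links := by
    intro p hp hpp l hl
    rw [box p hp hpp] at hl
    rcases hl with h1 | ⟨b, hb, -, h, hh, rfl⟩
    · exact hmemK l h1.2
    · exact hmemC b hb h hh
  -- levels
  have oKK : ∀ p ∈ K, p.IsPar → ∀ k ∈ K, ∀ v, G'.OutLevel p v k ↔ G.OutLevel p v k :=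
    fun p hp hpp k hk v => or_congr_left (bKK p hp hpp k hk)
  have iKK : ∀ p ∈ K, p.IsPar → ∀ k ∈ K, G'.InLevel p k ↔ G.InLevel p k :=
    fun p hp hpp k hk => or_congr_left (bKK p hp hpp k hk)
  have oKC : ∀ p ∈ K, p.IsPar → ∀ b ∈ D, ∀ h ∈ H, ∀ v,
      G'.OutLevel p v (h.map (f b) (g b)) ↔ Link.der b x ∈ G.box p := by
    intro p hp hpp b hb h hh v
    rw [← bKC p hp hpp b hb h hh]
    exact or_iff_left fun hc => cK b hb h hh (hc.1 ▸ hp)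
  have iKC : ∀ p ∈ K, p.IsPar → ∀ b ∈ D, ∀ h ∈ H,
      G'.InLevel p (h.map (f b) (g b)) ↔ Link.der b x ∈ G.box p := by
    intro p hp hpp b hb h hh
    rw [← bKC p hp hpp b hb h hh]
    exact or_iff_left fun hc => cK b hb h hh (hc ▸ hp)
  have oCK : ∀ b ∈ D, ∀ p ∈ H, p.IsPar → ∀ k ∈ K, ∀ v,
      ¬ G'.OutLevel (p.map (f b) (g b)) v k := by
    rintro b hb p hp hpp k hk v (h1 | ⟨h1, -⟩)
    · exact bCK b hb p hp hpp k hk h1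
    · exact cK b hb p hp (h1 ▸ hk)
  have iCK : ∀ b ∈ D, ∀ p ∈ H, p.IsPar → ∀ k ∈ K, ¬ G'.InLevel (p.map (f b) (g b)) k := by
    rintro b hb p hp hpp k hk (h1 | h1)
    · exact bCK b hb p hp hpp k hk h1
    · exact cK b hb p hp (h1 ▸ hk)
  have oCC : ∀ b' ∈ D, ∀ p ∈ H, p.IsPar → ∀ b ∈ D, ∀ h ∈ H, ∀ v : Node,
      G'.OutLevel (p.map (f b') (g b')) (v.map (f b) (g b)) (h.map (f b) (g b)) ↔
        b = b' ∧ G.OutLevel p v h := by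
    intro b' hb' p hp hpp b hb h hh v
    have hve : (∃ y, v.map (f b) (g b) = .e y) ↔ ∃ y, v = .e y := by cases v <;> simp [Node.map]
    unfold PreNet.OutLevel
    rw [bCC b' hb' p hp hpp b hb h hh, hve]
    constructor
    · rintro (⟨h1, h2⟩ | ⟨h1, h2⟩)
      · exact ⟨h1, .inl h2⟩
      · obtain ⟨h3, h4⟩ := cinj b hb b' hb' h hh p hp h1
        exact ⟨h3, .inr ⟨h4, h2⟩⟩
    · rintro ⟨rfl, h1 | ⟨rfl, h1⟩⟩
      · exact .inl ⟨rfl, h1⟩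
      · exact .inr ⟨rfl, h1⟩
  have iCC : ∀ b' ∈ D, ∀ p ∈ H, p.IsPar → ∀ b ∈ D, ∀ h ∈ H,
      G'.InLevel (p.map (f b') (g b')) (h.map (f b) (g b)) ↔ b = b' ∧ G.InLevel p h := by
    intro b' hb' p hp hpp b hb h hh
    unfold PreNet.InLevel
    rw [bCC b' hb' p hp hpp b hb h hh]
    constructor
    · rintro (⟨h1, h2⟩ | h1)
      · exact ⟨h1, .inl h2⟩
      · obtain ⟨h3, h4⟩ := cinj b hb b' hb' h hh p hp h1
        exact ⟨h3, .inr h4⟩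
    · rintro ⟨rfl, h1 | rfl⟩
      · exact .inl ⟨rfl, h1⟩
      · exact .inr rfl
  have hpar : ∀ p ∈ G'.links, p.IsPar → (p ∈ K ∨ ∃ b ∈ D, ∃ q ∈ H, q.IsPar ∧
      p = q.map (f b) (g b)) := by
    intro p hp hpp
    rcases hmem p hp with h1 | ⟨b, hb, q, hq, rfl⟩
    · exact .inl h1
    · exact .inr ⟨b, hb, q, hq, Link.isPar_map.1 hpp, rfl⟩
  -- the adjacent pairs of links of the result, and the pairs of the net that they come from
  have adj : ∀ v, ∀ l ∈ G'.links, ∀ l' ∈ G'.links, v ∈ l.src → v ∈ l'.tgt →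
      (l ∈ K ∧ l' ∈ K) ∨
      (l' ∈ K ∧ ∃ b ∈ D, v = .m b ∧ ∃ h ∈ H, Node.m a ∈ h.src ∧ l = h.map (f b) (g b)) ∨
      (l ∈ K ∧ ∃ b ∈ D, ∃ h ∈ H, v ∈ h.tgt ∧ h.IsDer ∧ l' = h.map (f b) (g b)) ∨
      ∃ b ∈ D, ∃ h ∈ H, ∃ h' ∈ H, l = h.map (f b) (g b) ∧ l' = h'.map (f b) (g b) ∧
        ∃ w, w ∈ h.src ∧ w ∈ h'.tgt ∧ w ∈ Inner H a ys ∧ w.map (f b) (g b) = v := by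
    intro v l hl l' hl' hv hv'
    rcases hmem l hl with hk | ⟨b, hb, h, hh, rfl⟩ <;>
      rcases hmem l' hl' with hk' | ⟨b', hb', h', hh', rfl⟩
    · exact .inl ⟨hk, hk'⟩
    · rcases ct b' hb' h' hh' v hv' with ⟨y, hy, rfl, hd, hy'⟩ | ⟨w, hw, hwI, rfl⟩
      · exact .inr (.inr (.inl ⟨hk, b', hb', h', hh', hy', hd, rfl⟩))
      · exact absurd hv (hIK b' hb' w hwI l hk).1
    · rcases cs b hb h hh v hv with ⟨rfl, h1⟩ | ⟨w, hw, hwI, rfl⟩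
      · exact .inr (.inl ⟨hk', b, hb, rfl, h, hh, h1, rfl⟩)
      · exact absurd hv' (hIK b hb w hwI l' hk').2
    · rcases cs b hb h hh v hv with ⟨rfl, h1⟩ | ⟨w, hw, hwI, rfl⟩ <;>
        rcases ct b' hb' h' hh' _ hv' with ⟨y, hy, h2, -, -⟩ | ⟨w', hw', hwI', h2⟩
      · cases h2
      · exact absurd h2 (hID b' hb' w' hwI' b hb)
      · exact absurd h2 (hIy b hb w hwI y hy)
      · obtain ⟨rfl, rfl⟩ := hinj b' hb' b hb w' hwI' w hwI h2
        exact .inr (.inr (.inr ⟨b', hb', h, hh, h', hh', rfl, rfl, w', hw, hw', hwI, rfl⟩))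
  obtain ⟨h₀, hh₀, ha₀⟩ := c.exists_top
  constructor
  case finite =>
    rw [links]
    refine (hG.finite.subset hKL).union ?_
    have hDf : D.Finite := by
      have : ((fun b => Link.der b x) '' D).Finite :=
        hG.finite.subset (by rintro _ ⟨b, hb, rfl⟩; exact hDL b hb)
      exact this.of_finite_image fun _ _ _ _ h => by simpa using h
    have hHf := hG.finite.subset c.subset
    refine (hDf.biUnion fun b _ => hHf.image (Link.map (f b) (g b))).subset ?_
    rintro l ⟨b, hb, hl⟩
    exact Set.mem_biUnion hb hl
  case box_subset =>
    intro p hp hpp l hl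
    rcases hpar p hp hpp with hpK | ⟨b, hb, q, hq, hqp, rfl⟩
    · exact bKm p hpK hpp l hl
    · obtain ⟨h, hh, -, rfl⟩ := bCm b hb q hq hqp l hl
      exact hmemC b hb h hh
  case box_irrefl =>
    intro p hp hpp hc
    rcases hpar p hp hpp with hpK | ⟨b, hb, q, hq, hqp, rfl⟩
    · exact hG.box_irrefl p (hKL p hpK) hpp ((bKK p hpK hpp p hpK).1 hc)
    · exact hG.box_irrefl q (hHL q hq) hqp ((bCC b hb q hq hqp b hb q hq).1 hc).2
  case box_trans =>
    intro p hp hpp p' hp' hpp' l hl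
    rcases hpar p hp hpp with hpK | ⟨b, hb, q, hq, hqp, rfl⟩
    · rcases hpar p' (bKm p hpK hpp p' hp') hpp' with hpK' | ⟨b, hb, q, hq, hqp, rfl⟩
      · have hsub := hG.box_trans p (hKL p hpK) hpp p' ((bKK p hpK hpp p' hpK').1 hp') hpp'
        rcases hmem l (bKm p' hpK' hpp' l hl) with hk | ⟨b, hb, h, hh, rfl⟩
        · exact (bKK p hpK hpp l hk).2 (hsub ((bKK p' hpK' hpp' l hk).1 hl))
        · exact (bKC p hpK hpp b hb h hh).2 (hsub ((bKC p' hpK' hpp' b hb h hh).1 hl))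
      · obtain ⟨h, hh, -, rfl⟩ := bCm b hb q hq hqp l hl
        exact (bKC p hpK hpp b hb h hh).2 ((bKC p hpK hpp b hb q hq).1 hp')
    · obtain ⟨q', hq', hqq, rfl⟩ := bCm b hb q hq hqp p' hp'
      have hqp' := Link.isPar_map.1 hpp'
      obtain ⟨h, hh, hhq, rfl⟩ := bCm b hb q' hq' hqp' l hl
      exact (bCC b hb q hq hqp b hb h hh).2 ⟨rfl, hG.box_trans q (hHL q hq) hqp q' hqq hqp' hhq⟩
  case box_laminar =>
    intro p hp hpp p' hp' hpp' l hl hl'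
    rcases hpar p hp hpp with hpK | ⟨b, hb, q, hq, hqp, rfl⟩ <;>
      rcases hpar p' hp' hpp' with hpK' | ⟨b', hb', q', hq', hqp', rfl⟩
    · rw [bKK p' hpK' hpp' p hpK, bKK p hpK hpp p' hpK']
      have hlam := hG.box_laminar p (hKL p hpK) hpp p' (hKL p' hpK') hpp'
      rcases hmem l (bKm p hpK hpp l hl) with hk | ⟨b, hb, h, hh, rfl⟩
      · exact hlam l ((bKK p hpK hpp l hk).1 hl) ((bKK p' hpK' hpp' l hk).1 hl')
      · exact hlam _ ((bKC p hpK hpp b hb h hh).1 hl) ((bKC p' hpK' hpp' b hb h hh).1 hl')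
    · obtain ⟨h, hh, -, rfl⟩ := bCm b' hb' q' hq' hqp' l hl'
      exact .inr (.inr ((bKC p hpK hpp b' hb' q' hq').2 ((bKC p hpK hpp b' hb' h hh).1 hl)))
    · obtain ⟨h, hh, -, rfl⟩ := bCm b hb q hq hqp l hl
      exact .inr (.inl ((bKC p' hpK' hpp' b hb q hq).2 ((bKC p' hpK' hpp' b hb h hh).1 hl')))
    · obtain ⟨h, hh, hhq, rfl⟩ := bCm b hb q hq hqp l hl
      obtain ⟨rfl, hhq'⟩ := (bCC b' hb' q' hq' hqp' b hb h hh).1 hl'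
      rw [bCC b hb q' hq' hqp' b hb q hq, bCC b hb q hq hqp b hb q' hq']
      rcases hG.box_laminar q (hHL q hq) hqp q' (hHL q' hq') hqp' h hhq hhq' with rfl | h1 | h1
      · exact .inl rfl
      · exact .inr (.inl ⟨rfl, h1⟩)
      · exact .inr (.inr ⟨rfl, h1⟩)
  case in_unique =>
    intro v l hl l' hl' hv hv' hne
    rcases hmem l hl with hk | ⟨b, hb, h, hh, rfl⟩ <;>
      rcases hmem l' hl' with hk' | ⟨b', hb', h', hh', rfl⟩
    · exact hG.in_unique v l (hKL l hk) l' (hKL l' hk') hv hv' hne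
    · rcases ct b' hb' h' hh' v hv' with ⟨y, hy, rfl, hd, hy'⟩ | ⟨w, hw, hwI, rfl⟩
      · rw [Link.isDer_map]
        exact hG.in_unique _ l (hKL l hk) h' (hHL h' hh') hv hy' fun h => hKH l hk (h ▸ hh')
      · exact absurd hv (hIK b' hb' w hwI l hk).2
    · rcases ct b hb h hh v hv with ⟨y, hy, rfl, hd, hy'⟩ | ⟨w, hw, hwI, rfl⟩
      · rw [Link.isDer_map]
        exact hG.in_unique _ h (hHL h hh) l' (hKL l' hk') hy' hv' fun h => hKH l' hk' (h ▸ hh)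
      · exact absurd hv' (hIK b hb w hwI l' hk').2
    · rw [Link.isDer_map, Link.isDer_map]
      rcases ct b hb h hh v hv with ⟨y, hy, rfl, hd, -⟩ | ⟨w, hw, hwI, rfl⟩ <;>
        rcases ct b' hb' h' hh' _ hv' with ⟨y', hy', h2, hd', -⟩ | ⟨w', hw', hwI', h2⟩
      · exact ⟨hd, hd'⟩
      · exact absurd h2 (hIy b' hb' w' hwI' y hy)
      · exact absurd h2 (hIy b hb w hwI y' hy')
      · obtain ⟨rfl, rfl⟩ := hinj b' hb' b hb w' hwI' w hwI h2
        exact hG.in_unique _ h (hHL h hh) h' (hHL h' hh') hw hw' fun h => hne (h ▸ rfl)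
  case out_unique =>
    intro v l hl l' hl' hv hv'
    rcases hmem l hl with hk | ⟨b, hb, h, hh, rfl⟩ <;>
      rcases hmem l' hl' with hk' | ⟨b', hb', h', hh', rfl⟩
    · exact hG.out_unique v l (hKL l hk) l' (hKL l' hk') hv hv'
    · rcases cs b' hb' h' hh' v hv' with ⟨rfl, -⟩ | ⟨w, hw, hwI, rfl⟩
      · exact absurd rfl ((hKs l hk _ hv).2.2.2 b' hb')
      · exact absurd hv (hIK b' hb' w hwI l hk).1
    · rcases cs b hb h hh v hv with ⟨rfl, -⟩ | ⟨w, hw, hwI, rfl⟩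
      · exact absurd rfl ((hKs l' hk' _ hv').2.2.2 b hb)
      · exact absurd hv' (hIK b hb w hwI l' hk').1
    · rcases cs b hb h hh v hv with ⟨rfl, h1⟩ | ⟨w, hw, hwI, rfl⟩ <;>
        rcases cs b' hb' h' hh' _ hv' with ⟨h2, h3⟩ | ⟨w', hw', hwI', h2⟩
      · cases h2
        rw [hG.out_unique _ h (hHL h hh) h' (hHL h' hh') h1 h3]
      · exact absurd h2 (hID b' hb' w' hwI' b hb)
      · exact absurd h2 (hID b hb w hwI b' hb')
      · obtain ⟨rfl, rfl⟩ := hinj b' hb' b hb w' hwI' w hwI h2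
        rw [hG.out_unique _ h (hHL h hh) h' (hHL h' hh') hw hw']
  case of_no_in =>
    intro v l hl hv hno
    rcases hmem l hl with hk | ⟨b, hb, h, hh, rfl⟩
    · have hvs := hKs l hk v hv
      obtain ⟨h1, h2⟩ := hG.of_no_in v l (hKL l hk) hv fun l' hl' hvl => by
        by_cases hlK : l' ∈ K
        · exact hno l' (hmemK l' hlK) hvl
        by_cases hlB : l' = .bang x a
        · subst hlB; exact hvs.2.1 ((hBt _).1 hvl)
        by_cases hlH : l' ∈ H
        · rcases hHt l' hlH v hvl with ⟨y, hy, rfl, -⟩ | h1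
          · exact hno _ (hmemC b₀ hb₀ l' hlH) ((ht' _ _ _).2 ⟨_, hvl, hbot b₀ hb₀ y hy⟩)
          · exact hvs.2.2.1 h1
        · refine hlK ((hKm l').2 ⟨hl', hlB, hlH, ?_⟩)
          rintro b hb rfl
          exact hvs.1 ((hdt _ _).1 hvl)
      refine ⟨by rw [root, h1], fun p hp hpp ho => ?_⟩
      rcases hpar p hp hpp with hpK | ⟨b, hb, q, hq, hqp, rfl⟩
      · exact h2 p (hKL p hpK) hpp ((oKK p hpK hpp l hk v).1 ho)
      · exact oCK b hb q hq hqp l hk v ho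
    · exfalso
      rcases cs b hb h hh v hv with ⟨rfl, -⟩ | ⟨w, hw, hwI, rfl⟩
      · -- the top of a copy is the source of the dereliction, and keeps its incoming link
        have hmb := mem_nodes_src (hDL b hb) ((hds _ _).2 rfl)
        obtain ⟨l', ⟨hl', hvl⟩, -⟩ := (hG.graphConditions.multiplicative b hmb).1
        refine hno l' (hmemK l' ((hKm l').2 ⟨hl', ?_, ?_, ?_⟩)) hvl
        · rintro rfl
          have := (hBt _).1 hvl
          cases this
          have h1 := hDout _ hb h₀ (hHL h₀ hh₀) ha₀
          exact hdH _ (h1 ▸ hh₀)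
        · intro hc
          rcases hHt l' hc _ hvl with ⟨y, hy, h1, -⟩ | h1
          · cases h1
          · exact hdH b ((hInner h1).1 _ (hDL b hb) ((hds _ _).2 rfl))
        · rintro b' hb' rfl
          cases (hdt _ _).1 hvl
      · obtain ⟨h', hh', hw'⟩ := (hInner hwI).2.2.2
        exact hno _ (hmemC b hb h' hh') ((ht' _ _ _).2 ⟨w, hw', rfl⟩)
  case of_no_out =>
    intro v l hl hv hno
    rcases hmem l hl with hk | ⟨b, hb, h, hh, rfl⟩
    · have hvt := hKt l hk v hv
      rcases hG.of_no_out v l (hKL l hk) hv fun l' hl' hvl => by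
          by_cases hlK : l' ∈ K
          · exact hno l' (hmemK l' hlK) hvl
          by_cases hlB : l' = .bang x a
          · subst hlB; exact hvt.1 ((hBs _).1 hvl)
          by_cases hlH : l' ∈ H
          · rcases hHs l' hlH v hvl with h1 | h1
            · exact hvt.2.1 h1
            · exact hvt.2.2 h1
          · refine hlK ((hKm l').2 ⟨hl', hlB, hlH, ?_⟩)
            rintro b hb rfl
            obtain rfl := (hds _ _).1 hvl
            exact hno _ (hmemC b hb h₀ hh₀) ((hs' _ _ _).2 ⟨_, ha₀, htop b hb⟩)
        with h1 | ⟨h1, h2⟩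
      · exact .inl h1
      · refine .inr ⟨h1, fun p hp hpp hc => ?_⟩
        rcases hpar p hp hpp with hpK | ⟨b, hb, q, hq, hqp, rfl⟩
        · exact h2 p (hKL p hpK) hpp ((bKK p hpK hpp l hk).1 hc)
        · exact bCK b hb q hq hqp l hk hc
    · rcases ct b hb h hh v hv with ⟨y, hy, rfl, hd, -⟩ | ⟨w, hw, hwI, rfl⟩
      · exact .inl (Link.isDer_map.2 hd)
      · obtain ⟨h', hh', hw'⟩ := (hInner hwI).2.2.1
        exact absurd ((hs' _ _ _).2 ⟨w, hw', rfl⟩) (hno _ (hmemC b hb h' hh'))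
  case root_out =>
    obtain ⟨k, hk, hr⟩ := hG.root_out
    refine ⟨k, hmemK k ((hKm k).2 ⟨hk, ?_, fun hc => ?_, ?_⟩), root ▸ hr⟩
    · rintro rfl
      have hrx : G.root = x := by simpa using (hBs _).1 hr
      exact hG.root_in _ (hDL b₀ hb₀) ((hdt _ _).2 (by rw [hrx]))
    · rcases hHs k hc _ hr with h1 | h1
      · cases h1
      · obtain ⟨l, hl, hv⟩ := (hInner h1).2.2.2
        exact hG.root_in l (hHL l hl) hv
    · rintro b hb rfl
      cases (hds _ _).1 hr
  case root_in =>
    intro l hl hv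
    rw [root] at hv
    rcases hmem l hl with hk | ⟨b, hb, h, hh, rfl⟩
    · exact hG.root_in l (hKL l hk) hv
    · rcases ct b hb h hh _ hv with ⟨y, hy, h1, -, h2⟩ | ⟨w, hw, hwI, h1⟩
      · exact hG.root_in h (hHL h hh) (h1 ▸ h2)
      · obtain ⟨k, hk, hr⟩ := hG.root_out
        have h2 := hfresh b hb w hwI (h1 ▸ mem_nodes_src hk hr)
        obtain ⟨l, hl, hv⟩ := (hInner h2).2.2.2
        exact hG.root_in l (hHL l hl) (h1 ▸ hv)
  case level_le =>
    intro v l hl l' hl' hv hv' p hp hpp ho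
    rcases adj v l hl l' hl' hv hv' with ⟨hk, hk'⟩ | ⟨hk', b, hb, rfl, h, hh, hha, rfl⟩ |
      ⟨hk, b, hb, h, hh, hvh, hd, rfl⟩ | ⟨b, hb, h, hh, h', hh', rfl, rfl, w, hw, hw', hwI, rfl⟩ <;>
      rcases hpar p hp hpp with hpK | ⟨b', hb', q, hq, hqp, rfl⟩
    · rw [iKK p hpK hpp l' hk']
      exact hG.level_le v l (hKL l hk) l' (hKL l' hk') hv hv' p (hKL p hpK) hpp
        ((oKK p hpK hpp l hk v).1 ho)
    · exact absurd ho (oCK b' hb' q hq hqp l hk v)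
    · rw [iKK p hpK hpp l' hk']
      exact hG.level_le _ _ (hDL b hb) l' (hKL l' hk') ((hds _ _).2 rfl) hv' p (hKL p hpK) hpp
        (.inl ((oKC p hpK hpp b hb h hh _).1 ho))
    · rw [← htop b hb, oCC b' hb' q hq hqp b hb h hh] at ho
      rcases ho.2 with h1 | ⟨-, y, hy⟩
      · exact absurd h1 (c.top_notMem_box hq hqp (hHL h hh) hha)
      · cases hy
    · rw [iKC p hpK hpp b hb h hh]
      refine hDbox p (hKL p hpK) hpp b hb ((c.mem_box_iff (hKL p hpK) hpp (hKH p hpK) hh).1 ?_)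
      rcases hG.level_le v l (hKL l hk) h (hHL h hh) hv hvh p (hKL p hpK) hpp
        ((oKK p hpK hpp l hk v).1 ho) with h1 | h1
      · exact h1
      · exact absurd (h1 ▸ hh) (hKH p hpK)
    · exact absurd ho (oCK b' hb' q hq hqp l hk v)
    · rw [iKC p hpK hpp b hb h' hh']
      exact (oKC p hpK hpp b hb h hh _).1 ho
    · rw [oCC b' hb' q hq hqp b hb h hh] at ho
      rw [iCC b' hb' q hq hqp b hb h' hh']
      exact ⟨ho.1, hG.level_le w h (hHL h hh) h' (hHL h' hh') hw hw' q (hHL q hq) hqp ho.2⟩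
  case level_eq =>
    intro v l hl l' hl' hv hv' hd p hp hpp hi
    rcases adj v l hl l' hl' hv hv' with ⟨hk, hk'⟩ | ⟨hk', b, hb, rfl, h, hh, hha, rfl⟩ |
      ⟨hk, b, hb, h, hh, hvh, hdh, rfl⟩ |
      ⟨b, hb, h, hh, h', hh', rfl, rfl, w, hw, hw', hwI, rfl⟩
    · rcases hpar p hp hpp with hpK | ⟨b', hb', q, hq, hqp, rfl⟩
      · rw [oKK p hpK hpp l hk]
        exact hG.level_eq v l (hKL l hk) l' (hKL l' hk') hv hv' hd p (hKL p hpK) hpp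
          ((iKK p hpK hpp l' hk').1 hi)
      · exact absurd hi (iCK b' hb' q hq hqp l' hk')
    · rcases hpar p hp hpp with hpK | ⟨b', hb', q, hq, hqp, rfl⟩
      · rw [oKC p hpK hpp b hb h hh]
        rcases hG.level_eq _ _ (hDL b hb) l' (hKL l' hk') ((hds _ _).2 rfl) hv' hd p (hKL p hpK) hpp
          ((iKK p hpK hpp l' hk').1 hi) with h1 | ⟨-, y, hy⟩
        · exact h1
        · cases hy
      · exact absurd hi (iCK b' hb' q hq hqp l' hk')
    · exact absurd (Link.isDer_map.2 hdh) hd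
    · rcases hpar p hp hpp with hpK | ⟨b', hb', q, hq, hqp, rfl⟩
      · rw [oKC p hpK hpp b hb h hh]
        exact (iKC p hpK hpp b hb h' hh').1 hi
      · rw [oCC b' hb' q hq hqp b hb h hh]
        rw [iCC b' hb' q hq hqp b hb h' hh'] at hi
        rw [Link.isDer_map] at hd
        exact ⟨hi.1, hG.level_eq w h (hHL h hh) h' (hHL h' hh') hw hw' hd q (hHL q hq) hqp hi.2⟩
  case variable_in =>
    intro z l hl l' hl' hlp hv hv'
    rcases adj _ l hl l' hl' hv hv' with ⟨hk, hk'⟩ | ⟨-, b, -, h1, -⟩ |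
      ⟨hk, b, hb, h, hh, hvh, hdh, rfl⟩ |
      ⟨b, hb, h, hh, h', hh', rfl, rfl, w, hw, hw', hwI, h1⟩
    · exact hG.variable_in z l (hKL l hk) l' (hKL l' hk') hlp hv hv'
    · cases h1
    · exact .inl (Link.isDer_map.2 hdh)
    · rw [Link.isDer_map, Link.isWeak_map]
      rw [Link.isPar_map] at hlp
      obtain ⟨y, rfl⟩ : ∃ y, w = .e y := by
        cases w with
        | e y => exact ⟨y, rfl⟩
        | m d => cases h1
      exact hG.variable_in y h (hHL h hh) h' (hHL h' hh') hlp hw hw'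
  case acyclic =>
    -- every step of the result projects to a path of the net, if copies are sent to originals
    classical
    let π : Node → Node := fun w =>
      if hw : ∃ v ∈ Inner H a ys, ∃ b ∈ D, v.map (f b) (g b) = w then hw.choose else w
    have πI : ∀ b ∈ D, ∀ v ∈ Inner H a ys, π (v.map (f b) (g b)) = v := by
      intro b hb v hv
      have hw : ∃ v' ∈ Inner H a ys, ∃ b' ∈ D, v'.map (f b') (g b') = v.map (f b) (g b) :=
        ⟨v, hv, b, hb, rfl⟩
      have h1 : π (v.map (f b) (g b)) = hw.choose := dif_pos hw
      obtain ⟨h2, b', hb', h3⟩ := hw.choose_spec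
      rw [h1]
      exact (hinj b' hb' b hb _ h2 v hv h3).2
    have πo : ∀ w, (∀ v ∈ Inner H a ys, ∀ b ∈ D, v.map (f b) (g b) ≠ w) → π w = w := by
      intro w hw
      refine dif_neg ?_
      rintro ⟨v, hv, b, hb, h1⟩
      exact hw v hv b hb h1
    have πK : ∀ k ∈ K, ∀ w, w ∈ k.src ∨ w ∈ k.tgt → π w = w := by
      intro k hk w hw
      refine πo w fun v hv b hb h1 => ?_
      subst h1
      exact hw.elim (hIK b hb v hv k hk).1 (hIK b hb v hv k hk).2
    have πD : ∀ b ∈ D, π (.m b) = .m b := fun b hb =>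
      πo _ fun v hv b' hb' => hID b' hb' v hv b hb
    have πy : ∀ y ∈ ys, π (.e y) = .e y := fun y hy =>
      πo _ fun v hv b' hb' => hIy b' hb' v hv y hy
    -- a node of a copy is the top of the copy, or its original is a node below `a`
    have πH : ∀ b ∈ D, ∀ h ∈ H, ∀ w, w ∈ (h.map (f b) (g b)).src ∨ w ∈ (h.map (f b) (g b)).tgt →
        (w = .m b ∧ Node.m a ∈ h.src) ∨ ((π w ∈ h.src ∨ π w ∈ h.tgt) ∧ π w ≠ .m a) := by
      rintro b hb h hh w (hw | hw)
      · rcases cs b hb h hh w hw with h1 | ⟨v, hv, hvI, rfl⟩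
        · exact .inl h1
        · rw [πI b hb v hvI]; exact .inr ⟨.inl hv, hvI.2.1⟩
      · rcases ct b hb h hh w hw with ⟨y, hy, rfl, -, h1⟩ | ⟨v, hv, hvI, rfl⟩
        · rw [πy y hy]; exact .inr ⟨.inr h1, by simp⟩
        · rw [πI b hb v hvI]; exact .inr ⟨.inr hv, hvI.2.1⟩
    have πt : ∀ b ∈ D, ∀ h ∈ H, ∀ w ∈ (h.map (f b) (g b)).tgt, π w ∈ h.tgt ∧ π w ≠ .m a := by
      intro b hb h hh w hw
      rcases ct b hb h hh w hw with ⟨y, hy, rfl, -, h1⟩ | ⟨v, hv, hvI, rfl⟩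
      · rw [πy y hy]; exact ⟨h1, by simp⟩
      · rw [πI b hb v hvI]; exact ⟨hv, hvI.2.1⟩
    have fD : ∀ b ∈ D, Relation.TransGen G.Flow (.m b) (.m a) := fun b hb =>
      .tail (.single (.link _ (hDL b hb) (hdp b) ((hds _ _).2 rfl) ((hdt _ _).2 rfl))) c.flow_bang
    refine fun v hv => hG.acyclic _ (hv.lift' π ?_)
    show ∀ u w, G'.Flow u w → Relation.TransGen G.Flow (π u) (π w)
    rintro u w (⟨l, hl, hlp, hu, hw⟩ | ⟨d, z, r, hp, l, hl, hw⟩)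
    · rcases hmem l hl with hk | ⟨b, hb, h, hh, rfl⟩
      · rw [πK l hk u (.inl hu), πK l hk w (.inr hw)]
        exact .single (.link l (hKL l hk) hlp hu hw)
      · obtain ⟨h1, h2⟩ := πt b hb h hh w hw
        rcases cs b hb h hh u hu with ⟨rfl, h3⟩ | ⟨v, hv, hvI, rfl⟩
        · rw [πD b hb]
          exact (fD b hb).tail (c.flow_m (mem_nodes_tgt hh h1) h2)
        · rw [πI b hb v hvI]
          exact .single (.link h (hHL h hh) (fun hc => hlp (Link.isPar_map.2 hc)) hv h1)
    · have hpp := Link.isPar_par d z r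
      rcases hpar _ hp hpp with hpK | ⟨b, hb, q, hq, hqp, heq⟩
      · rw [πK _ hpK (.m d) (.inl (by simp [Link.src]))]
        have hdL := hKL _ hpK
        rcases hmem l (bKm _ hpK hpp l hl) with hk | ⟨b, hb, h, hh, rfl⟩
        · rw [πK l hk w hw]
          exact .single (.box d z r hdL ⟨l, (bKK _ hpK hpp l hk).1 hl, hw⟩)
        · have hdb := (bKC _ hpK hpp b hb h hh).1 hl
          have fx : G.Flow (.m d) (.e x) :=
            .box d z r hdL (mem_nodes_tgt hdb ((hdt _ _).2 rfl))
          rcases πH b hb h hh w hw with ⟨rfl, -⟩ | ⟨h1, h2⟩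
          · rw [πD b hb]
            exact .single (.box d z r hdL (mem_nodes_src hdb ((hds _ _).2 rfl)))
          · exact .tail (.tail (.single fx) c.flow_bang) (c.flow_m ⟨h, hh, h1⟩ h2)
      · rw [heq] at hl
        obtain ⟨h, hh, hhq, rfl⟩ := bCm b hb q hq hqp l hl
        obtain ⟨d', z', r', rfl⟩ := hqp
        have hd : (Node.m d').map (f b) (g b) = .m d := by
          simp only [Link.map, Link.par.injEq] at heq
          simp [Node.map, heq.1]
        have hπw : (π w ∈ h.src ∨ π w ∈ h.tgt) ∧ π w ≠ .m a := by
          rcases πH b hb h hh w hw with ⟨-, h1⟩ | h1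
          · exact absurd hhq (c.top_notMem_box hq (Link.isPar_par ..) (hHL h hh) h1)
          · exact h1
        rcases hHs _ hq (.m d') (by simp [Link.src]) with h1 | h1
        · cases h1
          rw [htop b hb] at hd
          rw [← hd, πD b hb]
          exact (fD b hb).tail (c.flow_m ⟨h, hh, hπw.1⟩ hπw.2)
        · rw [← hd, πI b hb _ h1]
          exact .single (.box d' z' r' (hHL _ hq) ⟨h, hhq, hπw.1⟩)

end ExpCut

theorem Leveled.step {G G' : PreNet} (hG : Leveled ∅ G) (h : Step G G') : Leveled ∅ G' := by
  cases h with
  | mult s a u x r σ K hT hP hσ hK links root box =>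
    exact (MultCut.mk hG hT hP).leveled_step hσ hK links root box
  | expDer x a H ys D f g K hB hc hD hne hcopy hK links root box box_copy =>
    exact (ExpCut.mk hG hB hc).leveled_der hD hne hcopy hK links root box box_copy
  | expWeak x a H ys Y K hB hc hw hK hY links root box =>
    exact (ExpCut.mk hG hB hc).leveled_weak hw hK hY links root box

end CBVNet

theorem mainTheorem5 (G G' : CBVNet.PreNet) (hG : CBVNet.IsProofNet G)
    (hstep : CBVNet.Step G G') : CBVNet.Correct G' :=
  (hG.leveled.step hstep).correct
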